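/- Let $n\ge 1$ and let $g$ be a smooth Riemannian metric on $\mathbb R^n$ which is short-range asymptotically Euclidean: for $r=|z|$ sufficiently large and $\theta=z/|z|$, $$g=\sum_{i=1}^n (dz^i)^2+\frac{k_{ij}(r^{-1},\theta)\,dz^i\,dz^j}{r^2},$$ where the functions $k_{ij}$ are $C^\infty$ on $[0,\infty)\times S^{n-1}$ (up to the boundary $r^{-1}=0$). Assume that $g$ is nontrapping: $|\gamma(t)|\to\infty$ as $t\to+\infty$ and as $t\to-\infty$ for every nonconstant geodesic $\gamma$. Identify $\mathbb R^n\times S^{n-1}$ with the unit cosphere bundle $S^*\mathbb R^n$ of $g$ by sending $(z,\omega)$ to the positive multiple $\hat\zeta$ of $\omega$ with $g^{ij}(z)\hat\zeta_i\hat\zeta_j=1$. For $(z,\omega)\in\mathbb R^n\times S^{n-1}$ let $\gamma$ be the unit speed geodesic with $\gamma(0)=z$ and $\gamma'(0)^i=g^{ij}(z)\hat\zeta_j$. Then $\gamma$ exists for all time and is unique, the limits $$\theta=\lim_{t\to\infty}\frac{\gamma(t)}{|\gamma(t)|},\qquad \lambda=\lim_{t\to\infty}\bigl(t-|\gamma(t)|\bigr),\qquad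 \mu=\lim_{t\to\infty}|\gamma(t)|\Bigl(\theta-\frac{\gamma(t)}{|\gamma(t)|}\Bigr)$$ (asymptotic direction, sojourn time, angle of contact) exist, and the forward and backward sojourn maps $$S_f(z,\omega)=(\theta,\lambda\theta+\mu),\qquad S_b(z,\omega)=-S_f(z,-\omega)$$ are well defined maps $\mathbb R^n\times S^{n-1}\to S^{n-1}\times\mathbb R^n$. Endow $\mathbb R^n\times S^{n-1}$ with the contact structure given by the kernel of the canonical one-form $\sum_i\omega_i\,dz^i$ at $(z,\omega)$, and $S^{n-1}\times\mathbb R^n$ with the contact structure obtained from it by switching the two factors, i.e. the kernel of $\sum_i\theta_i\,d\xi^i$ at $(\theta,\xi)$. Then $S_f$ and $S_b$ are contact diffeomorphisms: they are $C^\infty$ diffeomorphisms whose differentials map the contact hyperplane at each point onto the contact hyperplane at the image point. -/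

import Mathlib

open Filter Topology Metric
open scoped Manifold ContDiff Matrix

noncomputable section

/-- Euclidean space `ℝⁿ` with its standard coordinates. -/
abbrev Euc (n : ℕ) : Type := EuclideanSpace ℝ (Fin n)

/-- The Euclidean unit sphere `S^{n-1} ⊆ ℝⁿ`. -/
abbrev Sph (n : ℕ) : Type := sphere (0 : Euc n) 1

/-- A metric on `ℝⁿ` in coordinates: `g z i j` is the component `g_{ij}(z)`. `IsMetric g` says that
`g` is a smooth Riemannian metric (`Matrix.PosDef` includes symmetry). -/
structure IsMetric {n : ℕ} (g : Euc n → Matrix (Fin n) (Fin n) ℝ) : Prop where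
  smooth : ∀ i j, ContDiff ℝ ∞ (fun z => g z i j)
  posDef : ∀ z, (g z).PosDef

/-- The short-range asymptotically Euclidean form of a metric near infinity:
`g = ∑ (dzⁱ)² + r⁻² k_{ij}(r⁻¹, θ) dzⁱ dzʲ` for `r = |z| ≫ 0`, `θ = z / |z|`, with `k_{ij}` smooth on
`[0, ∞) × S^{n-1}` up to the boundary `r⁻¹ = 0`. Smoothness on this closed subset of `ℝ × ℝⁿ` means,
as usual, being the restriction of a smooth function. -/
def IsShortRange {n : ℕ} (g : Euc n → Matrix (Fin n) (Fin n) ℝ) : Prop :=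
  ∃ R : ℝ, 0 < R ∧ ∃ k : Fin n → Fin n → ℝ × Euc n → ℝ,
    (∀ i j, ContDiff ℝ ∞ (k i j)) ∧
    ∀ z : Euc n, R < ‖z‖ → ∀ i j,
      g z i j = (if i = j then 1 else 0) + k i j (‖z‖⁻¹, ‖z‖⁻¹ • z) / ‖z‖ ^ 2

/-- The coordinate partial derivative `∂_i f (z)`. -/
def partialDeriv {n : ℕ} (i : Fin n) (f : Euc n → ℝ) (z : Euc n) : ℝ :=
  fderiv ℝ f z (EuclideanSpace.single i 1)

/-- The Christoffel symbols
`Γ^k_{ij} = ½ ∑_l g^{kl} (∂_i g_{jl} + ∂_j g_{il} - ∂_l g_{ij})` of `g`. -/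
def christoffel {n : ℕ} (g : Euc n → Matrix (Fin n) (Fin n) ℝ) (k i j : Fin n) (z : Euc n) : ℝ :=
  (1 / 2) * ∑ l, (g z)⁻¹ k l *
    (partialDeriv i (fun w => g w j l) z + partialDeriv j (fun w => g w i l) z
      - partialDeriv l (fun w => g w i j) z)

/-- `γ : ℝ → ℝⁿ` is a (complete, affinely parametrized) geodesic of `g`. -/
def IsGeodesic {n : ℕ} (g : Euc n → Matrix (Fin n) (Fin n) ℝ) (γ : ℝ → Euc n) : Prop :=
  ContDiff ℝ 2 γ ∧ ∀ t k,
    deriv (deriv γ) t k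
      + ∑ i, ∑ j, christoffel g k i j (γ t) * deriv γ t i * deriv γ t j = 0

/-- No trapped geodesics: every nonconstant geodesic escapes to infinity in both directions. -/
def IsNontrapping {n : ℕ} (g : Euc n → Matrix (Fin n) (Fin n) ℝ) : Prop :=
  ∀ γ : ℝ → Euc n, IsGeodesic g γ → deriv γ 0 ≠ 0 →
    Tendsto (fun t => ‖γ t‖) atTop atTop ∧ Tendsto (fun t => ‖γ t‖) atBot atTop

/-- The point of the `g`-unit cosphere over `z` in the direction `ω`. This is the identification
`ℝⁿ × S^{n-1} ≅ S*ℝⁿ`: the positive multiple `ζ` of `ω` with `g^{ij} ζ_i ζ_j = 1`. -/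
def unitCovector {n : ℕ} (g : Euc n → Matrix (Fin n) (Fin n) ℝ) (p : Euc n × Sph n) : Fin n → ℝ :=
  let u : Fin n → ℝ := fun i => (p.2 : Euc n) i
  (√(u ⬝ᵥ ((g p.1)⁻¹ *ᵥ u)))⁻¹ • u

/-- `γ` is the unit speed geodesic with `γ(0) = z` and `γ'(0)ⁱ = g^{ij} ζ_j`, where `ζ` is the unit
covector determined by `p = (z, ω)`. -/
def IsGeodesicFrom {n : ℕ} (g : Euc n → Matrix (Fin n) (Fin n) ℝ) (p : Euc n × Sph n)
    (γ : ℝ → Euc n) : Prop :=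
  IsGeodesic g γ ∧ γ 0 = p.1 ∧ ∀ i, deriv γ 0 i = ((g p.1)⁻¹ *ᵥ unitCovector g p) i

/-- `S_f(p) = q`: the geodesic `γ` issued from `p` has an asymptotic direction `θ`, a sojourn time
`lam` and an angle of contact `μ` (all three limits exist), and `q = (θ, lam θ + μ)`. -/
def IsForwardSojourn {n : ℕ} (g : Euc n → Matrix (Fin n) (Fin n) ℝ) (p : Euc n × Sph n)
    (q : Sph n × Euc n) : Prop :=
  ∃ (γ : ℝ → Euc n) (θ : Sph n) (lam : ℝ) (μ : Euc n), IsGeodesicFrom g p γ ∧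
    Tendsto (fun t => ‖γ t‖⁻¹ • γ t) atTop (𝓝 (θ : Euc n)) ∧
    Tendsto (fun t => t - ‖γ t‖) atTop (𝓝 lam) ∧
    Tendsto (fun t => ‖γ t‖ • ((θ : Euc n) - ‖γ t‖⁻¹ • γ t)) atTop (𝓝 μ) ∧
    q = (θ, lam • (θ : Euc n) + μ)

/-- `S_b(z, ω) = q`, where `S_b(z, ω) = -S_f(z, -ω)`. -/
def IsBackwardSojourn {n : ℕ} (g : Euc n → Matrix (Fin n) (Fin n) ℝ) (p : Euc n × Sph n)
    (q : Sph n × Euc n) : Prop :=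
  IsForwardSojourn g (p.1, -p.2) (-q)

/-- The model with corners of `ℝ^{n+1} × S^n`. -/
abbrev cosphereModel (n : ℕ) :=
  (𝓘(ℝ, Euc (n + 1))).prod (𝓡 n)

/-- The model with corners of `S^n × ℝ^{n+1}`. -/
abbrev switchedModel (n : ℕ) :=
  (𝓡 n).prod 𝓘(ℝ, Euc (n + 1))

/-- The canonical one-form `∑ ω_i dzⁱ` on `ℝ^{n+1} × S^n`, at the point `p = (z, ω)`. -/
def canonicalForm {n : ℕ} (p : Euc (n + 1) × Sph (n + 1)) :
    TangentSpace (cosphereModel n) p →L[ℝ] ℝ :=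
  (innerSL ℝ (p.2 : Euc (n + 1))).comp
    (mfderiv (cosphereModel n) 𝓘(ℝ, Euc (n + 1)) Prod.fst p)

/-- The contact structure of `ℝ^{n+1} × S^n`: the kernel of the canonical one-form. (Rescaling `ω`
to a `g`-unit covector multiplies the form by a positive function and does not change it.) -/
def cosphereContact {n : ℕ} (p : Euc (n + 1) × Sph (n + 1)) :
    Submodule ℝ (TangentSpace (cosphereModel n) p) :=
  LinearMap.ker (canonicalForm p).toLinearMap

/-- The contact structure of `S^n × ℝ^{n+1}`: that of `ℝ^{n+1} × S^n` pulled back by the switch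
`(θ, ξ) ↦ (ξ, θ)`, i.e. the kernel of `∑ θ_i dξⁱ`. -/
def switchedContact {n : ℕ} (q : Sph (n + 1) × Euc (n + 1)) :
    Submodule ℝ (TangentSpace (switchedModel n) q) :=
  (cosphereContact q.swap).comap
    (mfderiv (switchedModel n) (cosphereModel n) Prod.swap q).toLinearMap

/-- `S : ℝ^{n+1} × S^n → S^n × ℝ^{n+1}` is a contact diffeomorphism: a `C^∞` diffeomorphism whose
differential maps the contact hyperplane at each point onto the contact hyperplane at the image. -/
def IsContactDiffeomorphism {n : ℕ}
    (S : Euc (n + 1) × Sph (n + 1) → Sph (n + 1) × Euc (n + 1)) : Prop :=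
  (∃ Φ : (Euc (n + 1) × Sph (n + 1)) ≃ₘ^∞⟮cosphereModel n, switchedModel n⟯
      (Sph (n + 1) × Euc (n + 1)), ∀ p, Φ p = S p) ∧
  ∀ p, (cosphereContact p).map
      (mfderiv (cosphereModel n) (switchedModel n) S p).toLinearMap = switchedContact (S p)

end

/-! Along an escaping geodesic put `s = 1 / (t + 1)`, `v = γ'` and `y = γ - v / s`. The short-range
form of the metric says `g (w / s) = 1 + s² h (s, w)` with `h` smooth up to `s = 0` for `w ≠ 0`.
Differentiating in the position costs one more factor `s`, so the Christoffel term is `s³ A` with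
`A` smooth (`IsScatteringModel.accel_eq`), and the geodesic equation becomes `dv/ds = s A`, `dy/ds =
-A`. This field, `scatField`, is smooth across `s = 0`: infinity has become an ordinary initial
time.

Nontrapping gives `|γ| → ∞`, and convexity of `|γ|²` near infinity improves this to linear growth
(`exists_linear_escape`). Hence `w = s γ` stays away from `0`, the pair `(v, y)` converges as `s →
0`, and the geodesic is an integral curve on all of `[0, 1]` (`exists_isCurveIn_asympCurve`).
Conversely, each state with `v ≠ 0` at `s = 0` starts an integral curve, and geodesic completeness
carries it to `s = 1`, that is `t = 0` (`exists_isGeodesic_isCurveIn`). So the passage from data at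
`s = 1` to data at `s = 0` is a bijection by ODE uniqueness, and smooth both ways by smooth
dependence on initial values (`forward_smooth`, `backward_smooth`). In the limit, unit energy reads
`|v| = 1`. The limit state means `γ = t θ - ξ + o(1)`, and then `λ θ + μ = ξ`
(`tendsto_of_asymptotic_line`): the passage is the forward sojourn map.

For the contact property, let a unit-energy geodesic vary. The pairing `g (γ', δγ)` is constant in
time (`hasDerivAt_pairing`). At `t = 0` it is a positive multiple of `∑ ω_i dzⁱ`. Near infinity `δγ
= δv / s + δy`, whose first term looks singular, but unit energy forces `⟨v, δv⟩ = O(s²)`, so the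
pairing tends to `⟨θ, δy⟩ = -⟨θ, dξ⟩` (`pairing_eq`). The backward map is the forward map conjugated
by sign changes.

The map and its inverse are handled as restrictions of maps defined between vector spaces;
`isContactDiffeomorphism_of_ambient` transfers the results to the sphere bundles. Smooth dependence
itself comes from the implicit function theorem for the Picard equation in `C([0, 1], E)`. -/

noncomputable section

/-! ### Smoothness of the superposition operator `u ↦ f ∘ u` on continuous functions -/

section Superposition

universe u

variable {K : Type*} [TopologicalSpace K] [CompactSpace K]
  {E F : Type u} [NormedAddCommGroup E] [NormedSpace ℝ E] [NormedAddCommGroup F] [NormedSpace ℝ F]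

/-- Pointwise evaluation `(A, h) ↦ (t ↦ A t (h t))` as a continuous bilinear map. -/
def pointwiseApply (K : Type*) [TopologicalSpace K] [CompactSpace K] (E F : Type u)
    [NormedAddCommGroup E] [NormedSpace ℝ E] [NormedAddCommGroup F] [NormedSpace ℝ F] :
    C(K, E →L[ℝ] F) →L[ℝ] C(K, E) →L[ℝ] C(K, F) :=
  LinearMap.mkContinuous₂
    (LinearMap.mk₂ ℝ (fun (A : C(K, E →L[ℝ] F)) (h : C(K, E)) =>
      (⟨fun t => A t (h t), A.continuous.clm_apply h.continuous⟩ : C(K, F)))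
      (fun _ _ _ => by ext; simp) (fun _ _ _ => by ext; simp)
      (fun _ _ _ => by ext; simp) (fun _ _ _ => by ext; simp)) 1
    (fun A h => by
      rw [ContinuousMap.norm_le _ (by positivity)]
      intro t
      refine (ContinuousLinearMap.le_opNorm _ _).trans ?_
      rw [one_mul]
      gcongr
      exacts [A.norm_coe_le_norm t, h.norm_coe_le_norm t])

theorem norm_pointwiseApply_le (A : C(K, E →L[ℝ] F)) (h : C(K, E)) :
    ‖pointwiseApply K E F A h‖ ≤ ‖A‖ * ‖h‖ := by
  rw [ContinuousMap.norm_le _ (by positivity)]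
  intro t
  refine (ContinuousLinearMap.le_opNorm _ _).trans ?_
  gcongr
  exacts [A.norm_coe_le_norm t, h.norm_coe_le_norm t]

/-- The range of `u` is compact, so `fderiv ℝ f` is uniformly continuous there, with one `δ` for all
points of `K`. The mean value inequality on the balls of radius `δ` then makes the remainder
`o(‖h‖)` in the sup norm. -/
theorem hasFDerivAt_continuousMap_comp {f : E → F} (hf : ContDiff ℝ 1 f) (u : C(K, E)) :
    HasFDerivAt (fun u : C(K, E) => (⟨f, hf.continuous⟩ : C(E, F)).comp u)
      (pointwiseApply K E F
        ((⟨fderiv ℝ f, hf.continuous_fderiv one_ne_zero⟩ : C(E, E →L[ℝ] F)).comp u)) u := by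
  rw [hasFDerivAt_iff_isLittleO_nhds_zero, Asymptotics.isLittleO_iff]
  intro ε hε
  have hK : IsCompact (Set.range u) := isCompact_range u.continuous
  have huc := hK.uniformContinuousAt_of_continuousAt (fderiv ℝ f)
    (fun a _ => (hf.continuous_fderiv one_ne_zero).continuousAt) (Metric.dist_mem_uniformity hε)
  obtain ⟨δ, hδ, H⟩ := Metric.mem_uniformity_dist.1 huc
  filter_upwards [Metric.ball_mem_nhds (0 : C(K, E)) hδ] with h hh
  rw [mem_ball_zero_iff] at hh
  rw [ContinuousMap.norm_le _ (by positivity)]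
  intro t
  have key : ‖f (u t + h t) - f (u t) - fderiv ℝ f (u t) (u t + h t - u t)‖
      ≤ ε * ‖u t + h t - u t‖ := by
    refine (convex_ball (u t) δ).norm_image_sub_le_of_norm_hasFDerivWithin_le' (f' := fderiv ℝ f)
      (fun y _ => ((hf.differentiable one_ne_zero) y).hasFDerivAt.hasFDerivWithinAt)
      (fun y hy => ?_) (mem_ball_self hδ) ?_
    · have := H (a := u t) (b := y) (by rw [dist_comm]; exact hy) ⟨t, rfl⟩
      have h2 : dist (fderiv ℝ f (u t)) (fderiv ℝ f y) < ε := this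
      rw [dist_eq_norm, norm_sub_rev] at h2
      exact h2.le
    · rw [mem_ball, dist_eq_norm, add_sub_cancel_left]
      exact (h.norm_coe_le_norm t).trans_lt hh
  rw [add_sub_cancel_left] at key
  exact key.trans (mul_le_mul_of_nonneg_left (h.norm_coe_le_norm t) hε.le)

/-- The derivative is again a superposition operator, with `fderiv ℝ f` in place of `f`, followed by
a fixed continuous linear map. The target thus changes from `F` to `E →L[ℝ] F` at each step, which
is why `F` is quantified inside the induction and shares the universe of `E`. -/
theorem contDiff_nat_continuousMap_comp (n : ℕ) :
    ∀ {F : Type u} [NormedAddCommGroup F] [NormedSpace ℝ F] {f : E → F} (hf : ContDiff ℝ n f),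
      ContDiff ℝ n (fun u : C(K, E) => (⟨f, hf.continuous⟩ : C(E, F)).comp u) := by
  induction n with
  | zero =>
    intro F _ _ f hf
    exact contDiff_zero.2 (ContinuousMap.continuous_postcomp _)
  | succ n ih =>
    intro F _ _ f hf
    have h1 : ContDiff ℝ 1 f := hf.of_le (by norm_cast; omega)
    have hd : ContDiff ℝ n (fderiv ℝ f) := hf.fderiv_right (by norm_cast)
    refine contDiff_succ_iff_hasFDerivAt.2 ⟨_, ?_, hasFDerivAt_continuousMap_comp h1⟩
    exact (pointwiseApply K E F).contDiff.comp (ih hd)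

theorem contDiff_infty_continuousMap_comp {f : E → F} (hf : ContDiff ℝ ∞ f) :
    ContDiff ℝ ∞ (fun u : C(K, E) => (⟨f, hf.continuous⟩ : C(E, F)).comp u) :=
  contDiff_infty.2 fun n => contDiff_nat_continuousMap_comp n (contDiff_infty.1 hf n)

end Superposition

/-! ### The integration operator on `[0, 1]` -/

section Volterra

variable {E : Type*} [NormedAddCommGroup E] [NormedSpace ℝ E]

/-- Integration from `0` as an operator on continuous functions on `[0, 1]`. -/
def volterra (E : Type*) [NormedAddCommGroup E] [NormedSpace ℝ E] :
    C(unitInterval, E) →L[ℝ] C(unitInterval, E) :=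
  LinearMap.mkContinuous
    { toFun := fun w => ⟨fun t => ∫ r in (0 : ℝ)..t, w (Set.projIcc 0 1 zero_le_one r),
        ((intervalIntegral.continuous_primitive (fun a b => Continuous.intervalIntegrable
          (w.continuous.comp continuous_projIcc) a b) 0).comp continuous_subtype_val)⟩
      map_add' := fun w w' => by
        ext t
        exact intervalIntegral.integral_add
          ((w.continuous.comp continuous_projIcc).intervalIntegrable _ _)
          ((w'.continuous.comp continuous_projIcc).intervalIntegrable _ _)
      map_smul' := fun c w => by
        ext t
        exact intervalIntegral.integral_smul c _ } 1
    (fun w => by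
      rw [ContinuousMap.norm_le _ (by positivity)]
      intro t
      refine (intervalIntegral.norm_integral_le_of_norm_le_const (C := ‖w‖)
        (fun r _ => w.norm_coe_le_norm _)).trans ?_
      rw [sub_zero, abs_of_nonneg t.2.1, one_mul]
      exact mul_le_of_le_one_right (norm_nonneg _) t.2.2)

theorem norm_volterra_le (w : C(unitInterval, E)) : ‖volterra E w‖ ≤ ‖w‖ := by
  rw [ContinuousMap.norm_le _ (by positivity)]
  intro t
  refine (intervalIntegral.norm_integral_le_of_norm_le_const (C := ‖w‖)
    (fun r _ => w.norm_coe_le_norm _)).trans ?_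
  rw [sub_zero, abs_of_nonneg t.2.1]
  exact mul_le_of_le_one_right (norm_nonneg _) t.2.2

end Volterra

/-! ### Global integral curves -/

section GlobalCurves

variable {E : Type*} [NormedAddCommGroup E] [NormedSpace ℝ E]

/-- If a `C¹` vector field has integral curves through `x` on all intervals `(-T, T)`, it has a
global one. -/
theorem exists_global_integralCurve [CompleteSpace E] {f : E → E} (hf : ContDiff ℝ 1 f) (x : E)
    (h : ∀ T : ℝ, ∃ γ : ℝ → E, γ 0 = x ∧ ∀ t ∈ Set.Ioo (-T) T, HasDerivAt γ (f (γ t)) t) :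
    ∃ γ : ℝ → E, γ 0 = x ∧ ∀ t, HasDerivAt γ (f (γ t)) t := by
  have hv : ContMDiff 𝓘(ℝ, E) 𝓘(ℝ, E).tangent 1
      (fun x ↦ (⟨x, f x⟩ : TangentBundle 𝓘(ℝ, E) E)) :=
    contMDiff_vectorSpace_iff_contDiff.2 hf
  obtain ⟨γ, h0, hγ⟩ := (exists_isMIntegralCurve_iff_exists_isMIntegralCurveOn_Ioo hv x).2
    fun T => by
      obtain ⟨γ, h0, hγ⟩ := h T
      exact ⟨γ, h0, fun t ht => (hγ t ht).hasFDerivAt.hasMFDerivAt.hasMFDerivWithinAt⟩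
  exact ⟨γ, h0, fun t => by
    have h1 : HasFDerivAt γ ((1 : ℝ →L[ℝ] ℝ).smulRight (f (γ t)) : ℝ →L[ℝ] E) t :=
      hasMFDerivAt_iff_hasFDerivAt.1 (hγ t)
    simpa using h1.hasDerivAt⟩

theorem integralCurve_unique [CompleteSpace E] {f : E → E} (hf : ContDiff ℝ 1 f) {γ γ' : ℝ → E}
    (h : ∀ t, HasDerivAt γ (f (γ t)) t) (h' : ∀ t, HasDerivAt γ' (f (γ' t)) t) {t₀ : ℝ}
    (h0 : γ t₀ = γ' t₀) : γ = γ' := by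
  have hv : ContMDiff 𝓘(ℝ, E) 𝓘(ℝ, E).tangent 1
      (fun x ↦ (⟨x, f x⟩ : TangentBundle 𝓘(ℝ, E) E)) :=
    contMDiff_vectorSpace_iff_contDiff.2 hf
  exact isMIntegralCurve_Ioo_eq_of_contMDiff_boundaryless (v := fun x => f x) hv
    (fun t => (h t).hasFDerivAt.hasMFDerivAt) (fun t => (h' t).hasFDerivAt.hasMFDerivAt) h0

theorem exists_global_integralCurve_of_hasCompactSupport [CompleteSpace E] {f : E → E}
    (hf : ContDiff ℝ 1 f) (hc : HasCompactSupport f) (x : E) :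
    ∃ γ : ℝ → E, γ 0 = x ∧ ∀ t, HasDerivAt γ (f (γ t)) t := by
  obtain ⟨K, hK⟩ := hf.lipschitzWith_of_hasCompactSupport hc one_ne_zero
  obtain ⟨C, hC⟩ := hc.exists_bound_of_continuous hf.continuous
  refine exists_global_integralCurve hf x fun T => ?_
  rcases le_or_gt T 0 with hT | hT
  · exact ⟨fun _ => x, rfl, fun t ht => absurd (ht.1.trans ht.2) (by linarith)⟩
  have hC0 : 0 ≤ C := (norm_nonneg _).trans (hC 0)
  -- Since the field is bounded by `C` and Lipschitz everywhere, the ball may be taken of radius `C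
  -- * T`, and Picard–Lindelöf covers `[-T, T]` at once.
  have hpl : IsPicardLindelof (fun _ => f) (tmin := -T) (tmax := T)
      ⟨0, by simp [hT.le]⟩ x ⟨C * T, by positivity⟩ 0 ⟨C, hC0⟩ K :=
    IsPicardLindelof.of_time_independent (fun y _ => hC y) hK.lipschitzOnWith (by simp; rfl)
  obtain ⟨α, h0, hα⟩ := hpl.exists_eq_forall_mem_Icc_hasDerivWithinAt₀
  exact ⟨α, h0, fun t ht => (hα t (Set.Ioo_subset_Icc_self ht)).hasDerivAt
    (Icc_mem_nhds ht.1 ht.2)⟩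

end GlobalCurves

/-! ### Smoothness of flows by the implicit function theorem -/

section SmoothFlow

variable {E : Type*} [NormedAddCommGroup E] [NormedSpace ℝ E]

/-- Constant functions, as a continuous linear map. -/
def constCurve (E : Type*) [NormedAddCommGroup E] [NormedSpace ℝ E] :
    E →L[ℝ] C(unitInterval, E) :=
  LinearMap.mkContinuous
    { toFun := fun x => ContinuousMap.const _ x
      map_add' := fun _ _ => by ext; simp
      map_smul' := fun _ _ => by ext; simp } 1
    (fun x => by
      rw [ContinuousMap.norm_le _ (by positivity)]
      intro t
      simp)

/-- The defect `u - x - τ ∫₀ f(u)` whose zeros are the integral curves of `τ f` on `[0, 1]`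
starting at `x`. -/
def picardDefect (f : C(E, E)) (p : (ℝ × E) × C(unitInterval, E)) : C(unitInterval, E) :=
  p.2 - constCurve E p.1.2 - p.1.1 • volterra E (f.comp p.2)

theorem contDiff_picardDefect {f : E → E} (hf : ContDiff ℝ ∞ f) :
    ContDiff ℝ ∞ (picardDefect (⟨f, hf.continuous⟩ : C(E, E))) := by
  have h1 : ContDiff ℝ ∞ (fun u : C(unitInterval, E) => (⟨f, hf.continuous⟩ : C(E, E)).comp u) :=
    contDiff_infty_continuousMap_comp hf
  exact (contDiff_snd.sub ((constCurve E).contDiff.comp (contDiff_snd.comp contDiff_fst))).sub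
    ((contDiff_fst.comp contDiff_fst).smul
      ((volterra E).contDiff.comp (h1.comp contDiff_snd)))

/-- The partial derivative in the curve is the identity minus `τ` times a bounded operator, so a
Neumann series inverts it for small `τ`. -/
theorem fderiv_picardDefect_inr {f : E → E} (hf : ContDiff ℝ ∞ f)
    (p : (ℝ × E) × C(unitInterval, E)) :
    (fderiv ℝ (picardDefect (⟨f, hf.continuous⟩ : C(E, E))) p).comp
      (ContinuousLinearMap.inr ℝ (ℝ × E) C(unitInterval, E)) =
    1 - p.1.1 • (volterra E).comp (pointwiseApply unitInterval E E
      ((⟨fderiv ℝ f, hf.continuous_fderiv (by simp)⟩ : C(E, E →L[ℝ] E)).comp p.2)) := by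
  have h1 := HasFDerivAt.comp (f := fun v => (p.1, v)) p.2
    (((contDiff_picardDefect hf).differentiable (by simp)) p).hasFDerivAt
      (hasFDerivAt_prodMk_right p.1 p.2)
  have h2 : HasFDerivAt (fun v => picardDefect (⟨f, hf.continuous⟩ : C(E, E)) (p.1, v))
      (1 - p.1.1 • (volterra E).comp (pointwiseApply unitInterval E E
      ((⟨fderiv ℝ f, hf.continuous_fderiv (by simp)⟩ : C(E, E →L[ℝ] E)).comp p.2))) p.2 := by
    have h3 := (volterra E).hasFDerivAt.comp p.2
      (hasFDerivAt_continuousMap_comp (hf.of_le (by simp)) p.2)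
    exact ((hasFDerivAt_id (𝕜 := ℝ) p.2).sub_const (constCurve E p.1.2)).sub (h3.const_smul p.1.1)
  exact h1.unique h2

theorem isInvertible_one_sub {V : Type*} [NormedAddCommGroup V] [NormedSpace ℝ V] [CompleteSpace V]
    (A : V →L[ℝ] V) (hA : ‖A‖ < 1) : (1 - A).IsInvertible :=
  ⟨ContinuousLinearEquiv.unitsEquiv ℝ V (Units.oneSub A hA), by ext; rfl⟩

/-- The curve `σ ↦ Φ(σ τ, x)` on `[0, 1]`. -/
def flowCurve (Φ : ℝ × E → E) (hΦ : ∀ x, Continuous fun t => Φ (t, x)) (p : ℝ × E) :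
    C(unitInterval, E) :=
  ⟨fun σ => Φ (σ * p.1, p.2), (hΦ p.2).comp (by fun_prop)⟩

theorem picardDefect_flowCurve [CompleteSpace E] {f : E → E} (hf : Continuous f) {Φ : ℝ × E → E}
    (h0 : ∀ x, Φ (0, x) = x)
    (hΦ : ∀ x t, HasDerivAt (fun s => Φ (s, x)) (f (Φ (t, x))) t) (p : ℝ × E) :
    picardDefect ⟨f, hf⟩ (p, flowCurve Φ (fun x => continuous_iff_continuousAt.2
      fun t => (hΦ x t).continuousAt) p) = 0 := by
  ext σ
  have hc : Continuous fun s => Φ (s, p.2) := continuous_iff_continuousAt.2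
      fun t => (hΦ p.2 t).continuousAt
  have h1 : ∫ r in (0 : ℝ)..σ, p.1 • f (Φ (r * p.1, p.2)) = Φ (σ * p.1, p.2) - Φ (0 * p.1, p.2) := by
    refine intervalIntegral.integral_eq_sub_of_hasDerivAt (f := fun r => Φ (r * p.1, p.2))
      (fun r _ => ?_)
      (Continuous.intervalIntegrable ((hf.comp (hc.comp (by fun_prop))).const_smul _) _ _)
    have := (hΦ p.2 (r * p.1)).scomp r ((hasDerivAt_id r).mul_const p.1)
    simpa [Function.comp_def] using this
  have h2 : ∫ r in (0 : ℝ)..σ, f (Φ ((Set.projIcc (0 : ℝ) 1 zero_le_one r : ℝ) * p.1, p.2)) =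
      ∫ r in (0 : ℝ)..σ, f (Φ (r * p.1, p.2)) := by
    refine intervalIntegral.integral_congr fun r hr => ?_
    rw [Set.uIcc_of_le σ.2.1] at hr
    rw [Set.projIcc_of_mem _ ⟨hr.1, hr.2.trans σ.2.2⟩]
  rw [zero_mul, h0, intervalIntegral.integral_smul] at h1
  change Φ (σ * p.1, p.2) - p.2 - p.1 • (∫ r in (0 : ℝ)..σ,
    f (Φ ((Set.projIcc (0 : ℝ) 1 zero_le_one r : ℝ) * p.1, p.2))) = 0
  rw [h2, h1, sub_self]

/-- Two zeros differ by at most `|τ| L < 1` times their distance. This identifies the flow with the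
implicit function, which is only known to solve the equation. -/
theorem picardDefect_unique {f : E → E} {L : NNReal} (hL : LipschitzWith L f)
    {p : ℝ × E} (hp : |p.1| * L < 1) {u u' : C(unitInterval, E)}
    (hu : picardDefect ⟨f, hL.continuous⟩ (p, u) = 0)
    (hu' : picardDefect ⟨f, hL.continuous⟩ (p, u') = 0) : u = u' := by
  have e : u - u' = p.1 • volterra E
      ((⟨f, hL.continuous⟩ : C(E, E)).comp u - (⟨f, hL.continuous⟩ : C(E, E)).comp u') := by
    have h3 : picardDefect ⟨f, hL.continuous⟩ (p, u) - picardDefect ⟨f, hL.continuous⟩ (p, u') = 0 := by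
      rw [hu, hu', sub_zero]
    simp only [picardDefect] at h3
    rw [map_sub, smul_sub, ← sub_eq_zero, ← h3]
    abel
  have h1 : ‖(⟨f, hL.continuous⟩ : C(E, E)).comp u - (⟨f, hL.continuous⟩ : C(E, E)).comp u'‖
      ≤ L * ‖u - u'‖ := by
    rw [ContinuousMap.norm_le _ (by positivity)]
    intro t
    refine (hL.norm_sub_le (u t) (u' t)).trans ?_
    gcongr
    exact (u - u').norm_coe_le_norm t
  have h2 : ‖u - u'‖ ≤ (|p.1| * L) * ‖u - u'‖ := by
    conv_lhs => rw [e]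
    rw [norm_smul, Real.norm_eq_abs, mul_assoc]
    gcongr
    exact (norm_volterra_le _).trans h1
  have h3 : ‖u - u'‖ = 0 := by
    by_contra hne
    have hpos : 0 < ‖u - u'‖ := lt_of_le_of_ne (norm_nonneg _) (Ne.symm hne)
    nlinarith
  exact sub_eq_zero.1 (norm_eq_zero.1 h3)

/-- The flow of a smooth compactly supported vector field is globally defined and smooth. -/
theorem exists_contDiff_flow [CompleteSpace E] {f : E → E} (hf : ContDiff ℝ ∞ f)
    (hc : HasCompactSupport f) :
    ∃ Φ : ℝ × E → E, ContDiff ℝ ∞ Φ ∧ (∀ x, Φ (0, x) = x) ∧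
      ∀ x t, HasDerivAt (fun s => Φ (s, x)) (f (Φ (t, x))) t := by
  have hf1 : ContDiff ℝ 1 f := hf.of_le (by simp)
  obtain ⟨L, hL⟩ := hf.lipschitzWith_of_hasCompactSupport hc (by simp)
  choose γ h0 hγ using exists_global_integralCurve_of_hasCompactSupport hf1 hc
  let Φ : ℝ × E → E := fun p => γ p.2 p.1
  have hΦ : ∀ x t, HasDerivAt (fun s => Φ (s, x)) (f (Φ (t, x))) t := hγ
  have hadd : ∀ s t x, Φ (s + t, x) = Φ (s, Φ (t, x)) := by
    intro s t x
    have h1 : ∀ r, HasDerivAt (fun s => Φ (s + t, x)) (f (Φ (r + t, x))) r := fun r =>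
      (hΦ x (r + t)).comp_add_const r t
    have := integralCurve_unique hf1 (t₀ := 0) h1 (hΦ (Φ (t, x))) (by simp [Φ, h0])
    exact congrFun this s
  have hcont : ∀ x, Continuous fun t => Φ (t, x) := fun x => continuous_iff_continuousAt.2
      fun t => (hΦ x t).continuousAt
  -- For short times the whole curve `σ ↦ Φ (σ τ, x)` is locally the implicit function of the Picard
  -- defect; evaluation at `σ = 1` gives `Φ` itself.
  have hsmall : ∀ p : ℝ × E, |p.1| * L < 1 → ContDiffAt ℝ ∞ Φ p := by
    intro p hp
    let G := picardDefect (⟨f, hf.continuous⟩ : C(E, E))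
    have hG : ContDiffAt ℝ ∞ G (p, flowCurve Φ hcont p) := (contDiff_picardDefect hf).contDiffAt
    have hinv : (fderiv ℝ G (p, flowCurve Φ hcont p) ∘L .inr ℝ (ℝ × E)
        C(unitInterval, E)).IsInvertible := by
      rw [fderiv_picardDefect_inr hf]
      refine isInvertible_one_sub _ (lt_of_le_of_lt ?_ hp)
      refine ContinuousLinearMap.opNorm_le_bound _ (by positivity) fun h => ?_
      rw [_root_.smul_apply, norm_smul, Real.norm_eq_abs, mul_assoc]
      gcongr
      refine (norm_volterra_le _).trans ((norm_pointwiseApply_le _ _).trans ?_)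
      gcongr
      rw [ContinuousMap.norm_le _ (by positivity)]
      exact fun t => norm_fderiv_le_of_lipschitz ℝ hL
    have hψ := hG.contDiffAt_implicitFunction (by simp) hinv
    have heq : (fun q => flowCurve Φ hcont q) =ᶠ[𝓝 p] hG.implicitFunction (by simp) hinv := by
      have hopen : ∀ᶠ q : ℝ × E in 𝓝 p, |q.1| * L < 1 :=
        ContinuousAt.eventually_lt (by fun_prop) continuousAt_const hp
      filter_upwards [hG.eventually_apply_implicitFunction (by simp) hinv, hopen] with q hq hq1
      refine picardDefect_unique hL hq1 (picardDefect_flowCurve hf.continuous h0 hΦ q) ?_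
      exact hq.trans (picardDefect_flowCurve hf.continuous h0 hΦ p)
    have hU := hψ.congr_of_eventuallyEq heq
    have hev := (ContinuousMap.evalCLM ℝ (1 : unitInterval) :
      C(unitInterval, E) →L[ℝ] E).contDiff.contDiffAt.comp p hU
    refine hev.congr_of_eventuallyEq (Eventually.of_forall fun q => ?_)
    simp [flowCurve]
  -- The group law writes the time `j τ` map as a composition of `j` short-time maps, which removes
  -- the smallness of the time.
  have hmul : ∀ (j : ℕ) (p : ℝ × E), |p.1| * L < 1 →
      ContDiffAt ℝ ∞ (fun q : ℝ × E => Φ (j * q.1, q.2)) p := by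
    intro j
    induction j with
    | zero =>
      intro p _
      refine contDiffAt_snd.congr_of_eventuallyEq (Eventually.of_forall fun q => ?_)
      simp [Φ, h0]
    | succ j ih =>
      intro p hp
      have e : (fun q : ℝ × E => Φ ((j + 1 : ℕ) * q.1, q.2)) =
          fun q => Φ (q.1, Φ (j * q.1, q.2)) := by
        ext q
        rw [← hadd]
        push_cast
        ring_nf
      rw [e]
      exact ContDiffAt.comp p (hsmall (p.1, Φ (j * p.1, p.2)) hp) (contDiffAt_fst.prodMk (ih p hp))
  refine ⟨Φ, contDiff_iff_contDiffAt.2 fun p => ?_, h0, hΦ⟩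
  obtain ⟨j, hj⟩ := exists_nat_gt (|p.1| * L)
  have hjpos : (0 : ℝ) < j := lt_of_le_of_lt (by positivity) hj
  have hp : |p.1 / j| * L < 1 := by
    rw [abs_div, abs_of_pos hjpos, div_mul_eq_mul_div, div_lt_one hjpos]
    exact hj
  have h1 := ContDiffAt.comp p (g := fun q : ℝ × E => Φ (j * q.1, q.2))
    (f := fun q : ℝ × E => (q.1 / j, q.2)) (hmul j (p.1 / j, p.2) hp)
    ((contDiffAt_fst.div_const _).prodMk contDiffAt_snd)
  refine h1.congr_of_eventuallyEq (Eventually.of_forall fun q => ?_)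
  simp [mul_div_cancel₀, hjpos.ne']

end SmoothFlow

/-! ### Local uniqueness, smooth dependence and mixed partial derivatives -/

section LocalFlow

variable {E : Type*} [NormedAddCommGroup E] [NormedSpace ℝ E]

/-- A vector field that is smooth on an open set can be modified away from a given compact subset
to become smooth with compact support. -/
theorem exists_contDiff_hasCompactSupport_eqOn [FiniteDimensional ℝ E] {f : E → E} {U K : Set E}
    (hU : IsOpen U) (hf : ContDiffOn ℝ ∞ f U) (hK : IsCompact K) (hKU : K ⊆ U) :
    ∃ g : E → E, ContDiff ℝ ∞ g ∧ HasCompactSupport g ∧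
      ∃ V, IsOpen V ∧ K ⊆ V ∧ V ⊆ U ∧ Set.EqOn g f V := by
  have : ProperSpace E := FiniteDimensional.proper ℝ E
  obtain ⟨L, hL, hKL, hLU⟩ := exists_compact_between hK hU hKU
  obtain ⟨χ, h1, h0, -⟩ := exists_contMDiffMap_one_nhds_of_subset_interior (n := (⊤ : ℕ∞)) 𝓘(ℝ, E)
    hK.isClosed hKL
  have hχ : ContDiff ℝ ∞ χ := χ.contMDiff.contDiff
  refine ⟨fun x => χ x • f x, contDiff_iff_contDiffAt.2 fun x => ?_,
    HasCompactSupport.intro hL fun x hx => by simp [h0 x hx], ?_⟩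
  · by_cases hx : x ∈ U
    · exact hχ.contDiffAt.smul (hf.contDiffAt (hU.mem_nhds hx))
    · have hx' : Lᶜ ∈ 𝓝 x := hL.isClosed.isOpen_compl.mem_nhds fun h => hx (hLU h)
      refine (contDiffAt_const (c := (0 : E))).congr_of_eventuallyEq ?_
      filter_upwards [hx'] with y hy
      simp [h0 y hy]
  · obtain ⟨V, hV, hKV, hV1⟩ := mem_nhdsSet_iff_exists.1 h1
    refine ⟨V ∩ U, hV.inter hU, Set.subset_inter hKV hKU, Set.inter_subset_right, fun x hx => ?_⟩
    have : χ x = 1 := hV1 hx.1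
    simp [this]

/-- `u` is an integral curve of `f` on `[a, b]` that stays in `U`. -/
def IsCurveIn (f : E → E) (U : Set E) (a b : ℝ) (u : ℝ → E) : Prop :=
  ∀ t ∈ Set.Icc a b, u t ∈ U ∧ HasDerivWithinAt u (f (u t)) (Set.Icc a b) t

theorem IsCurveIn.continuousOn {f : E → E} {U : Set E} {a b : ℝ} {u : ℝ → E}
    (h : IsCurveIn f U a b u) : ContinuousOn u (Set.Icc a b) :=
  fun t ht => (h t ht).2.continuousWithinAt

theorem IsCurveIn.isCompact_image {f : E → E} {U : Set E} {a b : ℝ} {u : ℝ → E}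
    (h : IsCurveIn f U a b u) : IsCompact (u '' Set.Icc a b) :=
  isCompact_Icc.image_of_continuousOn h.continuousOn

theorem IsCurveIn.image_subset {f : E → E} {U : Set E} {a b : ℝ} {u : ℝ → E}
    (h : IsCurveIn f U a b u) : u '' Set.Icc a b ⊆ U := by
  rintro _ ⟨t, ht, rfl⟩
  exact (h t ht).1

theorem IsCurveIn.mono {f : E → E} {U : Set E} {a b a' b' : ℝ} {u : ℝ → E}
    (h : IsCurveIn f U a b u) (hab : Set.Icc a' b' ⊆ Set.Icc a b) : IsCurveIn f U a' b' u :=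
  fun t ht => ⟨(h t (hab ht)).1, (h t (hab ht)).2.mono hab⟩

/-- Both curves have compact image in `U`; cutting the field off outside a neighbourhood of these
images makes it globally Lipschitz, and Grönwall uniqueness applies on each side of `t₀`. -/
theorem IsCurveIn.eqOn [FiniteDimensional ℝ E] {f : E → E} {U : Set E} (hU : IsOpen U)
    (hf : ContDiffOn ℝ ∞ f U) {a b t₀ : ℝ} {u u' : ℝ → E} (h : IsCurveIn f U a b u)
    (h' : IsCurveIn f U a b u') (ht₀ : t₀ ∈ Set.Icc a b) (h0 : u t₀ = u' t₀) :
    Set.EqOn u u' (Set.Icc a b) := by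
  obtain ⟨g, hg, hgc, V, -, hKV, -, hgf⟩ := exists_contDiff_hasCompactSupport_eqOn hU hf
    (h.isCompact_image.union h'.isCompact_image) (Set.union_subset h.image_subset h'.image_subset)
  obtain ⟨L, hL⟩ := hg.lipschitzWith_of_hasCompactSupport hgc (by simp)
  have key : ∀ w : ℝ → E, IsCurveIn f U a b w → w '' Set.Icc a b ⊆ V →
      ∀ t ∈ Set.Icc a b, HasDerivWithinAt w (g (w t)) (Set.Icc a b) t := fun w hw hwV t ht => by
    rw [hgf (hwV ⟨t, ht, rfl⟩)]
    exact (hw t ht).2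
  have d := key u h (Set.subset_union_left.trans hKV)
  have d' := key u' h' (Set.subset_union_right.trans hKV)
  rw [← Set.Icc_union_Icc_eq_Icc ht₀.1 ht₀.2]
  have hr : Set.Ico t₀ b ⊆ Set.Ico a b := Set.Ico_subset_Ico_left ht₀.1
  have hl : Set.Ioc a t₀ ⊆ Set.Ioc a b := Set.Ioc_subset_Ioc_right ht₀.2
  refine Set.EqOn.union ?_ ?_
  · exact ODE_solution_unique_of_mem_Icc_left (s := fun _ => Set.univ) (v := fun _ => g) (K := L)
      (fun t _ => hL.lipschitzOnWith)
      (h.continuousOn.mono (Set.Icc_subset_Icc_right ht₀.2))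
      (fun t ht => (d t (Set.Ioc_subset_Icc_self (hl ht))).mono_of_mem_nhdsWithin
        (Icc_mem_nhdsLE_of_mem (hl ht)))
      (fun _ _ => trivial) (h'.continuousOn.mono (Set.Icc_subset_Icc_right ht₀.2))
      (fun t ht => (d' t (Set.Ioc_subset_Icc_self (hl ht))).mono_of_mem_nhdsWithin
        (Icc_mem_nhdsLE_of_mem (hl ht)))
      (fun _ _ => trivial) h0
  · exact ODE_solution_unique_of_mem_Icc_right (s := fun _ => Set.univ) (v := fun _ => g) (K := L)
      (fun t _ => hL.lipschitzOnWith)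
      (h.continuousOn.mono (Set.Icc_subset_Icc_left ht₀.1))
      (fun t ht => (d t (Set.Ico_subset_Icc_self (hr ht))).mono_of_mem_nhdsWithin
        (Icc_mem_nhdsGE_of_mem (hr ht)))
      (fun _ _ => trivial) (h'.continuousOn.mono (Set.Icc_subset_Icc_left ht₀.1))
      (fun t ht => (d' t (Set.Ico_subset_Icc_self (hr ht))).mono_of_mem_nhdsWithin
        (Icc_mem_nhdsGE_of_mem (hr ht)))
      (fun _ _ => trivial) h0

/-- Smooth dependence on the initial condition near a compact piece of an integral curve. -/
theorem IsCurveIn.exists_contDiff_flow [FiniteDimensional ℝ E] {f : E → E} {U : Set E}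
    (hU : IsOpen U) (hf : ContDiffOn ℝ ∞ f U) {a b t₀ : ℝ} {u : ℝ → E} (h : IsCurveIn f U a b u)
    (ht₀ : t₀ ∈ Set.Icc a b) :
    ∃ Φ : ℝ × E → E, ContDiff ℝ ∞ Φ ∧ (∀ x, Φ (t₀, x) = x) ∧
      (∀ t ∈ Set.Icc a b, Φ (t, u t₀) = u t) ∧
      ∀ t ∈ Set.Icc a b, ∀ᶠ p in 𝓝 (t, u t₀),
        Φ p ∈ U ∧ HasDerivAt (fun s => Φ (s, p.2)) (f (Φ p)) p.1 := by
  have : CompleteSpace E := FiniteDimensional.complete ℝ E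
  obtain ⟨g, hg, hgc, V, hV, hKV, hVU, hgf⟩ := exists_contDiff_hasCompactSupport_eqOn hU hf
    h.isCompact_image h.image_subset
  obtain ⟨Ψ, hΨ, hΨ0, hΨd⟩ := _root_.exists_contDiff_flow hg hgc
  let Φ : ℝ × E → E := fun p => Ψ (p.1 - t₀, p.2)
  have hΦ : ContDiff ℝ ∞ Φ := hΨ.comp ((contDiff_fst.sub contDiff_const).prodMk contDiff_snd)
  have hΦd : ∀ x t, HasDerivAt (fun s => Φ (s, x)) (g (Φ (t, x))) t := fun x t =>
    (hΨd x (t - t₀)).comp_sub_const t t₀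
  have hΦ0 : ∀ x, Φ (t₀, x) = x := fun x => by simp [Φ, hΨ0]
  have hu : ∀ t ∈ Set.Icc a b, Φ (t, u t₀) = u t := by
    have c1 : IsCurveIn g Set.univ a b u := fun t ht => ⟨trivial, by
      rw [hgf (hKV ⟨t, ht, rfl⟩)]
      exact (h t ht).2⟩
    have c2 : IsCurveIn g Set.univ a b (fun t => Φ (t, u t₀)) := fun t ht =>
      ⟨trivial, (hΦd _ t).hasDerivWithinAt⟩
    exact c2.eqOn isOpen_univ hg.contDiffOn c1 ht₀ (hΦ0 _)
  refine ⟨Φ, hΦ, hΦ0, hu, fun t ht => ?_⟩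
  have hmem : Φ (t, u t₀) ∈ V := by
    rw [hu t ht]
    exact hKV ⟨t, ht, rfl⟩
  filter_upwards [hΦ.continuous.continuousAt.preimage_mem_nhds (hV.mem_nhds hmem)] with p hp
  refine ⟨hVU hp, ?_⟩
  rw [← hgf hp]
  exact hΦd p.2 p.1

/-- Mixed partial derivatives commute. -/
theorem hasDerivAt_fderiv_of_eventually {F : Type*} [NormedAddCommGroup F] [NormedSpace ℝ F]
    {f D : ℝ × E → F} {t₀ : ℝ} {x₀ : E} (hf : ContDiffAt ℝ 2 f (t₀, x₀))
    (hD : ∀ᶠ p in 𝓝 (t₀, x₀), HasDerivAt (fun s => f (s, p.2)) (D p) p.1) (h : E) :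
    HasDerivAt (fun s => fderiv ℝ (fun x => f (s, x)) x₀ h)
      (fderiv ℝ (fun x => D (t₀, x)) x₀ h) t₀ := by
  have hev : ∀ᶠ p in 𝓝 (t₀, x₀), DifferentiableAt ℝ f p :=
    (hf.eventually (by simp)).mono fun p hp => hp.differentiableAt (by simp)
  have hd2 : HasFDerivAt (fderiv ℝ f) (fderiv ℝ (fderiv ℝ f) (t₀, x₀)) (t₀, x₀) :=
    ((hf.fderiv_right (m := 1) (by norm_num)).differentiableAt (by simp)).hasFDerivAt
  have hcont1 : Tendsto (fun s : ℝ => (s, x₀)) (𝓝 t₀) (𝓝 (t₀, x₀)) :=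
    (Continuous.prodMk_left x₀).tendsto t₀
  have hcont2 : Tendsto (fun x : E => (t₀, x)) (𝓝 x₀) (𝓝 (t₀, x₀)) :=
    (Continuous.prodMk_right t₀).tendsto x₀
  -- Both partial derivatives are values of the full derivative, at `(0, h)` and at `(1, 0)`, so the
  -- claim reduces to the symmetry of the second derivative.
  have e1 : (fun s => fderiv ℝ (fun x => f (s, x)) x₀ h) =ᶠ[𝓝 t₀]
      fun s => fderiv ℝ f (s, x₀) (0, h) := by
    filter_upwards [hcont1.eventually hev] with s hs
    have := HasFDerivAt.comp (f := fun x => (s, x)) x₀ hs.hasFDerivAt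
      (hasFDerivAt_prodMk_right s x₀)
    exact congrArg (fun A : E →L[ℝ] F => A h) this.fderiv
  have e2 : (fun x => D (t₀, x)) =ᶠ[𝓝 x₀] fun x => fderiv ℝ f (t₀, x) (1, 0) := by
    filter_upwards [hcont2.eventually hev, hcont2.eventually hD] with x hx hDx
    have h1 := hx.hasFDerivAt.comp_hasDerivAt_of_eq t₀
      ((hasDerivAt_id t₀).prodMk (hasDerivAt_const t₀ x)) rfl
    exact hDx.unique h1
  rw [e2.fderiv_eq]
  have d1 : HasDerivAt (fun s => fderiv ℝ f (s, x₀) (0, h))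
      (fderiv ℝ (fderiv ℝ f) (t₀, x₀) (1, 0) (0, h)) t₀ := by
    have h1 := hd2.comp_hasDerivAt_of_eq t₀
      ((hasDerivAt_id t₀).prodMk (hasDerivAt_const t₀ x₀)) rfl
    exact ((ContinuousLinearMap.apply ℝ F ((0, h) : ℝ × E)).hasFDerivAt.comp_hasDerivAt t₀ h1)
  have d2 : HasFDerivAt (fun x => fderiv ℝ f (t₀, x) (1, 0))
      (((ContinuousLinearMap.apply ℝ F ((1, 0) : ℝ × E)).comp
        (fderiv ℝ (fderiv ℝ f) (t₀, x₀))).comp (ContinuousLinearMap.inr ℝ ℝ E)) x₀ := by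
    have h1 := HasFDerivAt.comp (f := fun x => (t₀, x)) x₀ hd2 (hasFDerivAt_prodMk_right t₀ x₀)
    exact (ContinuousLinearMap.apply ℝ F ((1, 0) : ℝ × E)).hasFDerivAt.comp x₀ h1
  rw [d2.fderiv]
  have hs := hf.isSymmSndFDerivAt (by simp) (0, h) (1, 0)
  refine (d1.congr_of_eventuallyEq e1).congr_deriv ?_
  rw [← hs]
  rfl

end LocalFlow

/-! ### Quadratic forms and Christoffel terms as finite sums -/

section MetricAlgebra

variable {N : ℕ}

/-- The bilinear form of a matrix. -/
def matForm (Q : Matrix (Fin N) (Fin N) ℝ) (v w : Euc N) : ℝ := ∑ i, ∑ j, Q i j * v i * w j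

/-- The trilinear form of an array of coefficients. -/
def triForm (D : Fin N → Fin N → Fin N → ℝ) (u v w : Euc N) : ℝ :=
  ∑ m, ∑ i, ∑ j, D m i j * u m * v i * w j

/-- The lowered quadratic Christoffel term `½ (D i j l + D j i l - D l i j) vⁱ vʲ`. -/
def loweredAccel (D : Fin N → Fin N → Fin N → ℝ) (v : Euc N) (l : Fin N) : ℝ :=
  ∑ i, ∑ j, (1 / 2) * (D i j l + D j i l - D l i j) * v i * v j

/-- The quadratic Christoffel term `Γᵏᵢⱼ vⁱ vʲ` of a metric with matrix `Q` and first derivatives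
`D i j l = ∂ᵢ Q j l`. -/
def accel (Q : Matrix (Fin N) (Fin N) ℝ) (D : Fin N → Fin N → Fin N → ℝ) (v : Euc N) : Euc N :=
  WithLp.toLp 2 (Q⁻¹ *ᵥ loweredAccel D v)

/-- The first derivatives `∂ᵢ g j l` at `z`. -/
def metricDeriv (g : Euc N → Matrix (Fin N) (Fin N) ℝ) (z : Euc N) (i j l : Fin N) : ℝ :=
  partialDeriv i (fun w => g w j l) z

theorem matForm_eq_dotProduct (Q : Matrix (Fin N) (Fin N) ℝ) (v w : Euc N) :
    matForm Q v w = v.ofLp ⬝ᵥ (Q *ᵥ w.ofLp) := by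
  simp only [matForm, dotProduct, Matrix.mulVec, Finset.mul_sum]
  refine Finset.sum_congr rfl fun i _ => Finset.sum_congr rfl fun j _ => by ring

theorem matForm_comm {Q : Matrix (Fin N) (Fin N) ℝ} (hQ : Q.IsSymm) (v w : Euc N) :
    matForm Q v w = matForm Q w v := by
  rw [matForm, Finset.sum_comm, matForm]
  refine Finset.sum_congr rfl fun i _ => Finset.sum_congr rfl fun j _ => ?_
  rw [hQ.apply i j]
  ring

theorem matForm_add_right (Q : Matrix (Fin N) (Fin N) ℝ) (u v w : Euc N) :
    matForm Q u (v + w) = matForm Q u v + matForm Q u w := by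
  simp only [matForm, ← Finset.sum_add_distrib, PiLp.add_apply]
  refine Finset.sum_congr rfl fun i _ => Finset.sum_congr rfl fun j _ => by ring

theorem matForm_smul_left (Q : Matrix (Fin N) (Fin N) ℝ) (c : ℝ) (v w : Euc N) :
    matForm Q (c • v) w = c * matForm Q v w := by
  simp only [matForm, Finset.mul_sum, PiLp.smul_apply, smul_eq_mul]
  refine Finset.sum_congr rfl fun i _ => Finset.sum_congr rfl fun j _ => by ring

theorem matForm_smul_right (Q : Matrix (Fin N) (Fin N) ℝ) (c : ℝ) (v w : Euc N) :
    matForm Q v (c • w) = c * matForm Q v w := by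
  simp only [matForm, Finset.mul_sum, PiLp.smul_apply, smul_eq_mul]
  refine Finset.sum_congr rfl fun i _ => Finset.sum_congr rfl fun j _ => by ring

theorem triForm_smul₁ (D : Fin N → Fin N → Fin N → ℝ) (c : ℝ) (u v w : Euc N) :
    triForm D (c • u) v w = c * triForm D u v w := by
  simp only [triForm, Finset.mul_sum, PiLp.smul_apply, smul_eq_mul]
  refine Finset.sum_congr rfl fun i _ => Finset.sum_congr rfl fun j _ =>
    Finset.sum_congr rfl fun k _ => by ring

theorem matForm_one (v w : Euc N) : matForm 1 v w = inner ℝ v w := by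
  rw [matForm_eq_dotProduct, Matrix.one_mulVec, EuclideanSpace.inner_eq_star_dotProduct,
    star_trivial, dotProduct_comm]

theorem matForm_pos {Q : Matrix (Fin N) (Fin N) ℝ} (hQ : Q.PosDef) {v : Euc N} (hv : v ≠ 0) :
    0 < matForm Q v v := by
  rw [matForm_eq_dotProduct]
  have := hQ.dotProduct_mulVec_pos (x := v.ofLp) (fun h => hv (by ext i; exact congrFun h i))
  simpa using this

theorem Matrix.PosDef.isSymm {Q : Matrix (Fin N) (Fin N) ℝ} (hQ : Q.PosDef) : Q.IsSymm := by
  have := hQ.isHermitian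
  rwa [Matrix.IsHermitian, Matrix.conjTranspose_eq_transpose_of_trivial] at this

/-- Pairing with `Q` cancels `Q⁻¹`, and the first two Christoffel terms coincide after contraction
with `vⁱ vʲ`. In this form the conservation laws below need no inverse matrix. -/
theorem matForm_accel {Q : Matrix (Fin N) (Fin N) ℝ} (hQ : Q.IsSymm) (hdet : Q.det ≠ 0)
    (D : Fin N → Fin N → Fin N → ℝ) (v η : Euc N) :
    matForm Q (accel Q D v) η = triForm D v v η - 1 / 2 * triForm D η v v := by
  have h1 : matForm Q (accel Q D v) η = ∑ l, loweredAccel D v l * η l := by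
    rw [matForm_comm hQ, matForm_eq_dotProduct, accel]
    simp only
    rw [Matrix.mulVec_mulVec, Matrix.mul_nonsing_inv _ (isUnit_iff_ne_zero.2 hdet),
      Matrix.one_mulVec, dotProduct_comm]
    rfl
  have h2 : ∀ l, loweredAccel D v l = ∑ i, ∑ j, D i j l * v i * v j -
      1 / 2 * ∑ i, ∑ j, D l i j * v i * v j := by
    intro l
    have h3 : ∑ i, ∑ j, D j i l * v i * v j = ∑ i, ∑ j, D i j l * v i * v j := by
      rw [Finset.sum_comm]
      refine Finset.sum_congr rfl fun i _ => Finset.sum_congr rfl fun j _ => by ring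
    have h4 : loweredAccel D v l = 1 / 2 * ∑ i, ∑ j, D i j l * v i * v j +
        1 / 2 * ∑ i, ∑ j, D j i l * v i * v j - 1 / 2 * ∑ i, ∑ j, D l i j * v i * v j := by
      simp only [loweredAccel, Finset.mul_sum, ← Finset.sum_add_distrib, ← Finset.sum_sub_distrib]
      refine Finset.sum_congr rfl fun i _ => Finset.sum_congr rfl fun j _ => by ring
    rw [h4, h3]
    ring
  rw [h1]
  simp only [h2, sub_mul, Finset.sum_sub_distrib, triForm]
  congr 1
  · simp only [Finset.sum_mul]
    rw [Finset.sum_comm]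
    refine Finset.sum_congr rfl fun i _ => ?_
    rw [Finset.sum_comm]
  · simp only [Finset.sum_mul, Finset.mul_sum]
    refine Finset.sum_congr rfl fun i _ => Finset.sum_congr rfl fun j _ =>
      Finset.sum_congr rfl fun k _ => by ring

theorem accel_smul_coeff (Q : Matrix (Fin N) (Fin N) ℝ) (c : ℝ) (D : Fin N → Fin N → Fin N → ℝ)
    (v : Euc N) : accel Q (fun i j l => c * D i j l) v = c • accel Q D v := by
  have : loweredAccel (fun i j l => c * D i j l) v = c • loweredAccel D v := by
    ext l
    simp only [loweredAccel, Pi.smul_apply, smul_eq_mul, Finset.mul_sum]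
    refine Finset.sum_congr rfl fun i _ => Finset.sum_congr rfl fun j _ => by ring
  rw [accel, this, Matrix.mulVec_smul]
  rfl

theorem accel_smul (Q : Matrix (Fin N) (Fin N) ℝ) (c : ℝ) (D : Fin N → Fin N → Fin N → ℝ)
    (v : Euc N) : accel Q D (c • v) = c ^ 2 • accel Q D v := by
  have : loweredAccel D (c • v) = c ^ 2 • loweredAccel D v := by
    ext l
    simp only [loweredAccel, Pi.smul_apply, PiLp.smul_apply, smul_eq_mul, Finset.mul_sum]
    refine Finset.sum_congr rfl fun i _ => Finset.sum_congr rfl fun j _ => by ring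
  rw [accel, this, Matrix.mulVec_smul]
  rfl

theorem sum_christoffel (g : Euc N → Matrix (Fin N) (Fin N) ℝ) (z v : Euc N) (k : Fin N) :
    ∑ i, ∑ j, christoffel g k i j z * v i * v j = accel (g z) (metricDeriv g z) v k := by
  simp only [christoffel, accel, Matrix.mulVec, dotProduct, loweredAccel, Finset.mul_sum,
    Finset.sum_mul, metricDeriv]
  have h1 : ∀ F : Fin N → Fin N → Fin N → ℝ, ∑ i, ∑ j, ∑ l, F i j l = ∑ l, ∑ i, ∑ j, F i j l := by
    intro F
    rw [Finset.sum_comm]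
    refine (Finset.sum_congr rfl fun i _ => Finset.sum_comm).trans ?_
    rw [Finset.sum_comm]
    refine Finset.sum_congr rfl fun l _ => Finset.sum_comm
  rw [h1]
  refine Finset.sum_congr rfl fun l _ => Finset.sum_congr rfl fun i _ =>
    Finset.sum_congr rfl fun j _ => by ring

section Smoothness

variable {X : Type*} [NormedAddCommGroup X] [NormedSpace ℝ X] {n : WithTop ℕ∞} {x : X}

theorem contDiffAt_det {ι : Type*} [Fintype ι] [DecidableEq ι] {Q : X → Matrix ι ι ℝ}
    (hQ : ∀ i j, ContDiffAt ℝ n (fun x => Q x i j) x) : ContDiffAt ℝ n (fun x => (Q x).det) x := by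
  simp only [Matrix.det_apply']
  exact ContDiffAt.sum fun σ _ => contDiffAt_const.mul (contDiffAt_prod fun i _ => hQ _ _)

/-- By the adjugate formula the entries of the inverse are polynomials in the entries of `Q` divided
by the determinant. -/
theorem contDiffAt_inv_apply {Q : X → Matrix (Fin N) (Fin N) ℝ}
    (hQ : ∀ i j, ContDiffAt ℝ n (fun x => Q x i j) x) (hdet : (Q x).det ≠ 0) (k l : Fin N) :
    ContDiffAt ℝ n (fun x => (Q x)⁻¹ k l) x := by
  simp only [Matrix.inv_def, Ring.inverse_eq_inv', Matrix.smul_apply, smul_eq_mul,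
    Matrix.adjugate_apply]
  refine ((contDiffAt_det hQ).inv hdet).mul (contDiffAt_det fun i j => ?_)
  by_cases h : i = l
  · subst h
    simp only [Matrix.updateRow_self]
    exact contDiffAt_const
  · simp only [Matrix.updateRow_ne h]
    exact hQ i j

theorem contDiffAt_coord {v : X → Euc N} (hv : ContDiffAt ℝ n v x) (i : Fin N) :
    ContDiffAt ℝ n (fun x => v x i) x := contDiffAt_euclidean.1 hv i

theorem contDiffAt_accel {Q : X → Matrix (Fin N) (Fin N) ℝ} {D : X → Fin N → Fin N → Fin N → ℝ}
    {v : X → Euc N} (hQ : ∀ i j, ContDiffAt ℝ n (fun x => Q x i j) x) (hdet : (Q x).det ≠ 0)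
    (hD : ∀ i j l, ContDiffAt ℝ n (fun x => D x i j l) x) (hv : ContDiffAt ℝ n v x) :
    ContDiffAt ℝ n (fun x => accel (Q x) (D x) (v x)) x := by
  rw [contDiffAt_euclidean]
  intro k
  simp only [accel, Matrix.mulVec, dotProduct, loweredAccel]
  exact ContDiffAt.sum fun l _ => (contDiffAt_inv_apply hQ hdet k l).mul
    (ContDiffAt.sum fun i _ => ContDiffAt.sum fun j _ =>
      ((contDiffAt_const.mul (((hD i j l).add (hD j i l)).sub (hD l i j))).mul
        (contDiffAt_coord hv i)).mul (contDiffAt_coord hv j))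

theorem contDiffAt_matForm {Q : X → Matrix (Fin N) (Fin N) ℝ} {v w : X → Euc N}
    (hQ : ∀ i j, ContDiffAt ℝ n (fun x => Q x i j) x) (hv : ContDiffAt ℝ n v x)
    (hw : ContDiffAt ℝ n w x) : ContDiffAt ℝ n (fun x => matForm (Q x) (v x) (w x)) x := by
  simp only [matForm]
  exact ContDiffAt.sum fun i _ => ContDiffAt.sum fun j _ =>
    ((hQ i j).mul (contDiffAt_coord hv i)).mul (contDiffAt_coord hw j)

end Smoothness

theorem fderiv_eq_sum_partialDeriv (f : Euc N → ℝ) (z u : Euc N) :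
    fderiv ℝ f z u = ∑ m, partialDeriv m f z * u m := by
  have h : u = ∑ m, u m • EuclideanSpace.single m (1 : ℝ) := by
    ext i
    simp [Pi.single_apply]
  conv_lhs => rw [h, map_sum]
  refine Finset.sum_congr rfl fun m _ => ?_
  rw [map_smul, smul_eq_mul, mul_comm]
  rfl

theorem hasDerivAt_coord {v : ℝ → Euc N} {v' : Euc N} {t : ℝ} (hv : HasDerivAt v v' t)
    (i : Fin N) : HasDerivAt (fun t => v t i) (v' i) t := 
  (EuclideanSpace.proj i : Euc N →L[ℝ] ℝ).hasFDerivAt.comp_hasDerivAt t hv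

theorem hasDerivAt_matForm {g : Euc N → Matrix (Fin N) (Fin N) ℝ} {z a b : ℝ → Euc N}
    {z' a' b' : Euc N} {t : ℝ} (hg : ∀ i j, DifferentiableAt ℝ (fun w => g w i j) (z t))
    (hz : HasDerivAt z z' t) (ha : HasDerivAt a a' t) (hb : HasDerivAt b b' t) :
    HasDerivAt (fun t => matForm (g (z t)) (a t) (b t))
      (triForm (metricDeriv g (z t)) z' (a t) (b t) + matForm (g (z t)) a' (b t) +
        matForm (g (z t)) (a t) b') t := by
  have h1 : ∀ i j, HasDerivAt (fun t => g (z t) i j)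
      (∑ m, metricDeriv g (z t) m i j * z' m) t := by
    intro i j
    have := (hg i j).hasFDerivAt.comp_hasDerivAt t hz
    rw [fderiv_eq_sum_partialDeriv] at this
    exact this
  have h2 : HasDerivAt (fun t => matForm (g (z t)) (a t) (b t)) (∑ i, ∑ j,
      (((∑ m, metricDeriv g (z t) m i j * z' m) * a t i + g (z t) i j * a' i) * b t j +
        g (z t) i j * a t i * b' j)) t :=
    HasDerivAt.fun_sum fun i _ => HasDerivAt.fun_sum fun j _ =>
      ((h1 i j).mul (hasDerivAt_coord ha i)).mul (hasDerivAt_coord hb j)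
  refine h2.congr_deriv ?_
  have h3 : triForm (metricDeriv g (z t)) z' (a t) (b t) =
      ∑ i, ∑ j, (∑ m, metricDeriv g (z t) m i j * z' m) * a t i * b t j := by
    simp only [triForm, Finset.sum_mul]
    rw [Finset.sum_comm]
    refine Finset.sum_congr rfl fun i _ => ?_
    rw [Finset.sum_comm]
  rw [h3]
  simp only [matForm, ← Finset.sum_add_distrib]
  refine Finset.sum_congr rfl fun i _ => Finset.sum_congr rfl fun j _ => by ring

end MetricAlgebra

/-! ### Derivatives of the components of a curve in a product -/

section ProdDeriv

variable {A B : Type*} [NormedAddCommGroup A] [NormedSpace ℝ A] [NormedAddCommGroup B]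
  [NormedSpace ℝ B] {u : ℝ → A × B} {u' : A × B} {s : Set ℝ} {t : ℝ}

theorem hasDerivAt_prod_fst (h : HasDerivAt u u' t) : HasDerivAt (fun t => (u t).1) u'.1 t :=
  (ContinuousLinearMap.fst ℝ A B).hasFDerivAt.comp_hasDerivAt t h

theorem hasDerivAt_prod_snd (h : HasDerivAt u u' t) : HasDerivAt (fun t => (u t).2) u'.2 t :=
  (ContinuousLinearMap.snd ℝ A B).hasFDerivAt.comp_hasDerivAt t h

theorem hasDerivWithinAt_prod_fst (h : HasDerivWithinAt u u' s t) :
    HasDerivWithinAt (fun t => (u t).1) u'.1 s t :=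
  (ContinuousLinearMap.fst ℝ A B).hasFDerivAt.comp_hasDerivWithinAt t h

theorem hasDerivWithinAt_prod_snd (h : HasDerivWithinAt u u' s t) :
    HasDerivWithinAt (fun t => (u t).2) u'.2 s t :=
  (ContinuousLinearMap.snd ℝ A B).hasFDerivAt.comp_hasDerivWithinAt t h

end ProdDeriv

/-! ### The geodesic field, energy conservation and completeness -/

section Geodesics

variable {N : ℕ} {g : Euc N → Matrix (Fin N) (Fin N) ℝ}

theorem IsMetric.isSymm (hg : IsMetric g) (z : Euc N) : (g z).IsSymm := (hg.posDef z).isSymm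

theorem IsMetric.det_ne_zero (hg : IsMetric g) (z : Euc N) : (g z).det ≠ 0 :=
  (hg.posDef z).det_pos.ne'

theorem IsMetric.differentiableAt (hg : IsMetric g) (z : Euc N) (i j : Fin N) :
    DifferentiableAt ℝ (fun w => g w i j) z := (hg.smooth i j).differentiable (by simp) z

theorem contDiffAt_partialDeriv {f : Euc N → ℝ} {z : Euc N} (hf : ContDiffAt ℝ ∞ f z)
    (i : Fin N) : ContDiffAt ℝ ∞ (partialDeriv i f) z :=
  (hf.fderiv_right (m := ∞) (by simp)).clm_apply contDiffAt_const

/-- The geodesic vector field on the tangent bundle. -/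
def spray (g : Euc N → Matrix (Fin N) (Fin N) ℝ) (p : Euc N × Euc N) : Euc N × Euc N :=
  (p.2, -accel (g p.1) (metricDeriv g p.1) p.2)

theorem contDiff_spray (hg : IsMetric g) : ContDiff ℝ ∞ (spray g) := by
  refine contDiff_snd.prodMk (ContDiff.neg (contDiff_iff_contDiffAt.2 fun p => ?_))
  exact contDiffAt_accel (fun i j => (hg.smooth i j).contDiffAt.comp p contDiffAt_fst)
    (hg.det_ne_zero p.1)
    (fun i j l => (contDiffAt_partialDeriv (hg.smooth j l).contDiffAt i).comp p contDiffAt_fst)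
    contDiffAt_snd

/-- Twice the kinetic energy. -/
def energy (g : Euc N → Matrix (Fin N) (Fin N) ℝ) (p : Euc N × Euc N) : ℝ :=
  matForm (g p.1) p.2 p.2

/-- The energy is constant along integral curves of any multiple of the geodesic field. -/
theorem hasDerivAt_energy (hg : IsMetric g) {u : ℝ → Euc N × Euc N} {c t : ℝ}
    (hu : HasDerivAt u (c • spray g (u t)) t) : HasDerivAt (fun t => energy g (u t)) 0 t := by
  have h1 := hasDerivAt_prod_fst hu
  have h2 := hasDerivAt_prod_snd hu
  have h3 := hasDerivAt_matForm (fun i j => hg.differentiableAt (u t).1 i j) h1 h2 h2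
  refine h3.congr_deriv ?_
  simp only [spray, Prod.smul_mk, triForm_smul₁]
  have hs := hg.isSymm (u t).1
  rw [matForm_comm hs (u t).2, smul_neg, ← neg_smul, matForm_smul_left,
    matForm_accel hs (hg.det_ne_zero _)]
  ring

theorem energy_eq (hg : IsMetric g) {u : ℝ → Euc N × Euc N} {c : ℝ → ℝ}
    (hu : ∀ t, HasDerivAt u (c t • spray g (u t)) t) (t s : ℝ) :
    energy g (u t) = energy g (u s) :=
  is_const_of_deriv_eq_zero (fun t => (hasDerivAt_energy hg (hu t)).differentiableAt)
    (fun t => (hasDerivAt_energy hg (hu t)).deriv) t s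

/-- Geodesic completeness of a uniformly elliptic metric. -/
theorem exists_integralCurve_spray (hg : IsMetric g) {c : ℝ} (hc : 0 < c)
    (hlow : ∀ z v, c * ‖v‖ ^ 2 ≤ matForm (g z) v v) (p : Euc N × Euc N) :
    ∃ u : ℝ → Euc N × Euc N, u 0 = p ∧ ∀ t, HasDerivAt u (spray g (u t)) t := by
  refine exists_global_integralCurve ((contDiff_spray hg).of_le (by simp)) p fun T => ?_
  set S : ℝ := √(energy g p / c) with hS
  have hS0 : 0 ≤ S := Real.sqrt_nonneg _
  -- Multiplying the field by a cutoff only reparametrises it, so energy is still conserved. This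
  -- bounds the speed by `S` and the displacement by `S * |t|`; the inner radius is chosen so that
  -- the curve stays where `χ = 1` for `|t| < T`.
  let χ : ContDiffBump ((p.1, 0) : Euc N × Euc N) :=
    ⟨S * |T| + S + 1, S * |T| + S + 2, by positivity, by linarith⟩
  obtain ⟨u, hu0, hu⟩ := exists_global_integralCurve_of_hasCompactSupport
    (f := fun q => χ q • spray g q) ((χ.contDiff.smul (contDiff_spray hg)).of_le (n := ∞) (by simp))
    (χ.hasCompactSupport.smul_right) p
  have hE : ∀ t, ‖(u t).2‖ ≤ S := by
    intro t
    have h1 := hlow (u t).1 (u t).2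
    have h2 : matForm (g (u t).1) (u t).2 (u t).2 = energy g p := by
      rw [← hu0]
      exact energy_eq hg hu t 0
    rw [h2] at h1
    refine Real.le_sqrt_of_sq_le ?_
    rw [le_div_iff₀ hc]
    linarith
  have hz : ∀ t, ‖(u t).1 - p.1‖ ≤ S * |t| := by
    intro t
    have h1 := convex_univ.norm_image_sub_le_of_norm_hasDerivWithin_le (f := fun t => (u t).1)
      (C := S) (x := 0) (y := t) (fun s _ => (hasDerivAt_prod_fst (hu s)).hasDerivWithinAt) (fun s _ => ?_)
      (Set.mem_univ _) (Set.mem_univ _)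
    · simpa [hu0] using h1
    · simp only [spray, Prod.smul_mk]
      rw [norm_smul, Real.norm_eq_abs, abs_of_nonneg χ.nonneg]
      exact (mul_le_of_le_one_left (norm_nonneg _) χ.le_one).trans (hE s)
  refine ⟨u, hu0, fun t ht => ?_⟩
  have hχ : χ (u t) = 1 := by
    refine χ.one_of_mem_closedBall ?_
    have htT : |t| ≤ |T| := (abs_lt.2 ht).le.trans (le_abs_self T)
    have h3 : S * |t| ≤ S * |T| := by gcongr
    have h4 : 0 ≤ S * |T| := by positivity
    rw [mem_closedBall, dist_eq_norm, Prod.norm_def]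
    refine max_le ?_ ?_
    · exact (hz t).trans (by change _ ≤ S * |T| + S + 1; linarith)
    · change ‖(u t).2 - 0‖ ≤ S * |T| + S + 1
      rw [sub_zero]
      linarith [hE t]
  have := hu t
  rwa [hχ, one_smul] at this

theorem IsGeodesic.hasDerivAt {γ : ℝ → Euc N} (h : IsGeodesic g γ) (t : ℝ) :
    HasDerivAt (fun t => (γ t, deriv γ t)) (spray g (γ t, deriv γ t)) t := by
  have h1 : Differentiable ℝ γ := h.1.differentiable (by simp)
  have h2 : ContDiff ℝ 1 (deriv γ) := by
    have : ContDiff ℝ (1 + 1) γ := h.1.of_le (by norm_num)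
    exact (contDiff_succ_iff_deriv.1 this).2.2
  refine (h1 t).hasDerivAt.prodMk (((h2.differentiable (by simp)) t).hasDerivAt.congr_deriv ?_)
  ext k
  have h3 := h.2 t k
  rw [sum_christoffel] at h3
  simp only [PiLp.neg_apply]
  linarith

theorem isGeodesic_of_hasDerivAt (hg : IsMetric g) {u : ℝ → Euc N × Euc N}
    (hu : ∀ t, HasDerivAt u (spray g (u t)) t) :
    IsGeodesic g (fun t => (u t).1) ∧ ∀ t, deriv (fun t => (u t).1) t = (u t).2 := by
  have hd : ∀ t, deriv (fun t => (u t).1) t = (u t).2 := fun t => (hasDerivAt_prod_fst (hu t)).deriv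
  have hd' : deriv (fun t => (u t).1) = fun t => (u t).2 := funext hd
  have hd2 : ∀ t, deriv (fun t => (u t).2) t = (spray g (u t)).2 := fun t => (hasDerivAt_prod_snd (hu t)).deriv
  have hc : Continuous u := continuous_iff_continuousAt.2 fun t => (hu t).continuousAt
  refine ⟨⟨?_, fun t k => ?_⟩, hd⟩
  · have h1 : ContDiff ℝ 1 (fun t => (u t).2) := by
      rw [contDiff_one_iff_deriv]
      refine ⟨fun t => (hasDerivAt_prod_snd (hu t)).differentiableAt, ?_⟩
      rw [funext hd2]
      exact continuous_snd.comp ((contDiff_spray hg).continuous.comp hc)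
    have : ContDiff ℝ (1 + 1) (fun t => (u t).1) := by
      refine contDiff_succ_iff_deriv.2 ⟨fun t => (hasDerivAt_prod_fst (hu t)).differentiableAt, by simp, ?_⟩
      rw [hd']
      exact h1
    exact this.of_le (by norm_num)
  · rw [hd', hd2, sum_christoffel]
    simp [spray]

theorem IsGeodesic.unique (hg : IsMetric g) {γ γ' : ℝ → Euc N} (h : IsGeodesic g γ)
    (h' : IsGeodesic g γ') {t : ℝ} (h0 : γ t = γ' t) (h1 : deriv γ t = deriv γ' t) : γ = γ' := by
  have := integralCurve_unique ((contDiff_spray hg).of_le (by simp)) h.hasDerivAt h'.hasDerivAt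
    (t₀ := t) (by simp [h0, h1])
  ext1 s
  exact congrArg Prod.fst (congrFun this s)

theorem exists_isGeodesic (hg : IsMetric g) {c : ℝ} (hc : 0 < c)
    (hlow : ∀ z v, c * ‖v‖ ^ 2 ≤ matForm (g z) v v) (t₀ : ℝ) (z v : Euc N) :
    ∃ γ : ℝ → Euc N, IsGeodesic g γ ∧ γ t₀ = z ∧ deriv γ t₀ = v := by
  obtain ⟨u, h0, hu⟩ := exists_integralCurve_spray hg hc hlow (z, v)
  have hu' : ∀ t, HasDerivAt (fun t => u (t - t₀)) (spray g (u (t - t₀))) t := fun t =>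
    (hu (t - t₀)).comp_sub_const t t₀
  obtain ⟨h1, h2⟩ := isGeodesic_of_hasDerivAt hg hu'
  exact ⟨_, h1, by simp [h0], by rw [h2]; simp [h0]⟩

theorem IsGeodesic.energy_eq (hg : IsMetric g) {γ : ℝ → Euc N} (h : IsGeodesic g γ) (t s : ℝ) :
    energy g (γ t, deriv γ t) = energy g (γ s, deriv γ s) :=
  _root_.energy_eq hg (u := fun t => (γ t, deriv γ t)) (c := fun _ => 1)
    (fun t => by rw [one_smul]; exact h.hasDerivAt t) t s

end Geodesics

/-! ### The metric near infinity after rescaling -/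

section ScatteringModel

variable {N : ℕ} {g : Euc N → Matrix (Fin N) (Fin N) ℝ} {h : Fin N → Fin N → ℝ × Euc N → ℝ}
  {W : Set (ℝ × Euc N)}

/-- The matrix `1 + s² h(s, w)`. -/
def scaledMetric (h : Fin N → Fin N → ℝ × Euc N → ℝ) (p : ℝ × Euc N) :
    Matrix (Fin N) (Fin N) ℝ :=
  1 + p.1 ^ 2 • Matrix.of fun i j => h i j p

/-- The first derivatives of `h` in the position variables. -/
def scaledDeriv (h : Fin N → Fin N → ℝ × Euc N → ℝ) (p : ℝ × Euc N) (i j l : Fin N) : ℝ :=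
  fderiv ℝ (h j l) p (0, EuclideanSpace.single i 1)

/-- The quadratic Christoffel term of the rescaled metric. -/
def scaledAccel (h : Fin N → Fin N → ℝ × Euc N → ℝ) (x : (ℝ × Euc N) × Euc N) : Euc N :=
  accel (scaledMetric h x.1) (scaledDeriv h x.1) x.2

/-- `g(w / s) = 1 + s² h(s, w)` where `h` is smooth up to, and across, `s = 0` away from `w = 0`. -/
structure IsScatteringModel (g : Euc N → Matrix (Fin N) (Fin N) ℝ)
    (h : Fin N → Fin N → ℝ × Euc N → ℝ) (W : Set (ℝ × Euc N)) : Prop where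
  isOpen : IsOpen W
  pos_mem : ∀ p : ℝ × Euc N, 0 < p.1 → p ∈ W
  zero_mem : ∀ w : Euc N, w ≠ 0 → (0, w) ∈ W
  smooth : ∀ i j, ContDiffOn ℝ ∞ (h i j) W
  eq : ∀ (s : ℝ) (w : Euc N), 0 < s → g (s⁻¹ • w) = scaledMetric h (s, w)
  det_ne_zero : ∀ p ∈ W, (scaledMetric h p).det ≠ 0

theorem scaledMetric_apply (p : ℝ × Euc N) (i j : Fin N) :
    scaledMetric h p i j = (1 : Matrix (Fin N) (Fin N) ℝ) i j + p.1 ^ 2 * h i j p := rfl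

theorem contDiffAt_scaledMetric {p : ℝ × Euc N} {i j : Fin N} (hh : ContDiffAt ℝ ∞ (h i j) p) :
    ContDiffAt ℝ ∞ (fun p => scaledMetric h p i j) p := by
  simp only [scaledMetric_apply]
  exact contDiffAt_const.add ((contDiffAt_fst.pow 2).mul hh)

theorem scaledMetric_zero (w : Euc N) : scaledMetric h (0, w) = 1 := by
  simp [scaledMetric]

/-- With `z = w / s` one has `s⁻² (g z - 1) = |w|⁻² k (s / |w|, w / |w|)` as soon as `R s < |w|`.
The left side is smooth for `s > 0`, the right side for `R |s| < |w|`, including negative `s`,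
because `k` is defined and smooth on the whole space. -/
theorem exists_isScatteringModel (hg : IsMetric g) (hsr : IsShortRange g) :
    ∃ h W, IsScatteringModel g h W := by
  obtain ⟨R, hR, k, hk, hgk⟩ := hsr
  let F : Fin N → Fin N → ℝ × Euc N → ℝ := fun i j p =>
    (‖p.2‖ ^ 2)⁻¹ * k i j (p.1 * ‖p.2‖⁻¹, ‖p.2‖⁻¹ • p.2)
  let G : Fin N → Fin N → ℝ × Euc N → ℝ := fun i j p =>
    (p.1 ^ 2)⁻¹ * (g (p.1⁻¹ • p.2) i j - if i = j then 1 else 0)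
  let h : Fin N → Fin N → ℝ × Euc N → ℝ := fun i j p => if 0 < p.1 then G i j p else F i j p
  have hFo : IsOpen {p : ℝ × Euc N | R * |p.1| < ‖p.2‖} :=
    isOpen_lt (by fun_prop) (by fun_prop)
  have hGo : IsOpen {p : ℝ × Euc N | 0 < p.1} := isOpen_lt (by fun_prop) (by fun_prop)
  have hFG : ∀ i j (p : ℝ × Euc N), R * |p.1| < ‖p.2‖ → h i j p = F i j p := by
    intro i j p hp
    by_cases h0 : 0 < p.1
    · have hw : 0 < ‖p.2‖ := lt_of_le_of_lt (by positivity) hp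
      have hn : ‖p.1⁻¹ • p.2‖ = p.1⁻¹ * ‖p.2‖ := by
        rw [norm_smul, norm_inv, Real.norm_eq_abs, abs_of_pos h0]
      have hbig : R < ‖p.1⁻¹ • p.2‖ := by
        rw [hn, lt_inv_mul_iff₀ h0, mul_comm]
        rwa [abs_of_pos h0] at hp
      have e1 : ‖p.1⁻¹ • p.2‖⁻¹ = p.1 * ‖p.2‖⁻¹ := by rw [hn, mul_inv, inv_inv]
      have e2 : (p.1 * ‖p.2‖⁻¹) • p.1⁻¹ • p.2 = ‖p.2‖⁻¹ • p.2 := by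
        rw [smul_smul]
        congr 1
        field_simp
      simp only [h, if_pos h0, G, F]
      rw [hgk _ hbig i j, e1, e2, hn]
      field_simp
      ring
    · simp only [h, if_neg h0]
  have hFs : ∀ i j (p : ℝ × Euc N), R * |p.1| < ‖p.2‖ → ContDiffAt ℝ ∞ (h i j) p := by
    intro i j p hp
    have hw : 0 < ‖p.2‖ := lt_of_le_of_lt (by positivity) hp
    have hw' : p.2 ≠ 0 := norm_pos_iff.1 hw
    have hn : ContDiffAt ℝ ∞ (fun p : ℝ × Euc N => ‖p.2‖) p := contDiffAt_snd.norm ℝ hw'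
    have hni : ContDiffAt ℝ ∞ (fun p : ℝ × Euc N => ‖p.2‖⁻¹) p := hn.inv hw.ne'
    have : ContDiffAt ℝ ∞ (F i j) p :=
      ((hn.pow 2).inv (by positivity)).mul ((hk i j).contDiffAt.comp p
        ((contDiffAt_fst.mul hni).prodMk (hni.smul contDiffAt_snd)))
    refine this.congr_of_eventuallyEq ?_
    filter_upwards [hFo.mem_nhds hp] with q hq
    exact hFG i j q hq
  have hGs : ∀ i j (p : ℝ × Euc N), 0 < p.1 → ContDiffAt ℝ ∞ (h i j) p := by
    intro i j p hp
    have : ContDiffAt ℝ ∞ (G i j) p :=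
      ((contDiffAt_fst.pow 2).inv (by positivity)).mul (((hg.smooth i j).contDiffAt.comp p
        ((contDiffAt_fst.inv hp.ne').smul contDiffAt_snd)).sub contDiffAt_const)
    refine this.congr_of_eventuallyEq ?_
    filter_upwards [hGo.mem_nhds hp] with q hq
    exact if_pos hq
  let W₀ : Set (ℝ × Euc N) := {p | 0 < p.1} ∪ {p | R * |p.1| < ‖p.2‖}
  have hW₀ : IsOpen W₀ := hGo.union hFo
  have hs : ∀ i j, ∀ p ∈ W₀, ContDiffAt ℝ ∞ (h i j) p := fun i j p hp =>
    hp.elim (hGs i j p) (hFs i j p)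
  have hdet : ContinuousOn (fun p => (scaledMetric h p).det) W₀ := fun p hp =>
    (contDiffAt_det fun i j => contDiffAt_scaledMetric (hs i j p hp)).continuousAt.continuousWithinAt
  have heq : ∀ (s : ℝ) (w : Euc N), 0 < s → g (s⁻¹ • w) = scaledMetric h (s, w) := by
    intro s w hs
    ext i j
    rw [scaledMetric_apply, Matrix.one_apply]
    simp only [h, if_pos hs, G]
    field_simp
    ring
  -- For `s < 0` the rescaled matrix need not come from a metric, so its invertibility is imposed;
  -- this keeps the set open and loses no point with `s > 0`, nor with `s = 0` and `w ≠ 0`.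
  refine ⟨h, W₀ ∩ (fun p => (scaledMetric h p).det) ⁻¹' {0}ᶜ, ?_, ?_, ?_, ?_, heq, ?_⟩
  · exact hdet.isOpen_inter_preimage hW₀ isOpen_compl_singleton
  · intro p hp
    refine ⟨Or.inl hp, ?_⟩
    change (scaledMetric h (p.1, p.2)).det ≠ 0
    rw [← heq _ _ hp]
    exact hg.det_ne_zero _
  · intro w hw
    refine ⟨Or.inr ?_, ?_⟩
    · simpa using hw
    · change (scaledMetric h (0, w)).det ≠ 0
      rw [scaledMetric_zero, Matrix.det_one]
      exact one_ne_zero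
  · exact fun i j p hp => (hs i j p hp.1).contDiffWithinAt
  · exact fun p hp => hp.2

namespace IsScatteringModel

theorem contDiffAt (hm : IsScatteringModel g h W) {p : ℝ × Euc N} (hp : p ∈ W) (i j : Fin N) :
    ContDiffAt ℝ ∞ (h i j) p := (hm.smooth i j).contDiffAt (hm.isOpen.mem_nhds hp)

theorem contDiffAt_metric (hm : IsScatteringModel g h W) {p : ℝ × Euc N} (hp : p ∈ W)
    (i j : Fin N) : ContDiffAt ℝ ∞ (fun p => scaledMetric h p i j) p :=
  contDiffAt_scaledMetric (hm.contDiffAt hp i j)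

theorem contDiffAt_deriv (hm : IsScatteringModel g h W) {p : ℝ × Euc N} (hp : p ∈ W)
    (i j l : Fin N) : ContDiffAt ℝ ∞ (fun p => scaledDeriv h p i j l) p :=
  ((hm.contDiffAt hp j l).fderiv_right (m := ∞) (by simp)).clm_apply contDiffAt_const

theorem contDiffAt_scaledAccel (hm : IsScatteringModel g h W) {x : (ℝ × Euc N) × Euc N}
    (hx : x.1 ∈ W) : ContDiffAt ℝ ∞ (scaledAccel h) x :=
  contDiffAt_accel (Q := fun x : (ℝ × Euc N) × Euc N => scaledMetric h x.1)
    (fun i j => (hm.contDiffAt_metric hx i j).comp x contDiffAt_fst)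
    (hm.det_ne_zero _ hx) (fun i j l => (hm.contDiffAt_deriv hx i j l).comp x contDiffAt_fst)
    contDiffAt_snd

/-- The perturbation contributes `s²`, and `∂_z = s ∂_w` supplies the third factor. -/
theorem metricDeriv_eq (hm : IsScatteringModel g h W) (hg : IsMetric g) {s : ℝ} (hs : 0 < s)
    (w : Euc N) :
    metricDeriv g (s⁻¹ • w) = fun i j l => s ^ 3 * scaledDeriv h (s, w) i j l := by
  ext i j l
  have hmem : (s, w) ∈ W := hm.pos_mem _ hs
  have e : (fun w => g (s⁻¹ • w) j l) =
      fun w => (1 : Matrix (Fin N) (Fin N) ℝ) j l + s ^ 2 * h j l (s, w) := by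
    ext w
    rw [hm.eq s w hs, scaledMetric_apply]
  have d1 : HasFDerivAt (fun w => g (s⁻¹ • w) j l)
      ((fderiv ℝ (fun w => g w j l) (s⁻¹ • w)).comp (s⁻¹ • ContinuousLinearMap.id ℝ (Euc N))) w :=
    HasFDerivAt.comp (f := fun w : Euc N => s⁻¹ • w) w
      (hg.differentiableAt (s⁻¹ • w) j l).hasFDerivAt ((hasFDerivAt_id w).const_smul s⁻¹)
  have d2 : HasFDerivAt (fun w => (1 : Matrix (Fin N) (Fin N) ℝ) j l + s ^ 2 * h j l (s, w))
      (s ^ 2 • (fderiv ℝ (h j l) (s, w)).comp (ContinuousLinearMap.inr ℝ ℝ (Euc N))) w := by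
    have := HasFDerivAt.comp (f := fun w => (s, w)) w
      ((hm.contDiffAt hmem j l).differentiableAt (by simp)).hasFDerivAt
      (hasFDerivAt_prodMk_right s w)
    exact (this.const_mul (s ^ 2)).const_add _
  rw [e] at d1
  have h1 := congrArg (fun A : Euc N →L[ℝ] ℝ => A (EuclideanSpace.single i 1)) (d1.unique d2)
  have h2 : s⁻¹ * metricDeriv g (s⁻¹ • w) i j l = s ^ 2 * scaledDeriv h (s, w) i j l := by
    simpa [metricDeriv, partialDeriv, scaledDeriv] using h1
  rw [inv_mul_eq_iff_eq_mul₀ hs.ne'] at h2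
  rw [h2]
  ring

/-- The decay `s³` is exactly what is needed: the change of time contributes `s⁻²` to `dv/ds`, and
the weight `s⁻¹` in `y` consumes the remaining factor. -/
theorem accel_eq (hm : IsScatteringModel g h W) (hg : IsMetric g) {s : ℝ} (hs : 0 < s)
    (w v : Euc N) :
    accel (g (s⁻¹ • w)) (metricDeriv g (s⁻¹ • w)) v = s ^ 3 • scaledAccel h ((s, w), v) := by
  rw [hm.metricDeriv_eq hg hs, accel_smul_coeff, hm.eq s w hs]
  rfl

/-- The compact set of parameters `s ∈ [0, 1]`, `a ≤ |w| ≤ b`, `|v| ≤ b`. -/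
theorem isCompact_shell (N : ℕ) (a b : ℝ) : IsCompact
    ((Set.Icc (0 : ℝ) 1 ×ˢ (closedBall (0 : Euc N) b \ ball 0 a)) ×ˢ closedBall (0 : Euc N) b) :=
  (isCompact_Icc.prod ((isCompact_closedBall _ _).diff isOpen_ball)).prod (isCompact_closedBall _ _)

theorem shell_subset (hm : IsScatteringModel g h W) {a b : ℝ} (ha : 0 < a) :
    Set.Icc (0 : ℝ) 1 ×ˢ (closedBall (0 : Euc N) b \ ball 0 a) ⊆ W := by
  rintro ⟨s, w⟩ ⟨hs, -, hw⟩
  rcases hs.1.eq_or_lt with h0 | h0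
  · obtain rfl : 0 = s := h0
    refine hm.zero_mem w ?_
    rintro rfl
    exact hw (mem_ball_self ha)
  · exact hm.pos_mem _ h0

theorem exists_scaledAccel_bound (hm : IsScatteringModel g h W) {a b : ℝ} (ha : 0 < a) :
    ∃ M, ∀ s w v, 0 ≤ s → s ≤ 1 → a ≤ ‖w‖ → ‖w‖ ≤ b → ‖v‖ ≤ b →
      ‖scaledAccel h ((s, w), v)‖ ≤ M := by
  obtain ⟨M, hM⟩ := (isCompact_shell N a b).exists_bound_of_continuousOn (f := scaledAccel h)
    (fun x hx => (hm.contDiffAt_scaledAccel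
      (hm.shell_subset ha hx.1)).continuousAt.continuousWithinAt)
  refine ⟨M, fun s w v h0 h1 hw hw' hv => hM _ ⟨⟨⟨h0, h1⟩, ?_, ?_⟩, ?_⟩⟩
  · simpa using hw'
  · simpa using hw
  · simpa using hv

/-- Take `s = 1 / |z|` and `w = z / |z|`: these range over a compact set, and homogeneity of degree
two in `v` reduces to `|v| = 1`. -/
theorem exists_accel_bound (hm : IsScatteringModel g h W) (hg : IsMetric g) :
    ∃ M, 0 ≤ M ∧ ∀ z v, 1 ≤ ‖z‖ →
      ‖accel (g z) (metricDeriv g z) v‖ * ‖z‖ ^ 3 ≤ M * ‖v‖ ^ 2 := by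
  obtain ⟨M, hM⟩ := hm.exists_scaledAccel_bound (a := 1) (b := 1) one_pos
  refine ⟨max M 0, le_max_right _ _, fun z v hz => ?_⟩
  have hz0 : 0 < ‖z‖ := one_pos.trans_le hz
  have e : z = (‖z‖⁻¹)⁻¹ • (‖z‖⁻¹ • z) := by rw [smul_smul, inv_inv, mul_inv_cancel₀ hz0.ne', one_smul]
  have hw : ‖‖z‖⁻¹ • z‖ = 1 := norm_smul_inv_norm (𝕜 := ℝ) (norm_pos_iff.1 hz0)
  have h1 : ‖accel (g z) (metricDeriv g z) v‖ =
      ‖z‖⁻¹ ^ 3 * ‖scaledAccel h ((‖z‖⁻¹, ‖z‖⁻¹ • z), v)‖ := by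
    conv_lhs => rw [e, hm.accel_eq hg (inv_pos.2 hz0), norm_smul]
    rw [norm_pow, norm_inv, norm_norm]
  have h2 : ‖scaledAccel h ((‖z‖⁻¹, ‖z‖⁻¹ • z), v)‖ ≤ max M 0 * ‖v‖ ^ 2 := by
    rcases eq_or_ne v 0 with rfl | hv
    · have : scaledAccel h ((‖z‖⁻¹, ‖z‖⁻¹ • z), (0 : Euc N)) = 0 := by
        have := accel_smul (scaledMetric h (‖z‖⁻¹, ‖z‖⁻¹ • z)) 0
          (scaledDeriv h (‖z‖⁻¹, ‖z‖⁻¹ • z)) (0 : Euc N)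
        simpa [scaledAccel] using this
      rw [this]
      simp
    · have hv0 : 0 < ‖v‖ := norm_pos_iff.2 hv
      have e3 : v = ‖v‖ • (‖v‖⁻¹ • v) := by rw [smul_smul, mul_inv_cancel₀ hv0.ne', one_smul]
      have h3 : scaledAccel h ((‖z‖⁻¹, ‖z‖⁻¹ • z), v) =
          ‖v‖ ^ 2 • scaledAccel h ((‖z‖⁻¹, ‖z‖⁻¹ • z), ‖v‖⁻¹ • v) := by
        conv_lhs => rw [e3]
        exact accel_smul _ _ _ _
      rw [h3, norm_smul, norm_pow, norm_norm, mul_comm]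
      gcongr
      refine (hM _ _ _ (by positivity) (inv_le_one_of_one_le₀ hz) hw.ge hw.le ?_).trans
        (le_max_left _ _)
      exact (norm_smul_inv_norm (𝕜 := ℝ) hv).le
  rw [h1]
  calc ‖z‖⁻¹ ^ 3 * ‖scaledAccel h ((‖z‖⁻¹, ‖z‖⁻¹ • z), v)‖ * ‖z‖ ^ 3
      = ‖scaledAccel h ((‖z‖⁻¹, ‖z‖⁻¹ • z), v)‖ := by field_simp
    _ ≤ _ := h2

theorem scaledMetric_pos (hm : IsScatteringModel g h W) (hg : IsMetric g) {s : ℝ} {w : Euc N}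
    (hs : 0 ≤ s) {v : Euc N} (hv : v ≠ 0) :
    0 < matForm (scaledMetric h (s, w)) v v := by
  rcases hs.eq_or_lt with rfl | h0
  · rw [scaledMetric_zero, matForm_one]
    exact real_inner_self_pos.2 hv
  · rw [← hm.eq s w h0]
    exact matForm_pos (hg.posDef _) hv

/-- Uniform ellipticity. -/
theorem exists_bounds (hm : IsScatteringModel g h W) (hg : IsMetric g) :
    ∃ c C, 0 < c ∧ 0 < C ∧ ∀ z v, c * ‖v‖ ^ 2 ≤ matForm (g z) v v ∧
      matForm (g z) v v ≤ C * ‖v‖ ^ 2 := by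
  -- The exterior region becomes compact in the variables `(1 / |z|, z / |z|)`, the points at
  -- infinity `s = 0` included. The ball minus the open ball is the unit sphere, written so as to
  -- match `shell_subset`.
  let K₁ : Set ((ℝ × Euc N) × Euc N) :=
    (Set.Icc (0 : ℝ) 1 ×ˢ (closedBall (0 : Euc N) 1 \ ball 0 1)) ×ˢ sphere 0 1
  let K₂ : Set (Euc N × Euc N) := closedBall 0 1 ×ˢ sphere 0 1
  have hK₁ : IsCompact K₁ := (isCompact_Icc.prod
    ((isCompact_closedBall _ _).diff isOpen_ball)).prod (isCompact_sphere _ _)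
  have hK₂ : IsCompact K₂ := (isCompact_closedBall _ _).prod (isCompact_sphere _ _)
  have hne : ∀ v ∈ sphere (0 : Euc N) 1, v ≠ 0 := fun v hv => by
    rintro rfl
    simp at hv
  have hc₁ : ContinuousOn (fun x : (ℝ × Euc N) × Euc N => matForm (scaledMetric h x.1) x.2 x.2) K₁ :=
    fun x hx => (contDiffAt_matForm (Q := fun x : (ℝ × Euc N) × Euc N => scaledMetric h x.1)
      (fun i j => (hm.contDiffAt_metric (hm.shell_subset one_pos hx.1) i j).comp x contDiffAt_fst)
      contDiffAt_snd contDiffAt_snd).continuousAt.continuousWithinAt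
  have hc₂ : ContinuousOn (fun x : Euc N × Euc N => matForm (g x.1) x.2 x.2) K₂ :=
    fun x _ => (contDiffAt_matForm (Q := fun x : Euc N × Euc N => g x.1)
      (fun i j => (hg.smooth i j).contDiffAt.comp x contDiffAt_fst)
      contDiffAt_snd contDiffAt_snd).continuousAt.continuousWithinAt
  obtain ⟨c₁, hc₁0, hc₁'⟩ := hK₁.exists_forall_le' hc₁ (a := 0)
    (fun x hx => hm.scaledMetric_pos hg hx.1.1.1 (hne _ hx.2))
  obtain ⟨c₂, hc₂0, hc₂'⟩ := hK₂.exists_forall_le' hc₂ (a := 0)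
    (fun x hx => matForm_pos (hg.posDef _) (hne _ hx.2))
  obtain ⟨C₁, hC₁⟩ := hK₁.exists_bound_of_continuousOn hc₁
  obtain ⟨C₂, hC₂⟩ := hK₂.exists_bound_of_continuousOn hc₂
  -- The outer maximum with `1` only guarantees a positive upper constant.
  have key : ∀ z v, ‖v‖ = 1 → min c₁ c₂ ≤ matForm (g z) v v ∧
      matForm (g z) v v ≤ max (max C₁ C₂) 1 := by
    intro z v hv
    rcases le_total 1 ‖z‖ with hz | hz
    · have hz0 : 0 < ‖z‖ := one_pos.trans_le hz
      have e : z = (‖z‖⁻¹)⁻¹ • (‖z‖⁻¹ • z) := by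
        rw [smul_smul, inv_inv, mul_inv_cancel₀ hz0.ne', one_smul]
      have hw : ‖‖z‖⁻¹ • z‖ = 1 := norm_smul_inv_norm (𝕜 := ℝ) (norm_pos_iff.1 hz0)
      have e' : g z = scaledMetric h (‖z‖⁻¹, ‖z‖⁻¹ • z) := by
        conv_lhs => rw [e, hm.eq _ _ (inv_pos.2 hz0)]
      have hmem : (((‖z‖⁻¹, ‖z‖⁻¹ • z), v) : (ℝ × Euc N) × Euc N) ∈ K₁ :=
        ⟨⟨⟨(inv_pos.2 hz0).le, inv_le_one_of_one_le₀ hz⟩, mem_closedBall_zero_iff.2 hw.le,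
          fun hb => (mem_ball_zero_iff.1 hb).ne hw⟩, mem_sphere_zero_iff_norm.2 hv⟩
      have l1 : c₁ ≤ matForm (scaledMetric h (‖z‖⁻¹, ‖z‖⁻¹ • z)) v v :=
        hc₁' ((‖z‖⁻¹, ‖z‖⁻¹ • z), v) hmem
      have l2 : matForm (scaledMetric h (‖z‖⁻¹, ‖z‖⁻¹ • z)) v v ≤ C₁ :=
        (Real.le_norm_self _).trans (hC₁ ((‖z‖⁻¹, ‖z‖⁻¹ • z), v) hmem)
      rw [e']
      exact ⟨(min_le_left _ _).trans l1, l2.trans ((le_max_left _ _).trans (le_max_left _ _))⟩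
    · have hmem : (z, v) ∈ K₂ := ⟨mem_closedBall_zero_iff.2 hz, mem_sphere_zero_iff_norm.2 hv⟩
      have l1 : c₂ ≤ matForm (g z) v v := hc₂' (z, v) hmem
      have l2 : matForm (g z) v v ≤ C₂ := (Real.le_norm_self _).trans (hC₂ (z, v) hmem)
      exact ⟨(min_le_right _ _).trans l1, l2.trans ((le_max_right _ _).trans (le_max_left _ _))⟩
  refine ⟨min c₁ c₂, max (max C₁ C₂) 1, lt_min hc₁0 hc₂0, by positivity, fun z v => ?_⟩
  rcases eq_or_ne v 0 with rfl | hv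
  · simp [matForm]
  have hv0 : 0 < ‖v‖ := norm_pos_iff.2 hv
  have e3 : v = ‖v‖ • (‖v‖⁻¹ • v) := by rw [smul_smul, mul_inv_cancel₀ hv0.ne', one_smul]
  have h3 : matForm (g z) v v = ‖v‖ ^ 2 * matForm (g z) (‖v‖⁻¹ • v) (‖v‖⁻¹ • v) := by
    conv_lhs => rw [e3]
    rw [matForm_smul_left, matForm_smul_right]
    ring
  obtain ⟨k1, k2⟩ := key z (‖v‖⁻¹ • v) (norm_smul_inv_norm (𝕜 := ℝ) hv)
  rw [h3, mul_comm (min c₁ c₂), mul_comm (max (max C₁ C₂) 1)]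
  exact ⟨by gcongr, by gcongr⟩

end IsScatteringModel

end ScatteringModel

/-! ### The geodesic field in the variables `(s, v, y)` and linear escape -/

section ScatteringField

variable {N : ℕ} {g : Euc N → Matrix (Fin N) (Fin N) ℝ} {h : Fin N → Fin N → ℝ × Euc N → ℝ}
  {W : Set (ℝ × Euc N)} {γ : ℝ → Euc N}

/-- The rescaled position `(s, v + s y)`. -/
def scatPos (x : ℝ × Euc N × Euc N) : ℝ × Euc N := (x.1, x.2.1 + x.1 • x.2.2)

/-- The domain of the rescaled geodesic field. -/
def scatDomain (W : Set (ℝ × Euc N)) : Set (ℝ × Euc N × Euc N) := scatPos ⁻¹' W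

/-- The geodesic field in the variables `s = 1 / (t + 1)`, `v = γ'`, `y = γ - v / s`. -/
def scatField (h : Fin N → Fin N → ℝ × Euc N → ℝ) (x : ℝ × Euc N × Euc N) : ℝ × Euc N × Euc N :=
  (1, x.1 • scaledAccel h (scatPos x, x.2.1), -scaledAccel h (scatPos x, x.2.1))

/-- The energy in the rescaled variables. -/
def scatEnergy (h : Fin N → Fin N → ℝ × Euc N → ℝ) (x : ℝ × Euc N × Euc N) : ℝ :=
  matForm (scaledMetric h (scatPos x)) x.2.1 x.2.1

/-- The curve `s ↦ (s, v, y)` of `γ`. -/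
def scatCurve (γ : ℝ → Euc N) (s : ℝ) : ℝ × Euc N × Euc N :=
  (s, deriv γ (s⁻¹ - 1), γ (s⁻¹ - 1) - s⁻¹ • deriv γ (s⁻¹ - 1))

/-- The curve `s ↦ (s, v, y)` of `γ` with the value `(0, a)` at `s = 0`. -/
def asympCurve (γ : ℝ → Euc N) (a : Euc N × Euc N) : ℝ → ℝ × Euc N × Euc N :=
  Function.update (scatCurve γ) 0 (0, a)

theorem asympCurve_zero (a : Euc N × Euc N) : asympCurve γ a 0 = (0, a) :=
  Function.update_self _ _ _

theorem asympCurve_of_ne (a : Euc N × Euc N) {s : ℝ} (hs : s ≠ 0) :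
    asympCurve γ a s = scatCurve γ s := Function.update_of_ne hs _ _

theorem contDiff_scatPos : ContDiff ℝ ∞ (scatPos (N := N)) :=
  contDiff_fst.prodMk ((contDiff_fst.comp contDiff_snd).add
    (contDiff_fst.smul (contDiff_snd.comp contDiff_snd)))

theorem scatPos_scatCurve {s : ℝ} (hs : s ≠ 0) :
    scatPos (scatCurve γ s) = (s, s • γ (s⁻¹ - 1)) := by
  simp only [scatPos, scatCurve]
  rw [smul_sub, smul_smul, mul_inv_cancel₀ hs, one_smul, add_sub_cancel]

theorem scatPos_zero (a : Euc N × Euc N) : scatPos (0, a) = (0, a.1) := by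
  simp [scatPos]

namespace IsScatteringModel

theorem isOpen_scatDomain (hm : IsScatteringModel g h W) : IsOpen (scatDomain W) :=
  hm.isOpen.preimage contDiff_scatPos.continuous

theorem contDiffOn_scatField (hm : IsScatteringModel g h W) :
    ContDiffOn ℝ ∞ (scatField h) (scatDomain W) := by
  intro x hx
  have h1 : ContDiffAt ℝ ∞ (fun x : ℝ × Euc N × Euc N => scaledAccel h (scatPos x, x.2.1)) x :=
    ContDiffAt.comp (g := scaledAccel h) (f := fun x => (scatPos x, x.2.1)) x
      (hm.contDiffAt_scaledAccel (x := (scatPos x, x.2.1)) hx)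
      (contDiff_scatPos.contDiffAt.prodMk (contDiffAt_fst.comp x contDiffAt_snd))
  exact (contDiffAt_const.prodMk ((contDiffAt_fst.smul h1).prodMk h1.neg)).contDiffWithinAt

theorem contDiffAt_scatEnergy (hm : IsScatteringModel g h W) {x : ℝ × Euc N × Euc N}
    (hx : x ∈ scatDomain W) : ContDiffAt ℝ ∞ (scatEnergy h) x :=
  contDiffAt_matForm (Q := fun x : ℝ × Euc N × Euc N => scaledMetric h (scatPos x))
    (fun i j => ContDiffAt.comp (g := fun p => scaledMetric h p i j) (f := scatPos) x
      (hm.contDiffAt_metric hx i j) contDiff_scatPos.contDiffAt)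
    (contDiffAt_fst.comp x contDiffAt_snd) (contDiffAt_fst.comp x contDiffAt_snd)

theorem scatCurve_mem (hm : IsScatteringModel g h W) {s : ℝ} (hs : 0 < s) :
    scatCurve γ s ∈ scatDomain W := hm.pos_mem _ hs

theorem zero_mem_scatDomain (hm : IsScatteringModel g h W) {a : Euc N × Euc N} (ha : a.1 ≠ 0) :
    ((0, a) : ℝ × Euc N × Euc N) ∈ scatDomain W := by
  change scatPos (0, a) ∈ W
  rw [scatPos_zero]
  exact hm.zero_mem _ ha

theorem scatEnergy_scatCurve (hm : IsScatteringModel g h W) {s : ℝ} (hs : 0 < s) :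
    scatEnergy h (scatCurve γ s) = energy g (γ (s⁻¹ - 1), deriv γ (s⁻¹ - 1)) := by
  rw [scatEnergy, scatPos_scatCurve hs.ne', ← hm.eq _ _ hs, smul_smul, inv_mul_cancel₀ hs.ne',
    one_smul]
  rfl

/-- With `dt/ds = -s⁻²`, the equation `v' = -s³ A` gives `dv/ds = s A`. In `dy/ds` the terms `∓ s⁻²
v` cancel and `-s⁻¹ (s A) = -A` is left. -/
theorem hasDerivAt_scatCurve (hm : IsScatteringModel g h W) (hg : IsMetric g)
    (hγ : IsGeodesic g γ) {s : ℝ} (hs : 0 < s) :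
    HasDerivAt (scatCurve γ) (scatField h (scatCurve γ s)) s := by
  have hi : HasDerivAt (fun s : ℝ => s⁻¹ - 1) (-(s ^ 2)⁻¹) s := (hasDerivAt_inv hs.ne').sub_const 1
  have h0 := hγ.hasDerivAt (s⁻¹ - 1)
  have d1 : HasDerivAt (fun s : ℝ => γ (s⁻¹ - 1)) (-(s ^ 2)⁻¹ • deriv γ (s⁻¹ - 1)) s :=
    (hasDerivAt_prod_fst h0).scomp s hi
  set A := scaledAccel h (scatPos (scatCurve γ s), deriv γ (s⁻¹ - 1)) with hA
  have hacc : accel (g (γ (s⁻¹ - 1))) (metricDeriv g (γ (s⁻¹ - 1))) (deriv γ (s⁻¹ - 1)) =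
      s ^ 3 • A := by
    have h1 := hm.accel_eq hg hs (s • γ (s⁻¹ - 1)) (deriv γ (s⁻¹ - 1))
    rw [smul_smul, inv_mul_cancel₀ hs.ne', one_smul] at h1
    rw [h1, hA, scatPos_scatCurve hs.ne']
  have d2 : HasDerivAt (fun s : ℝ => deriv γ (s⁻¹ - 1)) (s • A) s := by
    have := (hasDerivAt_prod_snd h0).scomp s hi
    refine this.congr_deriv ?_
    simp only [spray]
    rw [hacc, smul_neg, neg_smul, neg_neg, smul_smul]
    congr 1
    field_simp
  have d3 : HasDerivAt (fun s : ℝ => γ (s⁻¹ - 1) - s⁻¹ • deriv γ (s⁻¹ - 1)) (-A) s := by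
    refine (d1.sub ((hasDerivAt_inv hs.ne').smul d2)).congr_deriv ?_
    rw [smul_smul, inv_mul_cancel₀ hs.ne', one_smul]
    abel
  exact (hasDerivAt_id s).prodMk (d2.prodMk d3)

theorem isCurveIn_scatCurve (hm : IsScatteringModel g h W) (hg : IsMetric g)
    (hγ : IsGeodesic g γ) {a b : ℝ} (ha : 0 < a) :
    IsCurveIn (scatField h) (scatDomain W) a b (scatCurve γ) := fun _ hs =>
  ⟨hm.scatCurve_mem (ha.trans_le hs.1),
    (hm.hasDerivAt_scatCurve hg hγ (ha.trans_le hs.1)).hasDerivWithinAt⟩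

theorem isCurveIn_asympCurve (hm : IsScatteringModel g h W) (hg : IsMetric g)
    (hγ : IsGeodesic g γ) {a : Euc N × Euc N} (ha : a.1 ≠ 0)
    (h0 : HasDerivWithinAt (asympCurve γ a) (scatField h (0, a)) (Set.Ici 0) 0) :
    IsCurveIn (scatField h) (scatDomain W) 0 1 (asympCurve γ a) := by
  intro s hs
  rcases hs.1.eq_or_lt with rfl | hs0
  · rw [asympCurve_zero]
    exact ⟨hm.zero_mem_scatDomain ha, h0.mono Set.Icc_subset_Ici_self⟩
  · rw [asympCurve_of_ne a hs0.ne']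
    refine ⟨hm.scatCurve_mem hs0, ?_⟩
    refine ((hm.hasDerivAt_scatCurve hg hγ hs0).congr_of_eventuallyEq ?_).hasDerivWithinAt
    filter_upwards [isOpen_ne.mem_nhds hs0.ne'] with r hr
    exact asympCurve_of_ne a hr

/-- The conserved energy is continuous up to `s = 0`, where the rescaled metric is Euclidean. -/
theorem energy_eq_norm_sq (hm : IsScatteringModel g h W) (hg : IsMetric g)
    (hγ : IsGeodesic g γ) {a : Euc N × Euc N}
    (hc : IsCurveIn (scatField h) (scatDomain W) 0 1 (asympCurve γ a)) (t : ℝ) :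
    energy g (γ t, deriv γ t) = ‖a.1‖ ^ 2 := by
  have h0 := hc 0 ⟨le_rfl, zero_le_one⟩
  have hne : (𝓝[Set.Ioc (0 : ℝ) 1] 0).NeBot := by
    rw [nhdsWithin_Ioc_eq_nhdsGT zero_lt_one]
    infer_instance
  have t1 : Tendsto (asympCurve γ a) (𝓝[Set.Ioc 0 1] 0) (𝓝 (asympCurve γ a 0)) :=
    h0.2.continuousWithinAt.mono Set.Ioc_subset_Icc_self
  have t2 := (hm.contDiffAt_scatEnergy h0.1).continuousAt.tendsto.comp t1
  have t3 : Tendsto (scatEnergy h ∘ asympCurve γ a) (𝓝[Set.Ioc 0 1] 0)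
      (𝓝 (energy g (γ t, deriv γ t))) := by
    refine tendsto_const_nhds.congr' ?_
    filter_upwards [self_mem_nhdsWithin] with s hs
    rw [Function.comp_apply, asympCurve_of_ne a hs.1.ne', hm.scatEnergy_scatCurve hs.1,
      hγ.energy_eq hg t]
  rw [tendsto_nhds_unique t3 t2, asympCurve_zero, scatEnergy, scatPos_zero, scaledMetric_zero,
    matForm_one, real_inner_self_eq_norm_sq]

/-- A unit-energy geodesic that goes to infinity does so at least linearly. -/
theorem exists_linear_escape (hm : IsScatteringModel g h W) (hg : IsMetric g)
    (hγ : IsGeodesic g γ) (hE : ∀ t, energy g (γ t, deriv γ t) = 1)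
    (hesc : Tendsto (fun t => ‖γ t‖) atTop atTop) :
    ∃ a T : ℝ, 0 < a ∧ 0 < T ∧ ∀ t, T ≤ t → a * t ≤ ‖γ t‖ := by
  obtain ⟨c, C, hc, hC, hcC⟩ := hm.exists_bounds hg
  obtain ⟨M, hM0, hM⟩ := hm.exists_accel_bound hg
  set m : ℝ := C⁻¹ with hm'
  have hmpos : 0 < m := inv_pos.2 hC
  have hv : ∀ t, m ≤ ‖deriv γ t‖ ^ 2 := by
    intro t
    have h1 := (hcC (γ t) (deriv γ t)).2
    rw [show matForm (g (γ t)) (deriv γ t) (deriv γ t) = 1 from hE t] at h1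
    rw [hm', inv_le_iff_one_le_mul₀' hC]
    exact h1
  -- Beyond this radius `⟨γ, A⟩ ≤ |v|² / 2`, so the second derivative of `|γ|²` is at least `|v|² ≥
  -- m`.
  obtain ⟨T₀, hT₀⟩ := eventually_atTop.1 (hesc.eventually_ge_atTop (max 1 (2 * M)))
  set A : ℝ → Euc N := fun t => accel (g (γ t)) (metricDeriv g (γ t)) (deriv γ t) with hA
  have d1 : ∀ t, HasDerivAt γ (deriv γ t) t := fun t => hasDerivAt_prod_fst (hγ.hasDerivAt t)
  have d2 : ∀ t, HasDerivAt (deriv γ) (-A t) t := fun t => hasDerivAt_prod_snd (hγ.hasDerivAt t)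
  have df : ∀ t, HasDerivAt (fun t => ‖γ t‖ ^ 2) (2 * inner ℝ (γ t) (deriv γ t)) t :=
    fun t => (d1 t).norm_sq
  have df' : ∀ t, HasDerivAt (fun t => 2 * inner ℝ (γ t) (deriv γ t))
      (2 * (inner ℝ (γ t) (-A t) + inner ℝ (deriv γ t) (deriv γ t))) t := fun t =>
    ((d1 t).inner ℝ (d2 t)).const_mul 2
  have hconv : ∀ t, T₀ ≤ t → m ≤ 2 * (inner ℝ (γ t) (-A t) + inner ℝ (deriv γ t) (deriv γ t)) := by
    intro t ht
    have hz1 : 1 ≤ ‖γ t‖ := (le_max_left _ _).trans (hT₀ t ht)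
    have hz2 : 2 * M ≤ ‖γ t‖ := (le_max_right _ _).trans (hT₀ t ht)
    have hz0 : 0 < ‖γ t‖ := one_pos.trans_le hz1
    have h1 := hM (γ t) (deriv γ t) hz1
    have h2 : inner ℝ (γ t) (A t) ≤ ‖γ t‖ * ‖A t‖ := real_inner_le_norm _ _
    have h3 : ‖γ t‖ * ‖A t‖ ≤ 1 / 2 * ‖deriv γ t‖ ^ 2 := by
      have h4 : (‖γ t‖ * ‖A t‖) * ‖γ t‖ ≤ (1 / 2 * ‖deriv γ t‖ ^ 2) * ‖γ t‖ := by
        have h5 : (‖γ t‖ * ‖A t‖) * ‖γ t‖ ≤ ‖A t‖ * ‖γ t‖ ^ 3 := by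
          have : ‖γ t‖ ^ 2 ≤ ‖γ t‖ ^ 3 := pow_le_pow_right₀ hz1 (by norm_num)
          nlinarith [norm_nonneg (A t)]
        nlinarith [sq_nonneg ‖deriv γ t‖]
      exact le_of_mul_le_mul_right h4 hz0
    rw [inner_neg_right, real_inner_self_eq_norm_sq]
    linarith [hv t]
  set b : ℝ := 2 * inner ℝ (γ T₀) (deriv γ T₀) - m * T₀ with hb
  have hf' : ∀ t, T₀ ≤ t → m * t + b ≤ 2 * inner ℝ (γ t) (deriv γ t) := by
    have hmono : MonotoneOn (fun t => 2 * inner ℝ (γ t) (deriv γ t) - m * t) (Set.Ici T₀) := by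
      have hd : ∀ t, HasDerivAt (fun t => 2 * inner ℝ (γ t) (deriv γ t) - m * t)
          (2 * (inner ℝ (γ t) (-A t) + inner ℝ (deriv γ t) (deriv γ t)) - m * 1) t := fun t =>
        (df' t).sub ((hasDerivAt_id t).const_mul m)
      refine monotoneOn_of_deriv_nonneg (convex_Ici T₀)
        (fun t _ => (hd t).continuousAt.continuousWithinAt)
        (fun t _ => (hd t).differentiableAt.differentiableWithinAt) fun t ht => ?_
      rw [interior_Ici] at ht
      rw [(hd t).deriv]
      linarith [hconv t (le_of_lt ht)]
    intro t ht
    have := hmono Set.self_mem_Ici ht ht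
    simp only at this
    linarith
  set d : ℝ := ‖γ T₀‖ ^ 2 - (m / 2 * T₀ ^ 2 + b * T₀) with hd
  have hf : ∀ t, T₀ ≤ t → m / 2 * t ^ 2 + b * t + d ≤ ‖γ t‖ ^ 2 := by
    have hmono : MonotoneOn (fun t => ‖γ t‖ ^ 2 - (m / 2 * t ^ 2 + b * t)) (Set.Ici T₀) := by
      have hd : ∀ t, HasDerivAt (fun t => ‖γ t‖ ^ 2 - (m / 2 * t ^ 2 + b * t))
          (2 * inner ℝ (γ t) (deriv γ t) - (m / 2 * (2 * t) + b * 1)) t := fun t => by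
        refine (df t).sub ((HasDerivAt.const_mul _ ?_).add ((hasDerivAt_id t).const_mul b))
        simpa using hasDerivAt_pow 2 t
      refine monotoneOn_of_deriv_nonneg (convex_Ici T₀)
        (fun t _ => (hd t).continuousAt.continuousWithinAt)
        (fun t _ => (hd t).differentiableAt.differentiableWithinAt) fun t ht => ?_
      rw [interior_Ici] at ht
      rw [(hd t).deriv]
      linarith [hf' t (le_of_lt ht)]
    intro t ht
    have := hmono Set.self_mem_Ici ht ht
    simp only at this
    linarith
  -- Two integrations gave `|γ|² ≥ m t² / 2 + b t + d`; past this time the lower-order terms cost at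
  -- most `m t² / 4`.
  refine ⟨√m / 2, max (max T₀ 1) ((|b| + |d|) * (4 / m)), by positivity, by positivity,
    fun t ht => ?_⟩
  have ht0 : T₀ ≤ t := (le_max_left _ _).trans ((le_max_left _ _).trans ht)
  have ht1 : 1 ≤ t := (le_max_right _ _).trans ((le_max_left _ _).trans ht)
  have ht2 : (|b| + |d|) * (4 / m) ≤ t := (le_max_right _ _).trans ht
  have ht3 : |b| + |d| ≤ m / 4 * t := by
    rw [← le_div_iff₀ (by positivity)] at ht2
    refine ht2.trans (le_of_eq ?_)
    field_simp
  refine (pow_le_pow_iff_left₀ (by positivity) (norm_nonneg _) two_ne_zero).1 ?_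
  refine le_trans ?_ (hf t ht0)
  rw [mul_pow, div_pow, Real.sq_sqrt hmpos.le]
  have hb1 := neg_abs_le b
  have hd1 := neg_abs_le d
  have hd2 : |d| ≤ |d| * t := le_mul_of_one_le_right (abs_nonneg d) ht1
  nlinarith

end IsScatteringModel

end ScatteringField

/-! ### Limits at `s = 0` and existence of geodesics with given limits -/

section Asymptotics

variable {N : ℕ} {g : Euc N → Matrix (Fin N) (Fin N) ℝ} {h : Fin N → Fin N → ℝ × Euc N → ℝ}
  {W : Set (ℝ × Euc N)} {γ : ℝ → Euc N}

namespace IsScatteringModel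

/-- The rescaled curve of an escaping unit-energy geodesic has a limit at `s = 0`. -/
theorem exists_tendsto_scatCurve (hm : IsScatteringModel g h W) (hg : IsMetric g)
    (hγ : IsGeodesic g γ) (hE : ∀ t, energy g (γ t, deriv γ t) = 1)
    (hesc : Tendsto (fun t => ‖γ t‖) atTop atTop) :
    ∃ a : Euc N × Euc N, a.1 ≠ 0 ∧ Tendsto (scatCurve γ) (𝓝[>] 0) (𝓝 (0, a)) := by
  obtain ⟨c, C, hc, hC, hcC⟩ := hm.exists_bounds hg
  obtain ⟨a, T, ha, hT, hlin⟩ := hm.exists_linear_escape hg hγ hE hesc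
  set S : ℝ := √(1 / c) with hS
  have hS0 : 0 ≤ S := Real.sqrt_nonneg _
  have hv : ∀ t, ‖deriv γ t‖ ≤ S := by
    intro t
    refine Real.le_sqrt_of_sq_le ?_
    have h1 := (hcC (γ t) (deriv γ t)).1
    rw [show matForm (g (γ t)) (deriv γ t) (deriv γ t) = 1 from hE t] at h1
    rw [le_div_iff₀ hc]
    linarith
  have d1 : ∀ t, HasDerivAt γ (deriv γ t) t := fun t => hasDerivAt_prod_fst (hγ.hasDerivAt t)
  have hz : ∀ t, 0 ≤ t → ‖γ t‖ ≤ ‖γ 0‖ + S * t := by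
    intro t ht
    have h1 := convex_univ.norm_image_sub_le_of_norm_hasDerivWithin_le (f := γ)
      (C := S) (x := 0) (y := t) (fun s _ => (d1 s).hasDerivWithinAt) (fun s _ => hv s)
      (Set.mem_univ _) (Set.mem_univ _)
    rw [sub_zero, Real.norm_eq_abs, abs_of_nonneg ht] at h1
    linarith [norm_le_norm_add_norm_sub' (γ t) (γ 0)]
  obtain ⟨M, hM⟩ := hm.exists_scaledAccel_bound (a := a / 2) (b := ‖γ 0‖ + S) (by positivity)
  -- The second bound makes `t = 1 / s - 1 ≥ T`, where the linear escape holds; the first turns `|s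
  -- γ| ≥ a (1 - s)` into `|s γ| ≥ a / 2`. On this range `s γ` lies in a fixed compact shell.
  set s₁ : ℝ := min (1 / 2) (T + 1)⁻¹ with hs₁
  have hs₁0 : 0 < s₁ := by positivity
  have hpos : ∀ s, 0 < s → s ≤ s₁ → a / 2 ≤ ‖s • γ (s⁻¹ - 1)‖ ∧
      ‖s • γ (s⁻¹ - 1)‖ ≤ ‖γ 0‖ + S := by
    intro s hs hss
    have hs2 : s ≤ 1 / 2 := hss.trans (min_le_left _ _)
    have hsT : T ≤ s⁻¹ - 1 := by
      have : T + 1 ≤ s⁻¹ := by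
        rw [le_inv_comm₀ (by positivity) hs]
        exact hss.trans (min_le_right _ _)
      linarith
    rw [norm_smul, Real.norm_eq_abs, abs_of_pos hs]
    have e : s * (s⁻¹ - 1) = 1 - s := by field_simp
    constructor
    · have := mul_le_mul_of_nonneg_left (hlin _ hsT) hs.le
      rw [mul_left_comm, e] at this
      nlinarith
    · have h1 := mul_le_mul_of_nonneg_left (hz _ (hT.le.trans hsT)) hs.le
      rw [mul_add, mul_left_comm, e] at h1
      nlinarith [norm_nonneg (γ 0)]
  have hlip : LipschitzOnWith (Real.toNNReal M) (fun s => (scatCurve γ s).2) (Set.Ioc 0 s₁) := by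
    refine (convex_Ioc 0 s₁).lipschitzOnWith_of_nnnorm_hasDerivWithin_le
      (f' := fun s => (scatField h (scatCurve γ s)).2)
      (fun s hs => (hasDerivAt_prod_snd (hm.hasDerivAt_scatCurve hg hγ hs.1)).hasDerivWithinAt)
      fun s hs => ?_
    rw [← NNReal.coe_le_coe, coe_nnnorm]
    refine le_trans ?_ (Real.le_coe_toNNReal M)
    have hs1 : s ≤ 1 := hs.2.trans ((min_le_left _ _).trans (by norm_num))
    have hb : ‖scaledAccel h (scatPos (scatCurve γ s), (scatCurve γ s).2.1)‖ ≤ M := by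
      rw [scatPos_scatCurve hs.1.ne']
      exact hM _ _ _ hs.1.le hs1 (hpos s hs.1 hs.2).1 (hpos s hs.1 hs.2).2
        ((hv _).trans (by linarith [norm_nonneg (γ 0)]))
    rw [Prod.norm_def]
    refine max_le ?_ ?_
    · change ‖s • scaledAccel h (scatPos (scatCurve γ s), (scatCurve γ s).2.1)‖ ≤ M
      rw [norm_smul, Real.norm_eq_abs, abs_of_pos hs.1]
      exact (mul_le_of_le_one_left (norm_nonneg _) hs1).trans hb
    · change ‖-scaledAccel h (scatPos (scatCurve γ s), (scatCurve γ s).2.1)‖ ≤ M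
      rw [norm_neg]
      exact hb
  -- A Lipschitz extension to the whole line is continuous at `0`, and its value there is the limit.
  obtain ⟨ψ, hψ, heq⟩ := hlip.extend_finite_dimension
  have hIoc : Set.Ioc 0 s₁ ∈ 𝓝[>] (0 : ℝ) := Ioc_mem_nhdsGT hs₁0
  have ht : Tendsto (fun s => (scatCurve γ s).2) (𝓝[>] 0) (𝓝 (ψ 0)) := by
    refine ((hψ.continuous.tendsto 0).mono_left nhdsWithin_le_nhds).congr' ?_
    filter_upwards [hIoc] with s hs
    exact (heq hs).symm
  have ht' : Tendsto (scatCurve γ) (𝓝[>] 0) (𝓝 (0, ψ 0)) :=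
    (tendsto_id.mono_left nhdsWithin_le_nhds).prodMk_nhds ht
  refine ⟨ψ 0, ?_, ht'⟩
  have hw : Tendsto (fun s => ‖(scatPos (scatCurve γ s)).2‖) (𝓝[>] 0) (𝓝 ‖(ψ 0).1‖) := by
    have := ((continuous_snd.comp contDiff_scatPos.continuous).norm.tendsto
      ((0, ψ 0) : ℝ × Euc N × Euc N)).comp ht'
    simp only [Function.comp_apply, scatPos_zero] at this
    exact this
  have hge : a / 2 ≤ ‖(ψ 0).1‖ := by
    refine ge_of_tendsto hw ?_
    filter_upwards [hIoc] with s hs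
    rw [scatPos_scatCurve hs.1.ne']
    exact (hpos s hs.1 hs.2).1
  exact norm_pos_iff.1 (lt_of_lt_of_le (by positivity) hge)

/-- The curve is continuous at `s = 0` and its derivative converges there to the value of the field,
so it is one-sidedly differentiable and solves the equation up to the endpoint. -/
theorem exists_isCurveIn_asympCurve (hm : IsScatteringModel g h W) (hg : IsMetric g)
    (hγ : IsGeodesic g γ) (hE : ∀ t, energy g (γ t, deriv γ t) = 1)
    (hesc : Tendsto (fun t => ‖γ t‖) atTop atTop) :
    ∃ a : Euc N × Euc N, IsCurveIn (scatField h) (scatDomain W) 0 1 (asympCurve γ a) := by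
  obtain ⟨a, ha, ht⟩ := hm.exists_tendsto_scatCurve hg hγ hE hesc
  refine ⟨a, hm.isCurveIn_asympCurve hg hγ ha ?_⟩
  have hd : ∀ s, 0 < s → HasDerivAt (asympCurve γ a) (scatField h (scatCurve γ s)) s := by
    intro s hs
    refine (hm.hasDerivAt_scatCurve hg hγ hs).congr_of_eventuallyEq ?_
    filter_upwards [isOpen_ne.mem_nhds hs.ne'] with r hr
    exact asympCurve_of_ne a hr
  refine hasDerivWithinAt_Ici_of_tendsto_deriv (s := Set.Ioi 0)
    (fun s hs => (hd s hs).differentiableAt.differentiableWithinAt) ?_ self_mem_nhdsWithin ?_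
  · rw [ContinuousWithinAt, asympCurve_zero]
    refine ht.congr' ?_
    filter_upwards [self_mem_nhdsWithin] with s hs
    exact (asympCurve_of_ne a (ne_of_gt hs)).symm
  · have hc : ContinuousAt (scatField h) (0, a) :=
      (hm.contDiffOn_scatField.contDiffAt
        (hm.isOpen_scatDomain.mem_nhds (hm.zero_mem_scatDomain ha))).continuousAt
    refine (hc.tendsto.comp ht).congr' ?_
    filter_upwards [self_mem_nhdsWithin] with s hs
    exact (hd s hs).deriv.symm

/-- Every asymptotic state is attained by a geodesic. -/
theorem exists_isGeodesic_isCurveIn (hm : IsScatteringModel g h W) (hg : IsMetric g)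
    {a : Euc N × Euc N} (ha : a.1 ≠ 0) :
    ∃ γ, IsGeodesic g γ ∧ IsCurveIn (scatField h) (scatDomain W) 0 1 (asympCurve γ a) := by
  obtain ⟨c, C, hc, hC, hcC⟩ := hm.exists_bounds hg
  have hX := hm.contDiffOn_scatField
  have hmem := hm.zero_mem_scatDomain ha
  have hopen := hm.isOpen_scatDomain
  -- Here the field must be defined on both sides of `s = 0`: `(0, a)` is an interior point of the
  -- domain.
  obtain ⟨α, hα0, ε, hε, hα⟩ := ((hX.contDiffAt (hopen.mem_nhds hmem)).of_le
    (m := 1) (by simp)).exists_forall_mem_closedBall_exists_eq_forall_mem_Ioo_hasDerivAt₀ 0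
  rw [zero_sub, zero_add] at hα
  have hαc : ContinuousAt α 0 := (hα 0 ⟨by linarith, hε⟩).continuousAt
  have hαmem : ∀ᶠ s in 𝓝 (0 : ℝ), α s ∈ scatDomain W := by
    refine hαc.eventually_mem ?_
    rw [hα0]
    exact hopen.mem_nhds hmem
  obtain ⟨δ, hδ, hδ'⟩ := Metric.eventually_nhds_iff.1 hαmem
  set s₁ : ℝ := min (min (ε / 2) (δ / 2)) 1 with hs₁
  have hs₁0 : 0 < s₁ := by positivity
  have hs₁ε : s₁ < ε := ((min_le_left _ _).trans (min_le_left _ _)).trans_lt (by linarith)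
  have hs₁δ : s₁ < δ := ((min_le_left _ _).trans (min_le_right _ _)).trans_lt (by linarith)
  have hαd : ∀ s ∈ Set.Icc 0 s₁, HasDerivAt α (scatField h (α s)) s := fun s hs =>
    hα s ⟨by linarith [hs.1], by linarith [hs.2]⟩
  have hαcurve : IsCurveIn (scatField h) (scatDomain W) 0 s₁ α := fun s hs =>
    ⟨hδ' (by rw [Real.dist_eq, sub_zero, abs_of_nonneg hs.1]; linarith [hs.2]),
      (hαd s hs).hasDerivWithinAt⟩
  have hα1 : (α s₁).1 = s₁ := by
    have hd : ∀ s ∈ Set.Icc 0 s₁, HasDerivAt (fun s => (α s).1 - s) 0 s := fun s hs => by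
      exact ((hasDerivAt_prod_fst (hαd s hs)).sub (hasDerivAt_id s)).congr_deriv (sub_self 1)
    have := (convex_Icc 0 s₁).norm_image_sub_le_of_norm_hasDerivWithin_le (C := 0)
      (f := fun s => (α s).1 - s) (fun s hs => (hd s hs).hasDerivWithinAt) (by simp)
      (Set.left_mem_Icc.2 hs₁0.le) (Set.right_mem_Icc.2 hs₁0.le)
    rw [zero_mul, norm_le_zero_iff, hα0] at this
    simpa [sub_eq_zero] using this
  -- The position `(v + s y) / s` inverts the change of variables at `s₁`; by uniqueness this
  -- geodesic follows `α` all the way down to `s = 0`.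
  obtain ⟨γ, hγ, hγ0, hγ1⟩ := exists_isGeodesic hg hc (fun z v => (hcC z v).1) (s₁⁻¹ - 1)
    (s₁⁻¹ • ((α s₁).2.1 + s₁ • (α s₁).2.2)) (α s₁).2.1
  have hend : scatCurve γ s₁ = α s₁ := by
    rw [scatCurve, hγ0, hγ1, smul_add, smul_smul, inv_mul_cancel₀ hs₁0.ne', one_smul,
      add_sub_cancel_left]
    exact Prod.ext hα1.symm rfl
  have heq : Set.EqOn (asympCurve γ a) α (Set.Icc 0 s₁) := by
    intro s hs
    rcases hs.1.eq_or_lt with rfl | hs0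
    · rw [asympCurve_zero, hα0]
    · rw [asympCurve_of_ne a hs0.ne']
      exact (hm.isCurveIn_scatCurve hg hγ hs0).eqOn hopen hX
        (hαcurve.mono (Set.Icc_subset_Icc_left hs.1)) (t₀ := s₁) ⟨hs.2, le_rfl⟩ hend ⟨le_rfl, hs.2⟩
  refine ⟨γ, hγ, hm.isCurveIn_asympCurve hg hγ ha ?_⟩
  have h0 : (0 : ℝ) ∈ Set.Icc 0 s₁ := ⟨le_rfl, hs₁0.le⟩
  have := (hαcurve 0 h0).2.congr heq (heq h0)
  rw [hα0] at this
  exact this.mono_of_mem_nhdsWithin (Icc_mem_nhdsGE hs₁0)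

end IsScatteringModel

end Asymptotics

/-! ### Smooth families of integral curves -/

section Families

variable {E P F : Type*} [NormedAddCommGroup E] [NormedSpace ℝ E] [NormedAddCommGroup P]
  [NormedSpace ℝ P] [NormedAddCommGroup F] [NormedSpace ℝ F]

/-- A family of integral curves on `[a, b]` whose values at one time depend smoothly on a parameter
depends smoothly on the parameter at all times. -/
theorem exists_contDiffAt_family [FiniteDimensional ℝ E] {f : E → E} {U : Set E}
    (hU : IsOpen U) (hf : ContDiffOn ℝ ∞ f U) {a b t₀ : ℝ} (ht₀ : t₀ ∈ Set.Icc a b)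
    {c : P → ℝ → E} {x : P → E} {p₀ : P} (hx : ContDiffAt ℝ ∞ x p₀)
    (hc : ∀ᶠ p in 𝓝 p₀, IsCurveIn f U a b (c p) ∧ c p t₀ = x p) :
    ∃ Ψ : ℝ × P → E, (∀ s, ContDiffAt ℝ ∞ Ψ (s, p₀)) ∧
      (∀ᶠ p in 𝓝 p₀, ∀ s ∈ Set.Icc a b, Ψ (s, p) = c p s) ∧
      ∀ s ∈ Set.Icc a b, ∀ᶠ q in 𝓝 (s, p₀),
        HasDerivAt (fun r => Ψ (r, q.2)) (f (Ψ q)) q.1 := by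
  obtain ⟨h0, h0'⟩ := hc.self_of_nhds
  obtain ⟨Φ, hΦ, hΦ0, -, hΦd⟩ := h0.exists_contDiff_flow hU hf ht₀
  rw [h0'] at hΦd
  refine ⟨fun q => Φ (q.1, x q.2), fun s => ?_, ?_, fun s hs => ?_⟩
  · exact hΦ.contDiffAt.comp (s, p₀)
      (contDiffAt_fst.prodMk (ContDiffAt.comp (s, p₀) hx contDiffAt_snd))
  · have hall : ∀ᶠ y in 𝓝 (x p₀), ∀ t ∈ Set.Icc a b,
        Φ (t, y) ∈ U ∧ HasDerivAt (fun s => Φ (s, y)) (f (Φ (t, y))) t := by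
      refine isCompact_Icc.eventually_forall_of_forall_eventually fun t ht => ?_
      have h1 : Tendsto (fun z : E × ℝ => (z.2, z.1)) (𝓝 (x p₀, t)) (𝓝 (t, x p₀)) :=
        continuous_swap.tendsto _
      exact h1.eventually (hΦd t ht)
    filter_upwards [hx.continuousAt.eventually hall, hc] with p hp hcp s hs
    have h2 : IsCurveIn f U a b (fun t => Φ (t, x p)) := fun t ht =>
      ⟨(hp t ht).1, (hp t ht).2.hasDerivWithinAt⟩
    exact h2.eqOn hU hf hcp.1 ht₀ ((hΦ0 _).trans hcp.2.symm) hs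
  · have h1 : Tendsto (fun q : ℝ × P => (q.1, x q.2)) (𝓝 (s, p₀)) (𝓝 (s, x p₀)) := by
      refine Tendsto.prodMk_nhds continuousAt_fst ?_
      exact hx.continuousAt.tendsto.comp continuousAt_snd
    exact (h1.eventually (hΦd s hs)).mono fun q hq => hq.2

theorem continuousAt_fderiv_slice {f : ℝ × P → F} {s₀ : ℝ} {p₀ : P}
    (hf : ContDiffAt ℝ ∞ f (s₀, p₀)) (η : P) :
    ContinuousAt (fun s => fderiv ℝ (fun p => f (s, p)) p₀ η) s₀ := by
  have hcont : Tendsto (fun s : ℝ => (s, p₀)) (𝓝 s₀) (𝓝 (s₀, p₀)) :=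
    (Continuous.prodMk_left p₀).tendsto s₀
  have h1 : ContDiffAt ℝ 1 f (s₀, p₀) := hf.of_le (by simp)
  have e1 : (fun s => fderiv ℝ (fun x => f (s, x)) p₀ η) =ᶠ[𝓝 s₀]
      fun s => fderiv ℝ f (s, p₀) (0, η) := by
    filter_upwards [hcont.eventually (h1.eventually (by simp))] with s hs
    have := HasFDerivAt.comp (f := fun x => (s, x)) p₀ (hs.differentiableAt (by simp)).hasFDerivAt
      (hasFDerivAt_prodMk_right s p₀)
    exact congrArg (fun A : P →L[ℝ] F => A η) this.fderiv
  refine ContinuousAt.congr ?_ e1.symm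
  have h2 : ContinuousAt (fderiv ℝ f) (s₀, p₀) :=
    (hf.fderiv_right (m := 0) (by simp)).continuousAt
  exact ((ContinuousLinearMap.apply ℝ F ((0, η) : ℝ × P)).continuous.continuousAt).comp
    (h2.tendsto.comp hcont : ContinuousAt (fun s => fderiv ℝ f (s, p₀)) s₀)

theorem contDiffAt_slice {f : ℝ × P → F} {s₀ : ℝ} {p₀ : P} (hf : ContDiffAt ℝ ∞ f (s₀, p₀)) :
    ContDiffAt ℝ ∞ (fun p => f (s₀, p)) p₀ :=
  ContDiffAt.comp p₀ hf (contDiffAt_const.prodMk contDiffAt_id)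

end Families

/-! ### Unit vectors and unit codirections -/

section InitialVelocity

variable {N : ℕ} {g : Euc N → Matrix (Fin N) (Fin N) ℝ} {p : Euc N × Euc N}

/-- The dual norm squared `gⁱʲ wᵢ wⱼ`. -/
def cometric (g : Euc N → Matrix (Fin N) (Fin N) ℝ) (p : Euc N × Euc N) : ℝ :=
  p.2.ofLp ⬝ᵥ ((g p.1)⁻¹ *ᵥ p.2.ofLp)

/-- The unit vector dual to the positive multiple of `w` of unit length. -/
def initialVelocity (g : Euc N → Matrix (Fin N) (Fin N) ℝ) (p : Euc N × Euc N) : Euc N :=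
  WithLp.toLp 2 ((g p.1)⁻¹ *ᵥ ((√(cometric g p))⁻¹ • p.2.ofLp))

theorem cometric_pos (hg : IsMetric g) (hp : p.2 ≠ 0) : 0 < cometric g p := by
  have := matForm_pos (hg.posDef p.1).inv hp
  rwa [matForm_eq_dotProduct] at this

theorem contDiffAt_cometric (hg : IsMetric g) : ContDiffAt ℝ ∞ (cometric g) p := by
  have : cometric g = fun p => matForm ((g p.1)⁻¹) p.2 p.2 := by
    ext p
    rw [matForm_eq_dotProduct]
    rfl
  rw [this]
  exact contDiffAt_matForm (Q := fun p : Euc N × Euc N => (g p.1)⁻¹)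
    (contDiffAt_inv_apply (fun i j => (hg.smooth i j).contDiffAt.comp p contDiffAt_fst)
      (hg.det_ne_zero _)) contDiffAt_snd contDiffAt_snd

theorem contDiffAt_initialVelocity (hg : IsMetric g) (hp : p.2 ≠ 0) :
    ContDiffAt ℝ ∞ (initialVelocity g) p := by
  rw [contDiffAt_euclidean]
  intro k
  simp only [initialVelocity, Matrix.mulVec, dotProduct, Pi.smul_apply, smul_eq_mul]
  refine ContDiffAt.sum fun i _ => (contDiffAt_inv_apply
    (Q := fun p : Euc N × Euc N => g p.1)
    (fun i j => (hg.smooth i j).contDiffAt.comp p contDiffAt_fst) (hg.det_ne_zero _) k i).mul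
    (ContDiffAt.mul ?_ (contDiffAt_coord contDiffAt_snd i))
  exact ((contDiffAt_cometric hg).sqrt (cometric_pos hg hp).ne').inv
    (Real.sqrt_pos.2 (cometric_pos hg hp)).ne'

/-- Lowering the index undoes raising it. This is how the conserved pairing at `t = 0` becomes a
multiple of the canonical form. -/
theorem matForm_initialVelocity (hg : IsMetric g) (η : Euc N) :
    matForm (g p.1) (initialVelocity g p) η = (√(cometric g p))⁻¹ * inner ℝ p.2 η := by
  rw [matForm_comm (hg.isSymm _), matForm_eq_dotProduct, initialVelocity, Matrix.mulVec_mulVec,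
    Matrix.mul_nonsing_inv _ (isUnit_iff_ne_zero.2 (hg.det_ne_zero _)), Matrix.one_mulVec,
    dotProduct_smul, smul_eq_mul, EuclideanSpace.inner_eq_star_dotProduct, star_trivial]

theorem energy_initialVelocity (hg : IsMetric g) (hp : p.2 ≠ 0) :
    energy g (p.1, initialVelocity g p) = 1 := by
  have hpos := cometric_pos hg hp
  have h1 : inner ℝ p.2 (initialVelocity g p) = (√(cometric g p))⁻¹ * cometric g p := by
    rw [EuclideanSpace.inner_eq_star_dotProduct, star_trivial, initialVelocity, dotProduct_comm,
      Matrix.mulVec_smul, dotProduct_smul]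
    rfl
  change matForm (g p.1) (initialVelocity g p) (initialVelocity g p) = 1
  rw [matForm_initialVelocity hg, h1, ← mul_assoc, ← mul_inv, Real.mul_self_sqrt hpos.le,
    inv_mul_cancel₀ hpos.ne']

theorem initialVelocity_ne_zero (hg : IsMetric g) (hp : p.2 ≠ 0) : initialVelocity g p ≠ 0 := by
  intro h0
  have := energy_initialVelocity hg hp
  rw [energy, h0] at this
  simp [matForm] at this

/-- The Euclidean unit covector dual to `v`. -/
def codirection (g : Euc N → Matrix (Fin N) (Fin N) ℝ) (p : Euc N × Euc N) : Euc N :=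
  ‖(WithLp.toLp 2 (g p.1 *ᵥ p.2.ofLp) : Euc N)‖⁻¹ • WithLp.toLp 2 (g p.1 *ᵥ p.2.ofLp)

theorem lower_ne_zero (hg : IsMetric g) (hp : p.2 ≠ 0) :
    (WithLp.toLp 2 (g p.1 *ᵥ p.2.ofLp) : Euc N) ≠ 0 := by
  intro h0
  have h1 := matForm_pos (hg.posDef p.1) hp
  have h2 : g p.1 *ᵥ p.2.ofLp = 0 := congrArg WithLp.ofLp h0
  rw [matForm_eq_dotProduct, h2, dotProduct_zero] at h1
  exact lt_irrefl _ h1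

theorem contDiffAt_codirection (hg : IsMetric g) (hp : p.2 ≠ 0) :
    ContDiffAt ℝ ∞ (codirection g) p := by
  have h1 : ContDiffAt ℝ ∞ (fun p : Euc N × Euc N =>
      (WithLp.toLp 2 (g p.1 *ᵥ p.2.ofLp) : Euc N)) p := by
    rw [contDiffAt_euclidean]
    intro k
    simp only [Matrix.mulVec, dotProduct]
    exact ContDiffAt.sum fun i _ => ((hg.smooth k i).contDiffAt.comp p contDiffAt_fst).mul
      (contDiffAt_coord contDiffAt_snd i)
  have hne := lower_ne_zero hg hp
  exact ((h1.norm ℝ hne).inv (norm_ne_zero_iff.2 hne)).smul h1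

theorem norm_codirection (hg : IsMetric g) (hp : p.2 ≠ 0) : ‖codirection g p‖ = 1 :=
  norm_smul_inv_norm (𝕜 := ℝ) (lower_ne_zero hg hp)

/-- Together with `initialVelocity_codirection`: over each point, raising and lowering indices with
normalisation are inverse bijections between Euclidean unit covectors and vectors of unit energy. -/
theorem codirection_initialVelocity (hg : IsMetric g) (hp : ‖p.2‖ = 1) :
    codirection g (p.1, initialVelocity g p) = p.2 := by
  have hp0 : p.2 ≠ 0 := norm_ne_zero_iff.1 (by rw [hp]; exact one_ne_zero)
  have hpos : 0 < (√(cometric g p))⁻¹ := inv_pos.2 (Real.sqrt_pos.2 (cometric_pos hg hp0))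
  have h1 : (WithLp.toLp 2 (g p.1 *ᵥ (initialVelocity g p).ofLp) : Euc N) =
      (√(cometric g p))⁻¹ • p.2 := by
    rw [initialVelocity, Matrix.mulVec_mulVec,
      Matrix.mul_nonsing_inv _ (isUnit_iff_ne_zero.2 (hg.det_ne_zero _)), Matrix.one_mulVec]
    rfl
  rw [codirection, h1, norm_smul, hp, mul_one, Real.norm_eq_abs, abs_of_pos hpos, smul_smul,
    inv_mul_cancel₀ hpos.ne', one_smul]

theorem initialVelocity_codirection (hg : IsMetric g) (hp : energy g p = 1) :
    initialVelocity g (p.1, codirection g p) = p.2 := by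
  have hp0 : p.2 ≠ 0 := by
    intro h0
    rw [energy, h0] at hp
    simp [matForm] at hp
  set ζ : Fin N → ℝ := g p.1 *ᵥ p.2.ofLp with hζ
  set c : ℝ := ‖(WithLp.toLp 2 ζ : Euc N)‖⁻¹ with hc
  have hc0 : 0 < c := inv_pos.2 (norm_pos_iff.2 (lower_ne_zero hg hp0))
  have h1 : (g p.1)⁻¹ *ᵥ ζ = p.2.ofLp := by
    rw [hζ, Matrix.mulVec_mulVec, Matrix.nonsing_inv_mul _ (isUnit_iff_ne_zero.2 (hg.det_ne_zero _)),
      Matrix.one_mulVec]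
  have h2 : (codirection g p).ofLp = c • ζ := rfl
  have h3 : cometric g (p.1, codirection g p) = c ^ 2 := by
    simp only [cometric]
    rw [h2, Matrix.mulVec_smul, h1, smul_dotProduct, dotProduct_smul, dotProduct_comm, hζ,
      ← matForm_eq_dotProduct, show matForm (g p.1) p.2 p.2 = 1 from hp]
    simp [sq]
  simp only [initialVelocity]
  rw [h3, h2, Real.sqrt_sq hc0.le, smul_smul, inv_mul_cancel₀ hc0.ne', one_smul, h1]

end InitialVelocity

/-! ### The conserved pairing and its limit at infinity -/

section Contact

variable {N : ℕ} {g : Euc N → Matrix (Fin N) (Fin N) ℝ} {h : Fin N → Fin N → ℝ × Euc N → ℝ}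
  {W : Set (ℝ × Euc N)} {P : Type*} [NormedAddCommGroup P] [NormedSpace ℝ P]

/-- The differential of the energy of a family of tangent vectors. -/
theorem energy_variation (hg : IsMetric g) {Z V : P → Euc N} {p₀ : P}
    (hZ : DifferentiableAt ℝ Z p₀) (hV : DifferentiableAt ℝ V p₀) {e : ℝ}
    (hE : ∀ᶠ p in 𝓝 p₀, energy g (Z p, V p) = e) (η : P) :
    triForm (metricDeriv g (Z p₀)) (fderiv ℝ Z p₀ η) (V p₀) (V p₀) +
      2 * matForm (g (Z p₀)) (V p₀) (fderiv ℝ V p₀ η) = 0 := by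
  have hline : Tendsto (fun τ : ℝ => p₀ + τ • η) (𝓝 0) (𝓝 p₀) := by
    have : Continuous fun τ : ℝ => p₀ + τ • η := by fun_prop
    simpa using this.tendsto 0
  have dZ : HasDerivAt (fun τ : ℝ => Z (p₀ + τ • η)) (fderiv ℝ Z p₀ η) 0 :=
    hZ.hasFDerivAt.hasLineDerivAt η
  have dV : HasDerivAt (fun τ : ℝ => V (p₀ + τ • η)) (fderiv ℝ V p₀ η) 0 :=
    hV.hasFDerivAt.hasLineDerivAt η
  have h1 := hasDerivAt_matForm (fun i j => hg.differentiableAt _ i j) dZ dV dV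
  have h2 : HasDerivAt (fun τ : ℝ => matForm (g (Z (p₀ + τ • η))) (V (p₀ + τ • η))
      (V (p₀ + τ • η))) 0 0 :=
    (hasDerivAt_const (0 : ℝ) e).congr_of_eventuallyEq (hline.eventually hE)
  have h3 := h1.unique h2
  simp only [zero_smul, add_zero] at h3
  rw [matForm_comm (hg.isSymm _) (fderiv ℝ V p₀ η)] at h3
  linarith

/-- Along a variation of geodesics of equal energy, the pairing of the velocity with the variation
field is constant. -/
theorem hasDerivAt_pairing (hg : IsMetric g) {Z V : ℝ × P → Euc N} {c : ℝ → ℝ} {s : ℝ} {p₀ : P}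
    (hZ : ContDiffAt ℝ 2 Z (s, p₀)) (hV : DifferentiableAt ℝ V (s, p₀))
    (hZ' : ∀ᶠ q in 𝓝 (s, p₀), HasDerivAt (fun r => Z (r, q.2)) (c q.1 • V q) q.1)
    (hV' : HasDerivAt (fun r => V (r, p₀))
      (c s • -accel (g (Z (s, p₀))) (metricDeriv g (Z (s, p₀))) (V (s, p₀))) s) {e : ℝ}
    (hE : ∀ᶠ p in 𝓝 p₀, energy g (Z (s, p), V (s, p)) = e) (η : P) :
    HasDerivAt (fun r => matForm (g (Z (r, p₀))) (V (r, p₀))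
      (fderiv ℝ (fun p => Z (r, p)) p₀ η)) 0 s := by
  have hsl : DifferentiableAt ℝ (fun p : P => (s, p)) p₀ :=
    (differentiableAt_const s).prodMk differentiableAt_id
  have sZ : DifferentiableAt ℝ (fun p => Z (s, p)) p₀ :=
    DifferentiableAt.comp (g := Z) p₀ (hZ.differentiableAt (by simp)) hsl
  have sV : DifferentiableAt ℝ (fun p => V (s, p)) p₀ := DifferentiableAt.comp (g := V) p₀ hV hsl
  have h1 := energy_variation hg sZ sV hE η
  have h2 := hasDerivAt_fderiv_of_eventually (D := fun q => c q.1 • V q) hZ hZ' η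
  have h3 := hasDerivAt_matForm (fun i j => hg.differentiableAt _ i j) hZ'.self_of_nhds hV' h2
  refine h3.congr_deriv ?_
  have h4 : fderiv ℝ (fun p => c s • V (s, p)) p₀ η = c s • fderiv ℝ (fun p => V (s, p)) p₀ η := by
    rw [fderiv_fun_const_smul sV]
    rfl
  simp only
  rw [h4, triForm_smul₁, matForm_smul_left, matForm_smul_right, ← neg_one_smul ℝ (accel _ _ _),
    matForm_smul_left, matForm_accel (hg.isSymm _) (hg.det_ne_zero _)]
  -- Koszul's formula leaves `c / 2` times the variation of the energy, which vanishes.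
  linear_combination (c s / 2) * h1

namespace IsScatteringModel

/-- The conserved pairing of the velocity with the variation field, between `s = 0` and `s = 1`. -/
theorem pairing_eq (hm : IsScatteringModel g h W) (hg : IsMetric g) {V Y : ℝ × P → Euc N} {p₀ : P}
    (hV : ∀ s, ContDiffAt ℝ ∞ V (s, p₀)) (hY : ∀ s, ContDiffAt ℝ ∞ Y (s, p₀))
    (h0 : V (0, p₀) ≠ 0)
    (hV' : ∀ s ∈ Set.Ioo (0 : ℝ) 1, ∀ᶠ q in 𝓝 (s, p₀), HasDerivAt (fun r => V (r, q.2))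
      (q.1 • scaledAccel h ((q.1, V q + q.1 • Y q), V q)) q.1)
    (hY' : ∀ s ∈ Set.Ioo (0 : ℝ) 1, ∀ᶠ q in 𝓝 (s, p₀), HasDerivAt (fun r => Y (r, q.2))
      (-scaledAccel h ((q.1, V q + q.1 • Y q), V q)) q.1)
    (hE : ∀ᶠ p in 𝓝 p₀, ∀ s ∈ Set.Icc (0 : ℝ) 1,
      matForm (scaledMetric h (s, V (s, p) + s • Y (s, p))) (V (s, p)) (V (s, p)) = 1) (η : P) :
    inner ℝ (V (0, p₀)) (fderiv ℝ (fun p => V (0, p)) p₀ η) = 0 ∧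
    inner ℝ (V (0, p₀)) (fderiv ℝ (fun p => Y (0, p)) p₀ η) =
      matForm (g (V (1, p₀) + Y (1, p₀))) (V (1, p₀))
        (fderiv ℝ (fun p => V (1, p) + Y (1, p)) p₀ η) := by
  set H : ℝ × P → Matrix (Fin N) (Fin N) ℝ := fun q =>
    Matrix.of fun i j => h i j (q.1, V q + q.1 • Y q) with hH
  set k : ℝ × P → ℝ := fun q => matForm (H q) (V q) (V q) with hk
  set v : ℝ → Euc N := fun s => V (s, p₀) with hv
  set dV : ℝ → Euc N := fun s => fderiv ℝ (fun p => V (s, p)) p₀ η with hdV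
  set dY : ℝ → Euc N := fun s => fderiv ℝ (fun p => Y (s, p)) p₀ η with hdY
  set dk : ℝ → ℝ := fun s => fderiv ℝ (fun p => k (s, p)) p₀ η with hdk
  have hmat : ∀ s p (a b : Euc N), matForm (scaledMetric h (s, V (s, p) + s • Y (s, p))) a b =
      inner ℝ a b + s ^ 2 * matForm (H (s, p)) a b := by
    intro s p a b
    rw [← matForm_one]
    simp only [matForm, scaledMetric_apply, hH, Finset.mul_sum, Matrix.of_apply,
      ← Finset.sum_add_distrib]
    refine Finset.sum_congr rfl fun i _ => Finset.sum_congr rfl fun j _ => by ring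
  have hmemW : ∀ s ∈ Set.Icc (0 : ℝ) 1, (s, V (s, p₀) + s • Y (s, p₀)) ∈ W := by
    intro s hs
    rcases hs.1.eq_or_lt with rfl | hs0
    · rw [zero_smul, add_zero]
      exact hm.zero_mem _ h0
    · exact hm.pos_mem _ hs0
  have hHs : ∀ s ∈ Set.Icc (0 : ℝ) 1, ∀ i j, ContDiffAt ℝ ∞ (fun q => H q i j) (s, p₀) := by
    intro s hs i j
    exact ContDiffAt.comp (g := h i j) (f := fun q : ℝ × P => (q.1, V q + q.1 • Y q)) (s, p₀)
      (hm.contDiffAt (hmemW s hs) i j)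
      (contDiffAt_fst.prodMk ((hV s).add (contDiffAt_fst.smul (hY s))))
  have hks : ∀ s ∈ Set.Icc (0 : ℝ) 1, ContDiffAt ℝ ∞ k (s, p₀) := fun s hs =>
    contDiffAt_matForm (hHs s hs) (hV s) (hV s)
  have dsl : ∀ {F : Type _} [NormedAddCommGroup F] [NormedSpace ℝ F] {f : ℝ × P → F} {s : ℝ},
      ContDiffAt ℝ ∞ f (s, p₀) → DifferentiableAt ℝ (fun p => f (s, p)) p₀ := fun hf =>
    (contDiffAt_slice hf).differentiableAt (by simp)
  -- Unit energy reads `|v|² + s² k = 1`; its variation shows that `⟨v, δv⟩` is of order `s²`.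
  have hvar : ∀ s ∈ Set.Icc (0 : ℝ) 1, 2 * inner ℝ (v s) (dV s) + s ^ 2 * dk s = 0 := by
    intro s hs
    have e1 : HasFDerivAt (fun p => inner ℝ (V (s, p)) (V (s, p)) + s ^ 2 * k (s, p)) _ p₀ :=
      ((dsl (hV s)).hasFDerivAt.inner ℝ (dsl (hV s)).hasFDerivAt).add
        ((dsl (hks s hs)).hasFDerivAt.const_mul (s ^ 2))
    have e2 : HasFDerivAt (fun p => inner ℝ (V (s, p)) (V (s, p)) + s ^ 2 * k (s, p))
        (0 : P →L[ℝ] ℝ) p₀ := by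
      refine (hasFDerivAt_const (1 : ℝ) p₀).congr_of_eventuallyEq ?_
      filter_upwards [hE] with p hp
      rw [← hp s hs, hmat]
    have e3 := congrArg (fun A : P →L[ℝ] ℝ => A η) (e1.unique e2)
    simp [fderivInnerCLM_apply] at e3
    rw [real_inner_comm (V (s, p₀))] at e3
    simp only [hv, hdV, hdk]
    linarith
  have h0mem : (0 : ℝ) ∈ Set.Icc (0 : ℝ) 1 := ⟨le_rfl, zero_le_one⟩
  have h1mem : (1 : ℝ) ∈ Set.Icc (0 : ℝ) 1 := ⟨zero_le_one, le_rfl⟩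
  refine ⟨by simpa using hvar 0 h0mem, ?_⟩
  -- This is the pairing of `v` with `δz = δv / s + δy`, where the singular term `⟨v, δv⟩ / s` has
  -- been replaced by `-s δk / 2` through `hvar`, so that it makes sense and is continuous at `s =
  -- 0`.
  set Q : ℝ → ℝ := fun s => inner ℝ (v s) (dY s) + s ^ 2 * matForm (H (s, p₀)) (v s) (dY s) +
    s * (matForm (H (s, p₀)) (v s) (dV s) - 1 / 2 * dk s) with hQ
  set Z : ℝ × P → Euc N := fun q => q.1⁻¹ • V q + Y q with hZ
  have hZs : ∀ s, 0 < s → ContDiffAt ℝ ∞ Z (s, p₀) := fun s hs =>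
    ((contDiffAt_fst.inv hs.ne').smul (hV s)).add (hY s)
  have hZeq : ∀ s p, 0 < s → Z (s, p) = s⁻¹ • (V (s, p) + s • Y (s, p)) := by
    intro s p hs
    rw [smul_add, smul_smul, inv_mul_cancel₀ hs.ne', one_smul]
  have hdZ : ∀ s, fderiv ℝ (fun p => Z (s, p)) p₀ η = s⁻¹ • dV s + dY s := by
    intro s
    have : HasFDerivAt (fun p => Z (s, p)) _ p₀ :=
      ((dsl (hV s)).hasFDerivAt.const_smul s⁻¹).add (dsl (hY s)).hasFDerivAt
    rw [this.fderiv]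
    rfl
  have hQeq : ∀ s ∈ Set.Ioc (0 : ℝ) 1,
      matForm (g (Z (s, p₀))) (V (s, p₀)) (fderiv ℝ (fun p => Z (s, p)) p₀ η) = Q s := by
    intro s hs
    rw [hZeq s p₀ hs.1, hm.eq _ _ hs.1, hdZ, hmat, inner_add_right, inner_smul_right,
      matForm_add_right, matForm_smul_right]
    have e := hvar s ⟨hs.1.le, hs.2⟩
    have hs0 := hs.1.ne'
    simp only [hQ, hv] at e ⊢
    field_simp
    linear_combination e
  have hQd : ∀ s ∈ Set.Ioo (0 : ℝ) 1, HasDerivAt Q 0 s := by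
    intro s hs
    have hs0 := hs.1.ne'
    have hpos : ∀ᶠ q : ℝ × P in 𝓝 (s, p₀), 0 < q.1 :=
      continuousAt_fst.eventually (lt_mem_nhds hs.1)
    have d1 : ∀ᶠ q in 𝓝 (s, p₀),
        HasDerivAt (fun r => Z (r, q.2)) (-(q.1 ^ 2)⁻¹ • V q) q.1 := by
      filter_upwards [hV' s hs, hY' s hs, hpos] with q h1 h2 h3
      refine (((hasDerivAt_inv h3.ne').smul h1).add h2).congr_deriv ?_
      rw [smul_smul, inv_mul_cancel₀ h3.ne', one_smul]
      abel
    have d2 := (hV' s hs).self_of_nhds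
    have e : accel (g (Z (s, p₀))) (metricDeriv g (Z (s, p₀))) (V (s, p₀)) =
        s ^ 3 • scaledAccel h ((s, V (s, p₀) + s • Y (s, p₀)), V (s, p₀)) := by
      rw [hZeq s p₀ hs.1, hm.accel_eq hg hs.1]
    have := hasDerivAt_pairing hg (c := fun r => -(r ^ 2)⁻¹) ((hZs s hs.1).of_le ENat.LEInfty.out)
      ((hV s).differentiableAt (by simp)) d1 (d2.congr_deriv ?_) (e := 1) ?_ η
    · refine this.congr_of_eventuallyEq ?_
      filter_upwards [Ioo_mem_nhds hs.1 hs.2] with r hr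
      exact (hQeq r ⟨hr.1, hr.2.le⟩).symm
    · rw [e, smul_neg, neg_smul, neg_neg, smul_smul]
      congr 1
      field_simp
    · filter_upwards [hE] with p hp
      rw [← hp s ⟨hs.1.le, hs.2.le⟩, energy, hZeq s p hs.1]
      simp only
      rw [hm.eq _ _ hs.1]
  have hQc : ContinuousOn Q (Set.Icc 0 1) := by
    intro s hs
    have hcont : ContinuousAt (fun r : ℝ => (r, p₀)) s :=
      (Continuous.prodMk_left p₀).continuousAt
    have c1 : ContinuousAt v s := ContinuousAt.comp (g := V) (hV s).continuousAt hcont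
    have c2 : ContinuousAt dV s := continuousAt_fderiv_slice (hV s) η
    have c3 : ContinuousAt dY s := continuousAt_fderiv_slice (hY s) η
    have c4 : ContinuousAt dk s := continuousAt_fderiv_slice (hks s hs) η
    have c5 : ∀ {a : ℝ → Euc N}, ContinuousAt a s →
        ContinuousAt (fun r => matForm (H (r, p₀)) (v r) (a r)) s := by
      intro a ha
      simp only [matForm]
      have hcoord : ∀ {b : ℝ → Euc N}, ContinuousAt b s → ∀ i, ContinuousAt (fun r => b r i) s :=
        fun hb i => (EuclideanSpace.proj i : Euc N →L[ℝ] ℝ).continuous.continuousAt.comp hb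
      refine tendsto_finsetSum _ fun i _ => tendsto_finsetSum _ fun j _ => ?_
      exact ((ContinuousAt.comp (f := fun r : ℝ => (r, p₀)) (g := fun q => H q i j)
        (hHs s hs i j).continuousAt hcont).mul
        (hcoord c1 i)).mul (hcoord ha j)
    exact (((c1.inner c3).add ((continuousAt_id.pow 2).mul (c5 c3))).add
      (continuousAt_id.mul ((c5 c2).sub (continuousAt_const.mul c4)))).continuousWithinAt
  -- Continuity on `[0, 1]` and zero derivative inside carry the conserved value to the endpoint at
  -- infinity.
  obtain ⟨r, -, hr⟩ := exists_hasDerivAt_eq_slope Q (fun _ => 0) zero_lt_one hQc hQd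
  have h01 : Q 0 = Q 1 := by
    rw [sub_zero, div_one] at hr
    linarith
  have hQ0 : Q 0 = inner ℝ (V (0, p₀)) (fderiv ℝ (fun p => Y (0, p)) p₀ η) := by
    simp [hQ, hv, hdY]
  rw [← hQ0, h01, ← hQeq 1 ⟨one_pos, le_rfl⟩]
  simp only [hZ, inv_one, one_smul]

end IsScatteringModel

end Contact

/-! ### The scattering map, its inverse and their smoothness -/

section ScatteringRelation

variable {N : ℕ} {g : Euc N → Matrix (Fin N) (Fin N) ℝ} {h : Fin N → Fin N → ℝ × Euc N → ℝ}
  {W : Set (ℝ × Euc N)} {γ : ℝ → Euc N}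

theorem asympCurve_fst (a : Euc N × Euc N) (s : ℝ) : (asympCurve γ a s).1 = s := by
  by_cases hs : s = 0
  · rw [hs, asympCurve_zero]
  · rw [asympCurve_of_ne a hs]
    rfl

theorem asympCurve_one (a : Euc N × Euc N) :
    asympCurve γ a 1 = (1, deriv γ 0, γ 0 - deriv γ 0) := by
  rw [asympCurve_of_ne a one_ne_zero, scatCurve, inv_one, sub_self, one_smul]

/-- The asymptotic state at `s = 0` of a curve `t θ - ξ + o(1)`. -/
def asympState (q : Euc N × Euc N) : Euc N × Euc N := (q.1, -(q.2 + q.1))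

/-- The geodesic with initial point and codirection `p` is asymptotic to `t θ - ξ`, where
`q = (θ, ξ)`. -/
def IsScattered (g : Euc N → Matrix (Fin N) (Fin N) ℝ) (h : Fin N → Fin N → ℝ × Euc N → ℝ)
    (W : Set (ℝ × Euc N)) (p q : Euc N × Euc N) (γ : ℝ → Euc N) : Prop :=
  IsGeodesic g γ ∧ γ 0 = p.1 ∧ deriv γ 0 = initialVelocity g p ∧
    IsCurveIn (scatField h) (scatDomain W) 0 1 (asympCurve γ (asympState q))

namespace IsScatteringModel

theorem scatEnergy_asympCurve (hm : IsScatteringModel g h W) (hg : IsMetric g)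
    (hγ : IsGeodesic g γ) {a : Euc N × Euc N}
    (hc : IsCurveIn (scatField h) (scatDomain W) 0 1 (asympCurve γ a)) {s : ℝ} (hs : 0 ≤ s) :
    scatEnergy h (asympCurve γ a s) = energy g (γ 0, deriv γ 0) := by
  rcases hs.eq_or_lt with rfl | hs0
  · rw [asympCurve_zero, hm.energy_eq_norm_sq hg hγ hc, scatEnergy, scatPos_zero, scaledMetric_zero,
      matForm_one, real_inner_self_eq_norm_sq]
  · rw [asympCurve_of_ne a hs0.ne', hm.scatEnergy_scatCurve hs0, hγ.energy_eq hg]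

theorem exists_isScattered (hm : IsScatteringModel g h W) (hg : IsMetric g)
    (hnt : IsNontrapping g) {p : Euc N × Euc N} (hp : p.2 ≠ 0) : ∃ q γ, IsScattered g h W p q γ := by
  obtain ⟨c, C, hc, -, hcC⟩ := hm.exists_bounds hg
  obtain ⟨γ, hγ, h0, h1⟩ := exists_isGeodesic hg hc (fun z v => (hcC z v).1) 0 p.1
    (initialVelocity g p)
  have hE : ∀ t, energy g (γ t, deriv γ t) = 1 := fun t => by
    rw [hγ.energy_eq hg t 0, h0, h1, energy_initialVelocity hg hp]
  obtain ⟨a, ha⟩ := hm.exists_isCurveIn_asympCurve hg hγ hE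
    (hnt γ hγ (by rw [h1]; exact initialVelocity_ne_zero hg hp)).1
  -- This inverts `asympState`. The extra `θ` there comes from `t = 1 / s - 1`, by which `t θ - ξ =
  -- θ / s - (ξ + θ)`.
  refine ⟨(a.1, -a.2 - a.1), γ, hγ, h0, h1, ?_⟩
  have : asympState (a.1, -a.2 - a.1) = a := by simp [asympState]
  rwa [this]

theorem isScattered_norm_eq (hm : IsScatteringModel g h W) (hg : IsMetric g)
    {p q : Euc N × Euc N} (hp : p.2 ≠ 0) (hs : IsScattered g h W p q γ) : ‖q.1‖ = 1 := by
  have h1 := hm.energy_eq_norm_sq hg hs.1 hs.2.2.2 0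
  rw [hs.2.1, hs.2.2.1, energy_initialVelocity hg hp] at h1
  exact (pow_eq_one_iff_of_nonneg (norm_nonneg _) two_ne_zero).1 h1.symm

/-- The same initial data give the same geodesic, and uniqueness from `s = 1` determines the state
at `s = 0`. -/
theorem isScattered_right_unique (hm : IsScatteringModel g h W) (hg : IsMetric g)
    {p q q' : Euc N × Euc N} {γ' : ℝ → Euc N} (hs : IsScattered g h W p q γ)
    (hs' : IsScattered g h W p q' γ') : q = q' := by
  obtain rfl : γ = γ' := hs.1.unique hg hs'.1 (hs.2.1.trans hs'.2.1.symm)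
    (hs.2.2.1.trans hs'.2.2.1.symm)
  have := hs.2.2.2.eqOn hm.isOpen_scatDomain hm.contDiffOn_scatField hs'.2.2.2
    (t₀ := 1) ⟨zero_le_one, le_rfl⟩ (by rw [asympCurve_one, asympCurve_one])
    (show (0 : ℝ) ∈ Set.Icc 0 1 from ⟨le_rfl, zero_le_one⟩)
  rw [asympCurve_zero, asympCurve_zero] at this
  simp only [asympState, Prod.mk.injEq, true_and] at this
  obtain ⟨h1, h2⟩ := this
  rw [h1, neg_inj, add_left_inj] at h2
  exact Prod.ext h1 h2

/-- Uniqueness now runs from `s = 0` to `s = 1`, where `γ 0 = v + y`; the unit covector is recovered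
from the velocity by `codirection`. -/
theorem isScattered_left_unique (hm : IsScatteringModel g h W) (hg : IsMetric g)
    {p p' q : Euc N × Euc N} {γ' : ℝ → Euc N} (hp : ‖p.2‖ = 1) (hp' : ‖p'.2‖ = 1)
    (hs : IsScattered g h W p q γ) (hs' : IsScattered g h W p' q γ') : p = p' := by
  have := hs.2.2.2.eqOn hm.isOpen_scatDomain hm.contDiffOn_scatField hs'.2.2.2
    (t₀ := 0) ⟨le_rfl, zero_le_one⟩ (by rw [asympCurve_zero, asympCurve_zero])
    (show (1 : ℝ) ∈ Set.Icc 0 1 from ⟨zero_le_one, le_rfl⟩)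
  rw [asympCurve_one, asympCurve_one, hs.2.1, hs.2.2.1, hs'.2.1, hs'.2.2.1] at this
  simp only [Prod.mk.injEq, true_and] at this
  obtain ⟨h1, h2⟩ := this
  rw [h1, sub_left_inj] at h2
  refine Prod.ext h2 ?_
  rw [← codirection_initialVelocity hg hp, ← codirection_initialVelocity hg hp', h1, h2]

/-- Every asymptotic line is attained. -/
theorem exists_isScattered_left (hm : IsScatteringModel g h W) (hg : IsMetric g)
    {q : Euc N × Euc N} (hq : ‖q.1‖ = 1) :
    ∃ p γ, ‖p.2‖ = 1 ∧ IsScattered g h W p q γ := by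
  have hq0 : q.1 ≠ 0 := norm_ne_zero_iff.1 (by rw [hq]; exact one_ne_zero)
  obtain ⟨γ, hγ, hc⟩ := hm.exists_isGeodesic_isCurveIn hg (a := asympState q) hq0
  have hE : energy g (γ 0, deriv γ 0) = 1 := by
    rw [hm.energy_eq_norm_sq hg hγ hc, asympState, hq, one_pow]
  have hv : deriv γ 0 ≠ 0 := by
    intro h0
    rw [energy, h0] at hE
    simp [matForm] at hE
  exact ⟨(γ 0, codirection g (γ 0, deriv γ 0)), γ, norm_codirection hg hv, hγ, rfl,
    (initialVelocity_codirection hg hE).symm, hc⟩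

/-- The forward scattering map is smooth, and pulls back the contact form to a multiple of the
contact form. -/
theorem forward_smooth (hm : IsScatteringModel g h W) (hg : IsMetric g)
    {F : Euc N × Euc N → Euc N × Euc N}
    (hF : ∀ p, p.2 ≠ 0 → ∃ γ, IsScattered g h W p (F p) γ) {p₀ : Euc N × Euc N}
    (hp₀ : p₀.2 ≠ 0) :
    ContDiffAt ℝ ∞ F p₀ ∧ ∀ η, inner ℝ (F p₀).1 (fderiv ℝ F p₀ η).2 =
      -(√(cometric g p₀))⁻¹ * inner ℝ p₀.2 η.1 := by
  have hF' : ∀ p, ∃ γ, p.2 ≠ 0 → IsScattered g h W p (F p) γ := fun p => by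
    by_cases hp : p.2 = 0
    · exact ⟨0, fun h => absurd hp h⟩
    · obtain ⟨γ, hγ⟩ := hF p hp
      exact ⟨γ, fun _ => hγ⟩
  choose Γ hΓ using hF'
  have hne : ∀ᶠ p : Euc N × Euc N in 𝓝 p₀, p.2 ≠ 0 :=
    continuousAt_snd.eventually (isOpen_ne.mem_nhds hp₀)
  have hvel := contDiffAt_initialVelocity hg hp₀
  have hI0 : (0 : ℝ) ∈ Set.Icc (0 : ℝ) 1 := ⟨le_rfl, zero_le_one⟩
  have hI1 : (1 : ℝ) ∈ Set.Icc (0 : ℝ) 1 := ⟨zero_le_one, le_rfl⟩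
  -- The data are prescribed at `s = 1` and `F` is read off at `s = 0`.
  obtain ⟨Ψ, hΨ, hΨe, hΨd⟩ := exists_contDiffAt_family hm.isOpen_scatDomain
    hm.contDiffOn_scatField hI1
    (c := fun p => asympCurve (Γ p) (asympState (F p)))
    (x := fun p => ((1 : ℝ), initialVelocity g p, p.1 - initialVelocity g p)) (p₀ := p₀)
    (contDiffAt_const.prodMk (hvel.prodMk (contDiffAt_fst.sub hvel)))
    (by
      filter_upwards [hne] with p hp
      obtain ⟨-, h0, h1, h2⟩ := hΓ p hp
      exact ⟨h2, by rw [asympCurve_one, h0, h1]⟩)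
  set V : ℝ × (Euc N × Euc N) → Euc N := fun q => (Ψ q).2.1 with hV
  set Y : ℝ × (Euc N × Euc N) → Euc N := fun q => (Ψ q).2.2 with hY
  have sV : ∀ s, ContDiffAt ℝ ∞ V (s, p₀) := fun s => (hΨ s).snd.fst
  have sY : ∀ s, ContDiffAt ℝ ∞ Y (s, p₀) := fun s => (hΨ s).snd.snd
  have hFe : F =ᶠ[𝓝 p₀] fun p => (V (0, p), -(Y (0, p) + V (0, p))) := by
    filter_upwards [hΨe] with p hp
    simp only [hV, hY]
    rw [hp 0 hI0, asympCurve_zero, asympState]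
    simp
  have hfst : ∀ s ∈ Set.Ioo (0 : ℝ) 1, ∀ᶠ q in 𝓝 (s, p₀), (Ψ q).1 = q.1 := by
    intro s hs
    filter_upwards [continuousAt_fst.eventually (Ioo_mem_nhds hs.1 hs.2),
      continuousAt_snd.eventually hΨe] with q h1 h2
    rw [h2 q.1 ⟨h1.1.le, h1.2.le⟩, asympCurve_fst]
  have hV0 : V (0, p₀) = (F p₀).1 := by rw [hFe.self_of_nhds]
  have hF1 := hm.isScattered_norm_eq hg hp₀ (hΓ p₀ hp₀)
  have key := hm.pairing_eq hg sV sY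
    (by rw [hV0]; exact norm_ne_zero_iff.1 (by rw [hF1]; exact one_ne_zero))
    (by
      intro s hs
      filter_upwards [hΨd s ⟨hs.1.le, hs.2.le⟩, hfst s hs] with q h1 h2
      refine (hasDerivAt_prod_fst (hasDerivAt_prod_snd h1)).congr_deriv ?_
      rw [scatField, scatPos, h2])
    (by
      intro s hs
      filter_upwards [hΨd s ⟨hs.1.le, hs.2.le⟩, hfst s hs] with q h1 h2
      refine (hasDerivAt_prod_snd (hasDerivAt_prod_snd h1)).congr_deriv ?_
      rw [scatField, scatPos, h2])
    (by
      filter_upwards [hΨe, hne] with p hp hp0 s hs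
      obtain ⟨h1, h2, h3, h4⟩ := hΓ p hp0
      have := hm.scatEnergy_asympCurve hg h1 h4 hs.1
      rw [h2, h3, energy_initialVelocity hg hp0, ← hp s hs, scatEnergy, scatPos, hp s hs,
        asympCurve_fst, ← hp s hs] at this
      exact this)
  have s0V := contDiffAt_slice (sV 0)
  have s0Y := contDiffAt_slice (sY 0)
  refine ⟨(s0V.prodMk (s0Y.add s0V).neg).congr_of_eventuallyEq hFe, fun η => ?_⟩
  obtain ⟨k1, k2⟩ := key η
  have dF : fderiv ℝ F p₀ η = (fderiv ℝ (fun p => V (0, p)) p₀ η,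
      -(fderiv ℝ (fun p => Y (0, p)) p₀ η + fderiv ℝ (fun p => V (0, p)) p₀ η)) := by
    have d1 := (s0V.differentiableAt (by simp)).hasFDerivAt
    have d2 := (s0Y.differentiableAt (by simp)).hasFDerivAt
    have d3 : HasFDerivAt (fun p => (V (0, p), -(Y (0, p) + V (0, p)))) _ p₀ :=
      d1.prodMk (d2.add d1).neg
    rw [(d3.congr_of_eventuallyEq hFe).fderiv]
    rfl
  have e1 : (fun p => V (1, p) + Y (1, p)) =ᶠ[𝓝 p₀] Prod.fst := by
    filter_upwards [hΨe, hne] with p hp hp0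
    simp only [hV, hY]
    rw [hp 1 hI1, asympCurve_one, (hΓ p hp0).2.1, add_sub_cancel]
  have e2 : V (1, p₀) = initialVelocity g p₀ := by
    simp only [hV]
    rw [hΨe.self_of_nhds 1 hI1, asympCurve_one, (hΓ p₀ hp₀).2.2.1]
  rw [e1.fderiv_eq, show V (1, p₀) + Y (1, p₀) = p₀.1 from e1.self_of_nhds, e2, fderiv_fst,
    matForm_initialVelocity hg] at k2
  -- Since `ξ = -(y + v)` at `s = 0` and `⟨v, δv⟩ = 0` there, `⟨θ, dξ⟩ = -⟨θ, δy⟩`, which is minus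
  -- the conserved pairing at `t = 0`.
  rw [dF, ← hV0, inner_neg_right, inner_add_right, k1, k2]
  simp

/-- The inverse scattering map is smooth. -/
theorem backward_smooth (hm : IsScatteringModel g h W) (hg : IsMetric g)
    {G : Euc N × Euc N → Euc N × Euc N}
    (hG : ∀ q, q.1 ≠ 0 → ‖(G q).2‖ = 1 ∧ ∃ γ, IsScattered g h W (G q) (‖q.1‖⁻¹ • q.1, q.2) γ)
    {q₀ : Euc N × Euc N} (hq₀ : q₀.1 ≠ 0) : ContDiffAt ℝ ∞ G q₀ := by
  have hG' : ∀ q, ∃ γ, q.1 ≠ 0 → IsScattered g h W (G q) (‖q.1‖⁻¹ • q.1, q.2) γ := fun q => by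
    by_cases hq : q.1 = 0
    · exact ⟨0, fun h => absurd hq h⟩
    · obtain ⟨-, γ, hγ⟩ := hG q hq
      exact ⟨γ, fun _ => hγ⟩
  choose Γ hΓ using hG'
  have hne : ∀ᶠ q : Euc N × Euc N in 𝓝 q₀, q.1 ≠ 0 :=
    continuousAt_fst.eventually (isOpen_ne.mem_nhds hq₀)
  have hI0 : (0 : ℝ) ∈ Set.Icc (0 : ℝ) 1 := ⟨le_rfl, zero_le_one⟩
  have hI1 : (1 : ℝ) ∈ Set.Icc (0 : ℝ) 1 := ⟨zero_le_one, le_rfl⟩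
  have hu : ContDiffAt ℝ ∞ (fun q : Euc N × Euc N => ‖q.1‖⁻¹ • q.1) q₀ :=
    ((contDiffAt_fst.norm ℝ hq₀).inv (norm_ne_zero_iff.2 hq₀)).smul contDiffAt_fst
  -- Now the data are prescribed at `s = 0`, with normalised direction, and `G` is read off at `s =
  -- 1`.
  obtain ⟨Ψ, hΨ, hΨe, -⟩ := exists_contDiffAt_family hm.isOpen_scatDomain
    hm.contDiffOn_scatField hI0
    (c := fun q => asympCurve (Γ q) (asympState (‖q.1‖⁻¹ • q.1, q.2)))
    (x := fun q => ((0 : ℝ), asympState (‖q.1‖⁻¹ • q.1, q.2))) (p₀ := q₀)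
    (contDiffAt_const.prodMk (hu.prodMk (contDiffAt_snd.add hu).neg))
    (by
      filter_upwards [hne] with q hq
      exact ⟨(hΓ q hq).2.2.2, asympCurve_zero _⟩)
  have hv : ∀ q, q.1 ≠ 0 → (G q).2 ≠ 0 := fun q hq =>
    norm_ne_zero_iff.1 (by rw [(hG q hq).1]; exact one_ne_zero)
  have hGe : G =ᶠ[𝓝 q₀] fun q => ((Ψ (1, q)).2.1 + (Ψ (1, q)).2.2,
      codirection g ((Ψ (1, q)).2.1 + (Ψ (1, q)).2.2, (Ψ (1, q)).2.1)) := by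
    filter_upwards [hΨe, hne] with q h1 h2
    obtain ⟨-, h3, h4, -⟩ := hΓ q h2
    rw [h1 1 hI1, asympCurve_one, h3, h4]
    simp only [add_sub_cancel]
    rw [codirection_initialVelocity hg (hG q h2).1]
  have h1 : (Ψ (1, q₀)).2.1 ≠ 0 := by
    rw [hΨe.self_of_nhds 1 hI1, asympCurve_one]
    simp only
    rw [(hΓ q₀ hq₀).2.2.1]
    exact initialVelocity_ne_zero hg (hv q₀ hq₀)
  have s1 := contDiffAt_slice (hΨ 1)
  have s2 := s1.snd.fst.add s1.snd.snd
  refine (s2.prodMk ?_).congr_of_eventuallyEq hGe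
  exact ContDiffAt.comp (g := codirection g)
    (f := fun q => ((Ψ (1, q)).2.1 + (Ψ (1, q)).2.2, (Ψ (1, q)).2.1)) q₀
    (contDiffAt_codirection hg h1) (s2.prodMk s1.snd.fst)

/-- The asymptotic line of a geodesic. -/
theorem _root_.IsScattered.tendsto {p q : Euc N × Euc N}
    (hs : IsScattered g h W p q γ) :
    Tendsto (fun t => γ t - t • q.1) atTop (𝓝 (-q.2)) := by
  obtain ⟨h1, h2⟩ := hs.2.2.2 0 ⟨le_rfl, zero_le_one⟩
  set c := asympCurve γ (asympState q) with hc
  -- The function is `s γ`. As `dv/ds = s A` vanishes at `s = 0`, its derivative there is `y`; its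
  -- difference quotient is `γ - (t + 1) θ`.
  have d1 : HasDerivWithinAt (fun s => (c s).2.1 + s • (c s).2.2) (-(q.2 + q.1))
      (Set.Icc 0 1) 0 := by
    have e := hasDerivWithinAt_prod_snd h2
    refine ((hasDerivWithinAt_prod_fst e).add ((hasDerivWithinAt_id (0 : ℝ) _).smul
      (hasDerivWithinAt_prod_snd e))).congr_deriv ?_
    rw [hc, asympCurve_zero]
    simp [scatField, asympState]
  have d2 := (hasDerivWithinAt_iff_tendsto_slope' (by simp)).1
    (d1.mono (s := Set.Ioc 0 1) Set.Ioc_subset_Icc_self)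
  rw [nhdsWithin_Ioc_eq_nhdsGT zero_lt_one] at d2
  have d3 : Tendsto (fun t : ℝ => (t + 1)⁻¹) atTop (𝓝[>] 0) :=
    tendsto_inv_atTop_nhdsGT_zero.comp (tendsto_atTop_add_const_right _ 1 tendsto_id)
  have d4 := (d2.comp d3).add_const q.1
  rw [neg_add, add_assoc, neg_add_cancel, add_zero] at d4
  refine d4.congr' ?_
  filter_upwards [eventually_gt_atTop (0 : ℝ)] with t ht
  have ht1 : t + 1 ≠ 0 := by linarith
  rw [Function.comp_apply, slope_def_module, hc, asympCurve_of_ne _ (inv_ne_zero ht1),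
    asympCurve_zero]
  simp only [scatCurve, asympState, inv_inv, add_sub_cancel_right, zero_smul, add_zero, sub_zero,
    smul_sub, smul_add, smul_smul, mul_inv_cancel₀ ht1, inv_mul_cancel₀ ht1, one_smul]
  module

end IsScatteringModel

end ScatteringRelation

/-! ### Sojourn time and angle of contact of an asymptotic line -/

section AsymptoticLine

variable {E : Type*} [NormedAddCommGroup E] [InnerProductSpace ℝ E]

/-- Direction, sojourn time and angle of contact of a curve asymptotic to the line `t θ + B`. -/
theorem tendsto_of_asymptotic_line {γ : ℝ → E} {θ B : E} (hθ : ‖θ‖ = 1)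
    (h : Tendsto (fun t => γ t - t • θ) atTop (𝓝 B)) :
    Tendsto (fun t => ‖γ t‖⁻¹ • γ t) atTop (𝓝 θ) ∧
    Tendsto (fun t => t - ‖γ t‖) atTop (𝓝 (-inner ℝ θ B)) ∧
    Tendsto (fun t => ‖γ t‖ • (θ - ‖γ t‖⁻¹ • γ t)) atTop (𝓝 (inner ℝ θ B • θ - B)) := by
  have hinv : Tendsto (fun t : ℝ => t⁻¹) atTop (𝓝 0) := tendsto_inv_atTop_zero
  have h1 : Tendsto (fun t => t⁻¹ • γ t) atTop (𝓝 θ) := by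
    have := (hinv.smul h).add_const θ
    rw [zero_smul, zero_add] at this
    refine this.congr' ?_
    filter_upwards [eventually_gt_atTop (0 : ℝ)] with t ht
    rw [smul_sub, smul_smul, inv_mul_cancel₀ ht.ne', one_smul, sub_add_cancel]
  have h2 : Tendsto (fun t => t⁻¹ * ‖γ t‖) atTop (𝓝 1) := by
    have := h1.norm
    rw [hθ] at this
    refine this.congr' ?_
    filter_upwards [eventually_gt_atTop (0 : ℝ)] with t ht
    rw [norm_smul, norm_inv, Real.norm_eq_abs, abs_of_pos ht]
  have h3 : Tendsto (fun t => t - ‖γ t‖) atTop (𝓝 (-inner ℝ θ B)) := by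
    -- With `δ = γ - t θ`, the identity `t - |γ| = (t² - |γ|²) / (t + |γ|)` becomes `-(2 ⟨θ, δ⟩ +
    -- |δ|² / t) / (1 + |γ| / t)`.
    have e1 := ((((tendsto_const_nhds (x := θ)).inner (𝕜 := ℝ) h).const_mul 2).add
      (hinv.mul (h.norm.pow 2))).neg.div (h2.const_add 1) (by norm_num)
    have e2 : -(2 * inner ℝ θ B + 0 * ‖B‖ ^ 2) / (1 + 1) = -inner ℝ θ B := by ring
    rw [e2] at e1
    refine e1.congr' ?_
    filter_upwards [eventually_gt_atTop (0 : ℝ)] with t ht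
    have e3 : ‖γ t‖ ^ 2 = t ^ 2 + 2 * t * inner ℝ θ (γ t - t • θ) + ‖γ t - t • θ‖ ^ 2 := by
      conv_lhs => rw [← add_sub_cancel (t • θ) (γ t)]
      rw [norm_add_sq_real, norm_smul, hθ, inner_smul_left, Real.norm_eq_abs, mul_one, sq_abs]
      simp only [conj_trivial]
      ring
    have hpos : 0 < t + ‖γ t‖ := by positivity
    have hpos' : 0 < 1 + t⁻¹ * ‖γ t‖ := by positivity
    change -(2 * inner ℝ θ (γ t - t • θ) + t⁻¹ * ‖γ t - t • θ‖ ^ 2) / (1 + t⁻¹ * ‖γ t‖) = _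
    rw [div_eq_iff hpos'.ne']
    field_simp
    linear_combination e3
  refine ⟨?_, h3, ?_⟩
  · have := (h2.inv₀ one_ne_zero).smul h1
    rw [inv_one, one_smul] at this
    refine this.congr' ?_
    filter_upwards [eventually_gt_atTop (0 : ℝ)] with t ht
    rw [mul_inv, inv_inv, smul_smul, mul_right_comm, mul_inv_cancel₀ ht.ne', one_mul]
  · have hpos : ∀ᶠ t in atTop, 0 < t⁻¹ * ‖γ t‖ := h2.eventually (lt_mem_nhds one_pos)
    -- Here `|γ| θ - γ = -(t - |γ|) θ - (γ - t θ)`.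
    have := (h3.neg.smul_const θ).sub h
    rw [neg_neg] at this
    refine this.congr' ?_
    filter_upwards [hpos] with t ht
    have hne : ‖γ t‖ ≠ 0 := fun h0 => by simp [h0] at ht
    rw [smul_sub, smul_smul, mul_inv_cancel₀ hne, one_smul, neg_sub, sub_smul]
    abel

end AsymptoticLine

/-! ### From the asymptotic line to the sojourn relation -/

section Sojourn

variable {n : ℕ} {g : Euc n → Matrix (Fin n) (Fin n) ℝ} {p : Euc n × Sph n} {γ : ℝ → Euc n}

theorem isGeodesicFrom_iff : IsGeodesicFrom g p γ ↔ IsGeodesic g γ ∧ γ 0 = p.1 ∧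
    deriv γ 0 = initialVelocity g (p.1, (p.2 : Euc n)) := by
  refine and_congr_right fun _ => and_congr_right fun _ => ?_
  exact ⟨fun h => by ext i; exact h i, fun h i => by rw [h]; rfl⟩

theorem IsGeodesicFrom.unique (hg : IsMetric g) {γ' : ℝ → Euc n} (h : IsGeodesicFrom g p γ)
    (h' : IsGeodesicFrom g p γ') : γ = γ' := by
  rw [isGeodesicFrom_iff] at h h'
  exact h.1.unique hg h'.1 (h.2.1.trans h'.2.1.symm) (h.2.2.trans h'.2.2.symm)

/-- With `B = -ξ` the two terms `⟨θ, B⟩ θ` cancel in `λ θ + μ`, leaving `ξ`; uniqueness of geodesics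
and of limits gives the converse. -/
theorem IsGeodesicFrom.isForwardSojourn_iff (hg : IsMetric g) (h : IsGeodesicFrom g p γ)
    {q : Sph n × Euc n} (hlim : Tendsto (fun t => γ t - t • (q.1 : Euc n)) atTop (𝓝 (-q.2)))
    (q' : Sph n × Euc n) : IsForwardSojourn g p q' ↔ q = q' := by
  obtain ⟨h1, h2, h3⟩ := tendsto_of_asymptotic_line (norm_eq_of_mem_sphere q.1) hlim
  have key : (-inner ℝ (q.1 : Euc n) (-q.2)) • (q.1 : Euc n) +
      (inner ℝ (q.1 : Euc n) (-q.2) • (q.1 : Euc n) - -q.2) = q.2 := by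
    rw [neg_smul, sub_neg_eq_add, neg_add_cancel_left]
  constructor
  · rintro ⟨γ', θ, lam, μ, hγ', k1, k2, k3, rfl⟩
    obtain rfl := h.unique hg hγ'
    obtain rfl : q.1 = θ := Subtype.ext (tendsto_nhds_unique h1 k1)
    rw [← tendsto_nhds_unique h2 k2, ← tendsto_nhds_unique h3 k3, key]
  · rintro rfl
    exact ⟨γ, q.1, _, _, h, h1, h2, h3, by rw [key]⟩

end Sojourn

/-! ### Contact diffeomorphisms of the sphere bundles from ambient maps -/

section ContactCriterion

variable {n : ℕ}

/-- The inclusion of the unit sphere bundle. -/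
def cosphereInclusion (p : Euc (n + 1) × Sph (n + 1)) : Euc (n + 1) × Euc (n + 1) := (p.1, p.2)

theorem contMDiff_coe_sph : ContMDiff (𝓡 n) 𝓘(ℝ, Euc (n + 1)) ∞
    ((↑) : Sph (n + 1) → Euc (n + 1)) :=
  haveI := Fact.mk (@finrank_euclideanSpace_fin ℝ _ (n + 1))
  contMDiff_coe_sphere

theorem contMDiff_of_coe_sph {H M : Type*} [TopologicalSpace H] [TopologicalSpace M]
    [ChartedSpace H M] {E : Type*} [NormedAddCommGroup E] [NormedSpace ℝ E]
    {I : ModelWithCorners ℝ E H} [IsManifold I ∞ M] {f : M → Sph (n + 1)}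
    (hf : ContMDiff I 𝓘(ℝ, Euc (n + 1)) ∞ (fun x => (f x : Euc (n + 1)))) :
    ContMDiff I (𝓡 n) ∞ f :=
  haveI := Fact.mk (@finrank_euclideanSpace_fin ℝ _ (n + 1))
  hf.codRestrict_sphere fun x => (f x).2

theorem contMDiff_cosphereInclusion : ContMDiff (cosphereModel n)
    𝓘(ℝ, Euc (n + 1) × Euc (n + 1)) ∞ (cosphereInclusion (n := n)) :=
  contMDiff_fst.prodMk_space (contMDiff_coe_sph.comp contMDiff_snd)

theorem contMDiff_switchedInclusion : ContMDiff (switchedModel n)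
    𝓘(ℝ, Euc (n + 1) × Euc (n + 1)) ∞
    (fun q : Sph (n + 1) × Euc (n + 1) => ((q.1 : Euc (n + 1)), q.2)) :=
  (contMDiff_coe_sph.comp contMDiff_fst).prodMk_space contMDiff_snd

theorem mem_cosphereContact {p : Euc (n + 1) × Sph (n + 1)}
    {X : TangentSpace (cosphereModel n) p} : X ∈ cosphereContact p ↔
      inner ℝ (p.2 : Euc (n + 1)) (mfderiv (cosphereModel n) 𝓘(ℝ, Euc (n + 1)) Prod.fst p X) = 0 :=
  Iff.rfl

theorem mem_switchedContact {q : Sph (n + 1) × Euc (n + 1)}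
    {X : TangentSpace (switchedModel n) q} : X ∈ switchedContact q ↔
      inner ℝ (q.1 : Euc (n + 1)) (mfderiv (switchedModel n) 𝓘(ℝ, Euc (n + 1)) Prod.snd q X) = 0 := by
  have h1 : MDifferentiableAt (switchedModel n) (cosphereModel n)
      (Prod.swap : Sph (n + 1) × Euc (n + 1) → Euc (n + 1) × Sph (n + 1)) q :=
    mdifferentiableAt_snd.prodMk mdifferentiableAt_fst
  have h2 := mfderiv_comp (I' := cosphereModel n) (I'' := 𝓘(ℝ, Euc (n + 1))) q
    (g := Prod.fst) mdifferentiableAt_fst h1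
  have h3 : (Prod.fst ∘ Prod.swap : Sph (n + 1) × Euc (n + 1) → Euc (n + 1)) = Prod.snd := rfl
  rw [h3] at h2
  rw [h2]
  exact Iff.rfl

/-- A criterion for contact diffeomorphisms in terms of ambient extensions. -/
theorem isContactDiffeomorphism_of_ambient
    {F G : Euc (n + 1) × Euc (n + 1) → Euc (n + 1) × Euc (n + 1)}
    {S : Euc (n + 1) × Sph (n + 1) → Sph (n + 1) × Euc (n + 1)}
    (hF : ∀ p, ‖p.2‖ = 1 → ContDiffAt ℝ ∞ F p) (hG : ∀ q, ‖q.1‖ = 1 → ContDiffAt ℝ ∞ G q)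
    (hGn : ∀ q, ‖q.1‖ = 1 → ‖(G q).2‖ = 1) (hFG : ∀ q, ‖q.1‖ = 1 → F (G q) = q)
    (hGF : ∀ p, ‖p.2‖ = 1 → G (F p) = p)
    (hS : ∀ p, F (cosphereInclusion p) = (((S p).1 : Euc (n + 1)), (S p).2))
    (hc : ∀ p, ‖p.2‖ = 1 → ∃ c : ℝ, c ≠ 0 ∧ ∀ η,
      inner ℝ (F p).1 (fderiv ℝ F p η).2 = c * inner ℝ p.2 η.1) :
    IsContactDiffeomorphism S := by
  have hp1 : ∀ p : Euc (n + 1) × Sph (n + 1), ‖(cosphereInclusion p).2‖ = 1 := fun p =>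
    norm_eq_of_mem_sphere p.2
  let J : Sph (n + 1) × Euc (n + 1) → Euc (n + 1) × Euc (n + 1) := fun q => (q.1, q.2)
  have hq1 : ∀ q, ‖(J q).1‖ = 1 := fun q => norm_eq_of_mem_sphere q.1
  have hFs : ContMDiff (cosphereModel n) 𝓘(ℝ, Euc (n + 1) × Euc (n + 1)) ∞
      (fun p => F (cosphereInclusion p)) := fun p =>
    (hF _ (hp1 p)).contMDiffAt.comp p (contMDiff_cosphereInclusion p)
  have hGs : ContMDiff (switchedModel n) 𝓘(ℝ, Euc (n + 1) × Euc (n + 1)) ∞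
      (fun q => G (J q)) := fun q =>
    (hG _ (hq1 q)).contMDiffAt.comp q (contMDiff_switchedInclusion q)
  let T : Sph (n + 1) × Euc (n + 1) → Euc (n + 1) × Sph (n + 1) := fun q =>
    ((G (J q)).1, ⟨(G (J q)).2, mem_sphere_zero_iff_norm.2 (hGn _ (hq1 q))⟩)
  have hT : ∀ q, cosphereInclusion (T q) = G (J q) := fun q => rfl
  have hJ : Function.Injective J := fun q q' h =>
    Prod.ext (Subtype.ext (Prod.ext_iff.1 h).1) (Prod.ext_iff.1 h).2
  have hι : Function.Injective (cosphereInclusion (n := n)) := fun p p' h =>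
    Prod.ext (Prod.ext_iff.1 h).1 (Subtype.ext (Prod.ext_iff.1 h).2)
  have hSs : ContMDiff (cosphereModel n) (switchedModel n) ∞ S := by
    have h1 : ContMDiff (cosphereModel n) 𝓘(ℝ, Euc (n + 1)) ∞
        (fun p => ((S p).1 : Euc (n + 1))) := by
      refine ((ContinuousLinearMap.fst ℝ (Euc (n + 1)) (Euc (n + 1))).contMDiff.comp hFs).congr
        fun p => ?_
      simp [hS]
    have h2 : ContMDiff (cosphereModel n) 𝓘(ℝ, Euc (n + 1)) ∞ (fun p => (S p).2) := by
      refine ((ContinuousLinearMap.snd ℝ (Euc (n + 1)) (Euc (n + 1))).contMDiff.comp hFs).congr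
        fun p => ?_
      simp [hS]
    exact (contMDiff_of_coe_sph h1).prodMk h2
  have hTs : ContMDiff (switchedModel n) (cosphereModel n) ∞ T :=
    ((ContinuousLinearMap.fst ℝ (Euc (n + 1)) (Euc (n + 1))).contMDiff.comp hGs).prodMk
      (contMDiff_of_coe_sph
        ((ContinuousLinearMap.snd ℝ (Euc (n + 1)) (Euc (n + 1))).contMDiff.comp hGs))
  let Φ : (Euc (n + 1) × Sph (n + 1)) ≃ₘ^∞⟮cosphereModel n, switchedModel n⟯
      (Sph (n + 1) × Euc (n + 1)) :=
    { toFun := S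
      invFun := T
      left_inv := fun p => hι (by
        rw [hT, show J (S p) = F (cosphereInclusion p) from (hS p).symm, hGF _ (hp1 p)])
      right_inv := fun q => hJ (by
        rw [show J (S (T q)) = F (cosphereInclusion (T q)) from (hS _).symm, hT, hFG _ (hq1 q)])
      contMDiff_toFun := hSs
      contMDiff_invFun := hTs }
  refine ⟨⟨Φ, fun p => rfl⟩, fun p => ?_⟩
  obtain ⟨c, hc0, hcη⟩ := hc _ (hp1 p)
  -- The chain rule for `Prod.snd ∘ S = Prod.snd ∘ F ∘ cosphereInclusion` shows that `∑ θ_i dξⁱ`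
  -- pulls back to `c` times the canonical form; `c ≠ 0` gives equality of kernels.
  have key : ∀ X : TangentSpace (cosphereModel n) p, X ∈ cosphereContact p ↔
      mfderiv (cosphereModel n) (switchedModel n) S p X ∈ switchedContact (S p) := by
    intro X
    have dS : MDifferentiableAt (cosphereModel n) (switchedModel n) S p :=
      (hSs p).mdifferentiableAt (by simp)
    have dι := (contMDiff_cosphereInclusion p).mdifferentiableAt (by simp : (∞ : WithTop ℕ∞) ≠ 0)
    have dF : MDifferentiableAt 𝓘(ℝ, Euc (n + 1) × Euc (n + 1)) 𝓘(ℝ, Euc (n + 1) × Euc (n + 1)) F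
        (cosphereInclusion p) :=
      ((hF _ (hp1 p)).differentiableAt (by simp)).mdifferentiableAt
    have e1 := mfderiv_comp (I'' := 𝓘(ℝ, Euc (n + 1))) p (g := Prod.snd) mdifferentiableAt_snd dS
    have e2 : Prod.snd ∘ S =
        ContinuousLinearMap.snd ℝ (Euc (n + 1)) (Euc (n + 1)) ∘ (F ∘ cosphereInclusion) := by
      ext1 p
      simp [hS]
    have e3 := mfderiv_comp (I'' := 𝓘(ℝ, Euc (n + 1))) p
      (g := ContinuousLinearMap.snd ℝ (Euc (n + 1)) (Euc (n + 1)))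
      (ContinuousLinearMap.snd ℝ (Euc (n + 1)) (Euc (n + 1))).mdifferentiableAt (dF.comp p dι)
    have e4 := mfderiv_comp p dF dι
    have e5 := mfderiv_comp (I'' := 𝓘(ℝ, Euc (n + 1))) p
      (g := ContinuousLinearMap.fst ℝ (Euc (n + 1)) (Euc (n + 1)))
      (ContinuousLinearMap.fst ℝ (Euc (n + 1)) (Euc (n + 1))).mdifferentiableAt dι
    have e6 : ContinuousLinearMap.fst ℝ (Euc (n + 1)) (Euc (n + 1)) ∘ cosphereInclusion (n := n) =
        Prod.fst := rfl
    rw [e6] at e5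
    rw [e2, e3, e4, ContinuousLinearMap.mfderiv_eq, mfderiv_eq_fderiv] at e1
    rw [ContinuousLinearMap.mfderiv_eq] at e5
    have e7 := congrArg (fun A : TangentSpace (cosphereModel n) p →L[ℝ] Euc (n + 1) => A X) e1
    have e8 := congrArg (fun A : TangentSpace (cosphereModel n) p →L[ℝ] Euc (n + 1) => A X) e5
    have e9 := hcη (mfderiv (cosphereModel n) 𝓘(ℝ, Euc (n + 1) × Euc (n + 1)) cosphereInclusion p X)
    rw [mem_cosphereContact, mem_switchedContact]
    have e10 : inner ℝ ((S p).1 : Euc (n + 1)) (mfderiv (switchedModel n) 𝓘(ℝ, Euc (n + 1))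
        Prod.snd (S p) (mfderiv (cosphereModel n) (switchedModel n) S p X)) =
        c * inner ℝ (p.2 : Euc (n + 1))
          (mfderiv (cosphereModel n) 𝓘(ℝ, Euc (n + 1)) Prod.fst p X) := by
      refine Eq.trans ?_ (e9.trans ?_)
      · rw [hS]
        exact congrArg (fun u : Euc (n + 1) => inner ℝ ((S p).1 : Euc (n + 1)) u) e7.symm
      · exact congrArg (fun u : Euc (n + 1) => c * inner ℝ (p.2 : Euc (n + 1)) u) e8.symm
    rw [e10, mul_eq_zero, or_iff_right hc0]
  ext X'
  rw [Submodule.mem_map]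
  constructor
  · rintro ⟨X, hX, rfl⟩
    exact (key X).1 hX
  · intro hX'
    -- The differential of a diffeomorphism is invertible, so preserving membership both ways makes
    -- the image the whole hyperplane.
    let A := Φ.mfderivToContinuousLinearEquiv (by simp) p
    have hA : ∀ X, mfderiv (cosphereModel n) (switchedModel n) S p X = A X := fun X => rfl
    refine ⟨A.symm X', (key _).2 ?_, ?_⟩
    · rw [hA, A.apply_symm_apply]
      exact hX'
    · exact (hA _).trans (A.apply_symm_apply X')

end ContactCriterion

end

/-- The time reversal of a contact diffeomorphism given by ambient extensions. -/
theorem isContactDiffeomorphism_reverse {n : ℕ}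
    {F G : Euc (n + 1) × Euc (n + 1) → Euc (n + 1) × Euc (n + 1)}
    {S : Euc (n + 1) × Sph (n + 1) → Sph (n + 1) × Euc (n + 1)}
    (hF : ∀ p, ‖p.2‖ = 1 → ContDiffAt ℝ ∞ F p) (hG : ∀ q, ‖q.1‖ = 1 → ContDiffAt ℝ ∞ G q)
    (hGn : ∀ q, ‖q.1‖ = 1 → ‖(G q).2‖ = 1) (hFG : ∀ q, ‖q.1‖ = 1 → F (G q) = q)
    (hGF : ∀ p, ‖p.2‖ = 1 → G (F p) = p)
    (hS : ∀ p, F (cosphereInclusion p) = (((S p).1 : Euc (n + 1)), (S p).2))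
    (hc : ∀ p, ‖p.2‖ = 1 → ∃ c : ℝ, c ≠ 0 ∧ ∀ η,
      inner ℝ (F p).1 (fderiv ℝ F p η).2 = c * inner ℝ p.2 η.1) :
    IsContactDiffeomorphism (fun p => -S (p.1, -p.2)) := by
  let σ : Euc (n + 1) × Euc (n + 1) →L[ℝ] Euc (n + 1) × Euc (n + 1) :=
    (ContinuousLinearMap.fst ℝ _ _).prod (-ContinuousLinearMap.snd ℝ _ _)
  have hσ : ∀ p, σ p = (p.1, -p.2) := fun p => rfl
  have hσσ : ∀ p, σ (σ p) = p := fun p => by simp [hσ]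
  have hσn : ∀ p, ‖p.2‖ = 1 → ‖(σ p).2‖ = 1 := fun p hp => by rwa [hσ, norm_neg]
  have hn : ∀ q : Euc (n + 1) × Euc (n + 1), ‖q.1‖ = 1 → ‖(-q).1‖ = 1 := fun q hq => by
    rwa [Prod.fst_neg, norm_neg]
  refine isContactDiffeomorphism_of_ambient (F := fun p => -F (σ p)) (G := fun q => σ (G (-q)))
    (fun p hp => ?_) (fun q hq => ?_) (fun q hq => ?_) (fun q hq => ?_) (fun p hp => ?_)
    (fun p => ?_) (fun p hp => ?_)
  · exact (ContDiffAt.comp (g := F) (f := σ) p (hF _ (hσn p hp)) σ.contDiff.contDiffAt).neg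
  · exact σ.contDiff.contDiffAt.comp q
      (ContDiffAt.comp (g := G) (f := fun q => -q) q (hG _ (hn q hq)) contDiffAt_id.neg)
  · exact hσn _ (hGn _ (hn q hq))
  · simp only [hσσ]
    rw [hFG _ (hn q hq), neg_neg]
  · simp only [neg_neg]
    rw [hGF _ (hσn p hp), hσσ]
  · have := hS (p.1, -p.2)
    change -F (p.1, -(p.2 : Euc (n + 1))) = _
    rw [show ((p.1, -(p.2 : Euc (n + 1))) : Euc (n + 1) × Euc (n + 1)) =
      cosphereInclusion (p.1, -p.2) from rfl, this]
    rfl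
  · obtain ⟨c, hc0, hcη⟩ := hc _ (hσn p hp)
    refine ⟨-c, neg_ne_zero.2 hc0, fun η => ?_⟩
    have hd : HasFDerivAt (fun p => -F (σ p)) (-(fderiv ℝ F (σ p)).comp σ) p :=
      (HasFDerivAt.comp p ((hF _ (hσn p hp)).differentiableAt (by simp)).hasFDerivAt
        σ.hasFDerivAt).neg
    have h1 := hcη (σ η)
    rw [hd.fderiv]
    change inner ℝ (-(F (σ p)).1) (-(fderiv ℝ F (σ p) (σ η)).2) = _
    rw [inner_neg_neg, h1, hσ, hσ, inner_neg_left]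
    ring

/-! ### Assembly of the forward and backward sojourn maps -/

theorem mainTheorem4 (n : ℕ) (g : Euc (n + 1) → Matrix (Fin (n + 1)) (Fin (n + 1)) ℝ)
    (hg : IsMetric g) (hsr : IsShortRange g) (hnt : IsNontrapping g) :
    (∀ p : Euc (n + 1) × Sph (n + 1), ∃! γ : ℝ → Euc (n + 1), IsGeodesicFrom g p γ) ∧
    ∃ Sf Sb : Euc (n + 1) × Sph (n + 1) → Sph (n + 1) × Euc (n + 1),
      (∀ p q, IsForwardSojourn g p q ↔ Sf p = q) ∧
      (∀ p q, IsBackwardSojourn g p q ↔ Sb p = q) ∧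
      IsContactDiffeomorphism Sf ∧ IsContactDiffeomorphism Sb := by
  obtain ⟨h, W, hm⟩ := exists_isScatteringModel hg hsr
  have hF : ∀ p : Euc (n + 1) × Euc (n + 1), ∃ q, p.2 ≠ 0 → ∃ γ, IsScattered g h W p q γ :=
    fun p => by
      by_cases hp : p.2 = 0
      · exact ⟨0, fun h => absurd hp h⟩
      · obtain ⟨q, hq⟩ := hm.exists_isScattered hg hnt hp
        exact ⟨q, fun _ => hq⟩
  choose F hF using hF
  -- An asymptotic direction must be a unit vector, so off the sphere `G` is defined through the
  -- normalised direction; no such step is needed for `F`, since `initialVelocity` normalises the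
  -- covector itself.
  have hG : ∀ q : Euc (n + 1) × Euc (n + 1), ∃ p : Euc (n + 1) × Euc (n + 1), q.1 ≠ 0 →
      ‖p.2‖ = 1 ∧ ∃ γ, IsScattered g h W p (‖q.1‖⁻¹ • q.1, q.2) γ := fun q => by
    by_cases hq : q.1 = 0
    · exact ⟨0, fun h => absurd hq h⟩
    · obtain ⟨p, γ, hp, hγ⟩ := hm.exists_isScattered_left hg (q := (‖q.1‖⁻¹ • q.1, q.2))
        (norm_smul_inv_norm (𝕜 := ℝ) hq)
      exact ⟨p, fun _ => ⟨hp, γ, hγ⟩⟩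
  choose G hG using hG
  have hne : ∀ {x : Euc (n + 1)}, ‖x‖ = 1 → x ≠ 0 := fun hx =>
    norm_ne_zero_iff.1 (by rw [hx]; exact one_ne_zero)
  have hFn : ∀ p : Euc (n + 1) × Euc (n + 1), ‖p.2‖ = 1 → ‖(F p).1‖ = 1 := fun p hp => by
    obtain ⟨γ, hγ⟩ := hF p (hne hp)
    exact hm.isScattered_norm_eq hg (hne hp) hγ
  have hGs : ∀ q : Euc (n + 1) × Euc (n + 1), ‖q.1‖ = 1 → ∃ γ, IsScattered g h W (G q) q γ :=
    fun q hq => by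
      obtain ⟨-, γ, hγ⟩ := hG q (hne hq)
      rw [hq, inv_one, one_smul] at hγ
      exact ⟨γ, hγ⟩
  have hGn : ∀ q : Euc (n + 1) × Euc (n + 1), ‖q.1‖ = 1 → ‖(G q).2‖ = 1 := fun q hq =>
    (hG q (hne hq)).1
  have hFG : ∀ q : Euc (n + 1) × Euc (n + 1), ‖q.1‖ = 1 → F (G q) = q := fun q hq => by
    obtain ⟨γ, hγ⟩ := hGs q hq
    obtain ⟨γ', hγ'⟩ := hF (G q) (hne (hGn q hq))
    exact hm.isScattered_right_unique hg hγ' hγ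
  have hGF : ∀ p : Euc (n + 1) × Euc (n + 1), ‖p.2‖ = 1 → G (F p) = p := fun p hp => by
    obtain ⟨γ, hγ⟩ := hF p (hne hp)
    obtain ⟨γ', hγ'⟩ := hGs (F p) (hFn p hp)
    exact hm.isScattered_left_unique hg (hGn _ (hFn p hp)) hp hγ' hγ
  have hp1 : ∀ p : Euc (n + 1) × Sph (n + 1), ‖(cosphereInclusion p).2‖ = 1 := fun p =>
    norm_eq_of_mem_sphere p.2
  let S : Euc (n + 1) × Sph (n + 1) → Sph (n + 1) × Euc (n + 1) := fun p =>
    (⟨(F (cosphereInclusion p)).1, mem_sphere_zero_iff_norm.2 (hFn _ (hp1 p))⟩,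
      (F (cosphereInclusion p)).2)
  have hgeo : ∀ p, ∃ γ, IsGeodesicFrom g p γ ∧
      Tendsto (fun t => γ t - t • ((S p).1 : Euc (n + 1))) atTop (𝓝 (-(S p).2)) := fun p => by
    obtain ⟨γ, hγ⟩ := hF (cosphereInclusion p) (hne (hp1 p))
    exact ⟨γ, isGeodesicFrom_iff.2 ⟨hγ.1, hγ.2.1, hγ.2.2.1⟩, hγ.tendsto⟩
  have hS : ∀ p q, IsForwardSojourn g p q ↔ S p = q := fun p q => by
    obtain ⟨γ, hγ, hlim⟩ := hgeo p
    exact hγ.isForwardSojourn_iff hg hlim q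
  have hFc : ∀ p : Euc (n + 1) × Euc (n + 1), ‖p.2‖ = 1 → ContDiffAt ℝ ∞ F p := fun p hp =>
    (hm.forward_smooth hg hF (hne hp)).1
  have hGc : ∀ q : Euc (n + 1) × Euc (n + 1), ‖q.1‖ = 1 → ContDiffAt ℝ ∞ G q := fun q hq =>
    hm.backward_smooth hg hG (hne hq)
  have hc : ∀ p : Euc (n + 1) × Euc (n + 1), ‖p.2‖ = 1 → ∃ c : ℝ, c ≠ 0 ∧ ∀ η,
      inner ℝ (F p).1 (fderiv ℝ F p η).2 = c * inner ℝ p.2 η.1 := fun p hp =>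
    ⟨_, neg_ne_zero.2 (inv_ne_zero (Real.sqrt_pos.2 (cometric_pos hg (hne hp))).ne'),
      (hm.forward_smooth hg hF (hne hp)).2⟩
  refine ⟨fun p => ?_, S, fun p => -S (p.1, -p.2), hS, fun p q => ?_,
    isContactDiffeomorphism_of_ambient hFc hGc hGn hFG hGF (fun p => rfl) hc,
    isContactDiffeomorphism_reverse hFc hGc hGn hFG hGF (fun p => rfl) hc⟩
  · obtain ⟨γ, hγ, -⟩ := hgeo p
    exact ⟨γ, hγ, fun γ' hγ' => hγ'.unique hg hγ⟩
  · exact (hS _ _).trans neg_eq_iff_eq_neg.symm
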